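/- **Machine.** Programs run on a word RAM with words of $w$ bits, where $n<2^w$. They have finitely many registers (each holding one word), arithmetic on words, tests, loops, and packed arrays, i.e. arrays whose cells have a fixed number of bits. Every instruction and every test costs one step. **Structure.** Let $n\ge 1$ and let $\pi$ be a permutation of an $n$-element set $[n]$. A *forest of splay trees* (FST) of $\pi$ consists of one binary tree for each cycle of $\pi$, keyed by position in the cycle: the in-order traversal of the tree is the cycle, written from some element on. A primitive change of a forest is one of the following: - splaying a node to the root of its tree (by zig, zig-zig and zig-zag steps); - splitting a tree by cutting the right edge of its root; - joining two trees by attaching one of them as right subtree to the root of the other, that has no right child; - reversing the subtree rooted at some node. The forest is stored in a matrix with three rows of $n$ entries of $\lceil\log_2(n+1)\rceil$ bits each, with two further bits per element, and a counter of $\lceil\log_2(n+1)\rceil$ bits that holds the number of cycles. For an element $x$, row 1 holds its left child (its right child if there is no left child, NIL if there is no child). Row 2 holds its right sibling if $x$ is a left child with a right sibling, otherwise its parent (NIL at a root). Row 3 holds the size of the subtree of $x$. One of the two bits is the sign of the size, where a negative sign means that the whole subtree is to be read in reverse (so reversals are carried out lazily). The other bit tells whether $x$ is a right child. **Theorem.**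 There are programs, one for the construction and one for each operation below, and constants $C$ and $K$, all independent of $n$, $w$ and $\pi$, such that for every $n\ge 1$, every $w$ with $n<2^w$ and every permutation $\pi$ of $[n]$ the following holds. 1. (Space) The FST occupies at most $3n\log_2 n+Cn$ bits. 2. (Construction) From the one-line representation of $\pi$, the construction program builds an FST of $\pi$ in at most $Cn$ steps; it may use temporarily a constant number of further arrays of $n$ words. 3. (Operations) For every sequence of $m$ operations that is performed after the construction, the total number of steps of these operations is at most $C\,(n+m(1+\log_2 n))$; that is, each operation takes $O(\log n)$ amortized time. Every operation accesses only the stored FST and registers, returns the correct answer for the current permutation $\pi$, replaces the FST of $\pi$ by an FST of the new permutation, and does so by at most $K$ primitive changes of the forest. The operations, with $i,j\in[n]$ and an integer $0\le k<2^w$, are: - the queries $\pi(i)$, $\pi^{-1}(j)$, $\pi^k(i)$ and $\pi^{-k}(j)$; - the number of cycles of $\pi$ (fixed points included), and the number of elements in the cycle of $i$; - whether $i$ and $j$ are in the same cycle; - the distance $\min\{d\ge 0:\pi^d(i)=j\}$, which is $\infty$ if there is no such $d$; - the updates $\pi\mapsto (i,j)\cdot\pi$ and $\pi\mapsto(\pi(i),\pi(j))\cdot\pi$,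 where $(a,b)$ exchanges $a$ and $b$ and is applied after $\pi$; - the flip, for $i$ and $j$ in the same cycle: if this cycle, written from $i$ on, is $(i,\dots,j,c,\dots,c')$, it is replaced by $(j,\dots,i,c,\dots,c')$, where the part $c,\dots,c'$ may be empty. -/

import Mathlib

namespace FST

/-! ### A word RAM with packed arrays and a step count

Registers hold words of `w` bits. Memory consists of arrays; the cells of array `a` are `len a` many
and `width a` bits wide, so that a layout determines exactly how many bits may be touched. -/

/-- Binary operations of the machine on words. -/
inductive BinOp
  | add | sub | mul | div | mod

/-- Sums and products wrap around, differences stop at `0`, and `x / 0 = 0`, `x % 0 = x`. -/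
def BinOp.eval (w : ℕ) : BinOp → ℕ → ℕ → ℕ
  | .add, x, y => (x + y) % 2 ^ w
  | .sub, x, y => x - y
  | .mul, x, y => (x * y) % 2 ^ w
  | .div, x, y => x / y
  | .mod, x, y => x % y

/-- Tests on registers. -/
inductive Test
  | eq (a b : ℕ)
  | lt (a b : ℕ)

def Test.eval (reg : ℕ → ℕ) : Test → Bool
  | .eq a b => decide (reg a = reg b)
  | .lt a b => decide (reg a < reg b)

/-- Programs. The numbers `d`, `x`, `y`, `i`, `s` name registers, `a` names an array. -/
inductive Cmd
  | skip
  | const (d c : ℕ)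
  | bin (o : BinOp) (d x y : ℕ)
  | load (d a i : ℕ)
  | store (a i s : ℕ)
  | seq (p q : Cmd)
  | branch (c : Test) (p q : Cmd)
  | loop (c : Test) (p : Cmd)

/-- Array names, to indices, to contents. -/
abbrev Memory := ℕ → ℕ → ℕ

structure State where
  reg : ℕ → ℕ
  mem : Memory

structure Layout where
  len : ℕ → ℕ
  width : ℕ → ℕ

/-- `Exec w L p s s' t`: started in state `s`, on words of `w` bits and arrays as in `L`, the program
`p` halts in state `s'` after exactly `t` steps. Every instruction and every test costs one step.
Accesses outside of an array, and stores of numbers too long for the cell, are stuck. -/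
inductive Exec (w : ℕ) (L : Layout) : Cmd → State → State → ℕ → Prop
  | skip (s : State) : Exec w L .skip s s 1
  | const (s : State) (d c : ℕ) :
      Exec w L (.const d c) s ⟨Function.update s.reg d (c % 2 ^ w), s.mem⟩ 1
  | bin (s : State) (o : BinOp) (d x y : ℕ) :
      Exec w L (.bin o d x y) s
        ⟨Function.update s.reg d (o.eval w (s.reg x) (s.reg y)), s.mem⟩ 1
  | load (s : State) (d a i : ℕ) (hi : s.reg i < L.len a) :
      Exec w L (.load d a i) s ⟨Function.update s.reg d (s.mem a (s.reg i)), s.mem⟩ 1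
  | store (s : State) (a i x : ℕ) (hi : s.reg i < L.len a) (hx : s.reg x < 2 ^ L.width a) :
      Exec w L (.store a i x) s
        ⟨s.reg, Function.update s.mem a (Function.update (s.mem a) (s.reg i) (s.reg x))⟩ 1
  | seq {p q : Cmd} {s₁ s₂ s₃ : State} {t₁ t₂ : ℕ} (hp : Exec w L p s₁ s₂ t₁)
      (hq : Exec w L q s₂ s₃ t₂) : Exec w L (.seq p q) s₁ s₃ (t₁ + t₂)
  | branchTrue {c : Test} {p q : Cmd} {s s' : State} {t : ℕ} (hc : c.eval s.reg = true)
      (hp : Exec w L p s s' t) : Exec w L (.branch c p q) s s' (1 + t)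
  | branchFalse {c : Test} {p q : Cmd} {s s' : State} {t : ℕ} (hc : c.eval s.reg = false)
      (hq : Exec w L q s s' t) : Exec w L (.branch c p q) s s' (1 + t)
  | loopStop {c : Test} {p : Cmd} {s : State} (hc : c.eval s.reg = false) :
      Exec w L (.loop c p) s s 1
  | loopStep {c : Test} {p : Cmd} {s₁ s₂ s₃ : State} {t₁ t₂ : ℕ} (hc : c.eval s₁.reg = true)
      (hp : Exec w L p s₁ s₂ t₁) (hl : Exec w L (.loop c p) s₂ s₃ t₂) :
      Exec w L (.loop c p) s₁ s₃ (1 + t₁ + t₂)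

/-! ### Splay trees

Trees have elements of `{0, …, n - 1}` as values; the key of an element is its position in the
in-order traversal. -/

/-- In-order traversal. -/
def inorder {α : Type} : BinaryTree α → List α
  | .nil => []
  | .node x l r => inorder l ++ x :: inorder r

/-- The reversed tree. -/
def mirror {α : Type} : BinaryTree α → BinaryTree α
  | .nil => .nil
  | .node x l r => .node x (mirror r) (mirror l)

/-- Reverse the subtree that is rooted at `v`. -/
def mirrorAt {α : Type} [DecidableEq α] (v : α) : BinaryTree α → BinaryTree α
  | .nil => .nil
  | .node x l r =>
    if x = v then mirror (.node x l r) else .node x (mirrorAt v l) (mirrorAt v r)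

/-- One step of the way up from a node: the node is the left child of `p`, whose right subtree is
`t` (`inLeft p t`), or the right child of `p`, whose left subtree is `t` (`inRight p t`). -/
inductive Frame (α : Type)
  | inLeft (p : α) (t : BinaryTree α)
  | inRight (p : α) (t : BinaryTree α)

/-- The left and right subtree of the node `x` and the way from it up to the root. -/
def locate {α : Type} [DecidableEq α] (x : α) :
    BinaryTree α → List (Frame α) → Option (BinaryTree α × BinaryTree α × List (Frame α))
  | .nil, _ => none
  | .node y l r, path =>
    if y = x then some (l, r, path)
    else match locate x l (.inLeft y r :: path) with
      | some z => some z
      | none => locate x r (.inRight y l :: path)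

/-- Bottom-up splaying of the node `x` with subtrees `l` and `r` along the given way to the root:
zig if the parent is the root, otherwise zig-zig or zig-zag. -/
def splayUp {α : Type} (x : α) : BinaryTree α → BinaryTree α → List (Frame α) → BinaryTree α
  | l, r, [] => .node x l r
  | l, r, [.inLeft p c] => .node x l (.node p r c)
  | l, r, [.inRight p c] => .node x (.node p c l) r
  | l, r, .inLeft p c :: .inLeft g d :: path => splayUp x l (.node p r (.node g c d)) path
  | l, r, .inRight p c :: .inRight g d :: path => splayUp x (.node p (.node g d c) l) r path
  | l, r, .inRight p c :: .inLeft g d :: path => splayUp x (.node p c l) (.node g r d) path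
  | l, r, .inLeft p c :: .inRight g d :: path => splayUp x (.node g d l) (.node p r c) path

/-- Splaying the node `x` to the root of its tree. -/
def splay {α : Type} [DecidableEq α] (x : α) (t : BinaryTree α) : BinaryTree α :=
  match locate x t [] with
  | some (l, r, path) => splayUp x l r path
  | none => t

/-- A forest on `{0, …, n - 1}`: each element is mapped to the tree that contains it. -/
abbrev Forest (n : ℕ) := Fin n → BinaryTree (Fin n)

/-- Make `t` the tree of all of its elements. -/
def Forest.set {n : ℕ} (F : Forest n) (t : BinaryTree (Fin n)) : Forest n :=
  fun y => if y ∈ inorder t then t else F y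

/-- The primitive changes of a forest of splay trees: splay a node; split a tree by cutting the right
edge of its root; join two trees by hanging one as right subtree under the root of the other, that
has no right child; reverse the subtree of a node. -/
inductive Move {n : ℕ} : Forest n → Forest n → Prop
  | splay (F : Forest n) (x : Fin n) : Move F (F.set (splay x (F x)))
  | split (F : Forest n) (x : Fin n) (l r : BinaryTree (Fin n)) (h : F x = .node x l r) :
      Move F ((F.set (.node x l .nil)).set r)
  | join (F : Forest n) (x y : Fin n) (l : BinaryTree (Fin n)) (h : F x = .node x l .nil)
      (hy : y ∉ inorder (F x)) : Move F (F.set (.node x l (F y)))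
  | flip (F : Forest n) (v : Fin n) : Move F (F.set (mirrorAt v (F v)))

/-- `Moves k F F'`: `F'` results from `F` by exactly `k` primitive changes. -/
inductive Moves {n : ℕ} : ℕ → Forest n → Forest n → Prop
  | zero (F : Forest n) : Moves 0 F F
  | succ {k : ℕ} {F G H : Forest n} (h : Moves k F G) (hm : Move G H) : Moves (k + 1) F H

/-- The number of cycles of a permutation, fixed points included. -/
noncomputable def numCycles {n : ℕ} (π : Equiv.Perm (Fin n)) : ℕ :=
  Nat.card (Quotient (Equiv.Perm.SameCycle.setoid π))

/-- The trees of the forest are disjoint, there is one for each cycle of `π`, and its in-order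
traversal is that cycle, written from one of its elements on. -/
structure Represents {n : ℕ} (F : Forest n) (π : Equiv.Perm (Fin n)) : Prop where
  nodup : ∀ x, (inorder (F x)).Nodup
  mem : ∀ x, x ∈ inorder (F x)
  same : ∀ x, ∀ y ∈ inorder (F x), F y = F x
  cycle : ∀ x, (inorder (F x)).formPerm = π.cycleOf x

/-! ### The matrix

Five arrays of length `n` and a counter. For an element `x`, with NIL coded by `n`:
* array 0: the left child of `x`; its right child if it has no left child; NIL if it is a leaf;
* array 1: the right sibling of `x` if `x` is a left child with a right sibling; the parent of `x`
  if it is any other child; NIL if `x` is a root;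
* array 2: the size of the subtree of `x`, and array 3: its sign (1 is negative);
* array 4: a bit that is 1 iff `x` is a right child;
* array 5: one cell, with the number of cycles. -/

/-- The arrays of the forest, and no others. -/
def fstLayout (n : ℕ) : Layout where
  len a := if a < 5 then n else if a = 5 then 1 else 0
  width a := if a < 3 ∨ a = 5 then Nat.clog 2 (n + 1) else if a < 5 then 1 else 0

/-- The number of bits that the forest occupies. -/
def fstBits (n : ℕ) : ℕ :=
  ∑ a ∈ Finset.range 6, (fstLayout n).len a * (fstLayout n).width a

/-- The tree that is meant by a tree with signs: a negative sign reverses the whole subtree.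
The first argument tells whether the tree is to be read reversed on account of signs above. -/
def unfold {n : ℕ} : Bool → BinaryTree (Bool × Fin n) → BinaryTree (Fin n)
  | _, .nil => .nil
  | rev, .node (neg, x) l r =>
    if xor rev neg then .node x (unfold true r) (unfold true l)
    else .node x (unfold false l) (unfold false r)

/-- The root of a tree with signs, `d` if the tree is empty. -/
def rootOr {n : ℕ} (d : ℕ) : BinaryTree (Bool × Fin n) → ℕ
  | .nil => d
  | .node (_, x) _ _ => x

/-- The memory `A` stores the given tree with signs, where `link` and `side` are the entries of
the root in the arrays 1 and 4. -/
def Stored {n : ℕ} (A : Memory) : ℕ → ℕ → BinaryTree (Bool × Fin n) → Prop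
  | _, _, .nil => True
  | link, side, .node (neg, x) l r =>
    A 0 x = rootOr (rootOr n r) l ∧ A 1 x = link ∧
    A 2 x = (BinaryTree.node (neg, x) l r).numNodes ∧ A 3 x = neg.toNat ∧ A 4 x = side ∧
    Stored A (rootOr x r) 0 l ∧ Stored A x 1 r

/-- The memory `A` holds the forest of splay trees `F` of the permutation `π`. -/
structure IsFST {n : ℕ} (A : Memory) (F : Forest n) (π : Equiv.Perm (Fin n)) : Prop where
  represents : Represents F π
  stored : ∀ x, ∃ T, unfold false T = F x ∧ Stored A n 0 T
  counter : A 5 0 = numCycles π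

/-! ### Construction -/

/-- During the construction there are, besides the arrays of the forest, the array 6 with the
one-line representation of the permutation, and arrays of `n` words each as temporary work space. -/
def buildLayout (n w : ℕ) : Layout where
  len a := if a < 6 then (fstLayout n).len a else n
  width a := if a < 6 then (fstLayout n).width a else w

/-- At the start of the construction, array 6 holds the permutation, the other arrays are zero, and
register 0 holds `n`. -/
def buildState {n : ℕ} (π : Equiv.Perm (Fin n)) : State where
  reg r := if r = 0 then n else 0
  mem a i := if h : a = 6 ∧ i < n then (π ⟨i, h.2⟩ : ℕ) else 0

/-! ### Operations -/

inductive OpName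
  | image | preimage | power | inversePower | cycleCount | cycleSize | sameCycle | distance
  | transposeValues | transposePositions | flip

/-- An operation with its arguments; those that it does not need are ignored. -/
structure Op (n : ℕ) where
  name : OpName
  i : Fin n
  j : Fin n
  k : ℕ

/-- The segment `i, π i, …, j` of the cycle of `i` and `j` is reversed within the cycle: if the cycle,
written from `i` on, is `(i, …, j, c, …, c')`, then it becomes `(j, …, i, c, …, c')`. -/
noncomputable def flipPerm {n : ℕ} (π : Equiv.Perm (Fin n)) (i j : Fin n) :
    Equiv.Perm (Fin n) :=
  let c := π.toList i
  let d := sInf {d : ℕ | (π ^ d) i = j}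
  ((c.take (d + 1)).reverse ++ c.drop (d + 1)).formPerm * (π.cycleOf i)⁻¹ * π

/-- The permutation after an operation. -/
noncomputable def Op.next {n : ℕ} (o : Op n) (π : Equiv.Perm (Fin n)) : Equiv.Perm (Fin n) :=
  match o.name with
  | .transposeValues => Equiv.swap o.i o.j * π
  | .transposePositions => Equiv.swap (π o.i) (π o.j) * π
  | .flip => flipPerm π o.i o.j
  | _ => π

/-- `val` and `inf` are a correct answer to the operation. Truth values are coded by 1 and 0, and
an infinite distance by `inf = 1`. -/
def Op.Correct {n : ℕ} (o : Op n) (π : Equiv.Perm (Fin n)) (val inf : ℕ) : Prop :=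
  match o.name with
  | .image => val = π o.i
  | .preimage => val = π⁻¹ o.j
  | .power => val = (π ^ o.k) o.i
  | .inversePower => val = (π⁻¹ ^ o.k) o.j
  | .cycleCount => val = numCycles π
  | .cycleSize => val = {y | π.SameCycle o.i y}.ncard
  | .sameCycle => (π.SameCycle o.i o.j ∧ val = 1) ∨ (¬ π.SameCycle o.i o.j ∧ val = 0)
  | .distance =>
    (inf = 0 ∧ IsLeast {d : ℕ | (π ^ d) o.i = o.j} val) ∨ (inf = 1 ∧ ∀ d : ℕ, (π ^ d) o.i ≠ o.j)
  | .transposeValues => True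
  | .transposePositions => True
  | .flip => True

/-- An operation may be called if `k` fits into a word, and a flip if `i` and `j` are in a cycle. -/
def Op.Admissible {n : ℕ} (w : ℕ) (o : Op n) (π : Equiv.Perm (Fin n)) : Prop :=
  o.k < 2 ^ w ∧ (o.name = .flip → π.SameCycle o.i o.j)

/-- All operations of the sequence may be called when their turn comes. -/
def AdmissibleSeq {n : ℕ} (w : ℕ) : List (Op n) → Equiv.Perm (Fin n) → Prop
  | [], _ => True
  | o :: os, π => o.Admissible w π ∧ AdmissibleSeq w os (o.next π)

/-- At the call of an operation, registers 0, 1, 2, 3 hold `n`, `i`, `j`, `k`, the others 0. -/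
def Op.callState {n : ℕ} (o : Op n) (A : Memory) : State where
  reg r := if r = 0 then n else if r = 1 then o.i else if r = 2 then o.j
    else if r = 3 then o.k else 0
  mem := A

/-- `Serves w K prog A F π os T`: when the memory `A` holds the forest `F` of `π`, the programs `prog`,
which can access nothing but registers and the arrays of the forest, perform the operations `os` one
after the other in `T` steps altogether. Each of them leaves its answer in registers 0 and 1 and the
forest of the new permutation in the memory, and it makes at most `K` primitive changes of the
forest. -/
inductive Serves {n : ℕ} (w K : ℕ) (prog : OpName → Cmd) :
    Memory → Forest n → Equiv.Perm (Fin n) → List (Op n) → ℕ → Prop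
  | done (A : Memory) (F : Forest n) (π : Equiv.Perm (Fin n)) : Serves w K prog A F π [] 0
  | step {A : Memory} {F F' : Forest n} {π : Equiv.Perm (Fin n)} {o : Op n} {os : List (Op n)}
      {s : State} {k t T : ℕ}
      (run : Exec w (fstLayout n) (prog o.name) (o.callState A) s t)
      (answer : o.Correct π (s.reg 0) (s.reg 1))
      (moves : Moves k F F') (hk : k ≤ K)
      (holds : IsFST s.mem F' (o.next π))
      (rest : Serves w K prog s.mem F' (o.next π) os T) :
      Serves w K prog A F π (o :: os) (t + T)

end FST

/-!
The forest is kept as splay trees, and every operation is composed of a constant number of splayings,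
searches by rank, cuts and joins. Three facts carry the proof.

*Programs are correct.* A tree with signs and the way from a node up to the root are followed in the
memory step by step (`wp_splay`, `wp_find`). Going up, a negative sign at the parent is removed by
reversing what is below and beside it, so that each rotation works on positive signs, while the tree
that is meant does not change (`splayed_flip`). Splaying thus realizes `splay` on the tree that is
meant; searching by rank carries along whether the current subtree is to be read in reverse.

*Permutations.* Splaying the first node of a segment and the last node of a tree allows to rotate the
traversal of a tree such that it begins with a given element (`wp_rotate`); the traversal is the same
cycle, written from another element on. Then a power of the permutation is an access by rank, a
distance is the size of a left subtree, and reversing a prefix is a flip (`Follows.flip`). By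
`formPerm_append`, the cycle `(i … j …)` is the product of the transposition of `i` and `j` with the
cycles `(i …)` and `(j …)`, so that cutting and joining traversals carries out the transpositions
(`wp_transpose`). Two nodes of the same tree cannot both be the root, which is the test for being in
the same cycle (`wp_same`).

*Amortization.* With the potential `pot`, the sum of the logarithms of the sizes of all subtrees, the
access lemma `pot_splayUp` bounds the depth of the splayed node by the loss of potential plus
`3 log₂ n + 1`. Every search ends with splaying what it finds, a join adds at most `log₂ n` to the
potential, and cuts and reversals add nothing; `Transition` records this for forests. The
construction makes perfectly balanced trees, whose potential is linear in their size
(`logb_halves`), so that all operations together are charged only `O(n)` for it.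
-/

namespace FST

set_option linter.unusedSimpArgs false

/-! ### Symbolic execution

Programs are run symbolically, by rewriting with the equations below. The specification of a
procedure takes a continuation `k`, which gets the final state and the final clock with all that is
to be known about them, and proves the goal `Q` for them. -/

/-- Started in `s` with `t` steps on the clock, the program halts, and then the state and the clock
satisfy `Q`. -/
def Wp (w : ℕ) (L : Layout) (p : Cmd) (s : State) (t : ℕ) (Q : State → ℕ → Prop) : Prop :=
  ∃ s' t', Exec w L p s s' t' ∧ Q s' (t + t')

/-- The memory `A` after `v` is stored in cell `x` of array `a`. -/
def setCell (A : Memory) (a x v : ℕ) : Memory :=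
  Function.update A a (Function.update (A a) x v)

theorem setCell_apply (A : Memory) (a x v b y : ℕ) :
    setCell A a x v b y = if b = a ∧ y = x then v else A b y := by
  by_cases h : b = a
  · subst h; by_cases h' : y = x <;> simp [setCell, h']
  · simp [setCell, h]

theorem setCell_ne {A : Memory} {a x v b y : ℕ} (h : ¬ (b = a ∧ y = x)) :
    setCell A a x v b y = A b y := by
  rw [setCell_apply, if_neg h]

section Wp

variable {w : ℕ} {L : Layout} {s : State} {t : ℕ} {Q : State → ℕ → Prop}

theorem wp_skip : Wp w L .skip s t Q ↔ Q s (t + 1) := by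
  constructor
  · rintro ⟨_, _, h, hq⟩; cases h; exact hq
  · exact fun h => ⟨_, _, .skip s, h⟩

theorem wp_const {d c : ℕ} :
    Wp w L (.const d c) s t Q ↔ Q ⟨Function.update s.reg d (c % 2 ^ w), s.mem⟩ (t + 1) := by
  constructor
  · rintro ⟨_, _, h, hq⟩; cases h; exact hq
  · exact fun h => ⟨_, _, .const s d c, h⟩

theorem wp_bin {o : BinOp} {d x y : ℕ} :
    Wp w L (.bin o d x y) s t Q ↔
      Q ⟨Function.update s.reg d (o.eval w (s.reg x) (s.reg y)), s.mem⟩ (t + 1) := by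
  constructor
  · rintro ⟨_, _, h, hq⟩; cases h; exact hq
  · exact fun h => ⟨_, _, .bin s o d x y, h⟩

theorem wp_load {d a i : ℕ} :
    Wp w L (.load d a i) s t Q ↔ s.reg i < L.len a ∧
      Q ⟨Function.update s.reg d (s.mem a (s.reg i)), s.mem⟩ (t + 1) := by
  constructor
  · rintro ⟨_, _, h, hq⟩; cases h; exact ⟨by assumption, hq⟩
  · exact fun h => ⟨_, _, .load s d a i h.1, h.2⟩

theorem wp_store {a i x : ℕ} :
    Wp w L (.store a i x) s t Q ↔ (s.reg i < L.len a ∧ s.reg x < 2 ^ L.width a) ∧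
      Q ⟨s.reg, setCell s.mem a (s.reg i) (s.reg x)⟩ (t + 1) := by
  constructor
  · rintro ⟨_, _, h, hq⟩; cases h; exact ⟨⟨by assumption, by assumption⟩, hq⟩
  · exact fun h => ⟨_, _, .store s a i x h.1.1 h.1.2, h.2⟩

theorem wp_seq {p q : Cmd} :
    Wp w L (.seq p q) s t Q ↔ Wp w L p s t (fun s' t' => Wp w L q s' t' Q) := by
  constructor
  · rintro ⟨_, _, h, hq⟩
    cases h with
    | seq h1 h2 => exact ⟨_, _, h1, _, _, h2, by rwa [Nat.add_assoc]⟩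
  · rintro ⟨_, _, h1, _, _, h2, hq⟩
    exact ⟨_, _, .seq h1 h2, by rwa [← Nat.add_assoc]⟩

theorem wp_branch {c : Test} {p q : Cmd} :
    Wp w L (.branch c p q) s t Q ↔
      if c.eval s.reg = true then Wp w L p s (t + 1) Q else Wp w L q s (t + 1) Q := by
  constructor
  · rintro ⟨_, _, h, hq⟩
    cases h with
    | branchTrue hc hp => rw [if_pos hc]; exact ⟨_, _, hp, by rwa [Nat.add_assoc]⟩
    | branchFalse hc hp => rw [if_neg (by simp [hc])]; exact ⟨_, _, hp, by rwa [Nat.add_assoc]⟩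
  · intro h
    split_ifs at h with hc
    · obtain ⟨_, _, hp, hq⟩ := h
      exact ⟨_, _, .branchTrue hc hp, by rwa [← Nat.add_assoc]⟩
    · obtain ⟨_, _, hp, hq⟩ := h
      exact ⟨_, _, .branchFalse (by simpa using hc) hp, by rwa [← Nat.add_assoc]⟩

theorem wp_loop {c : Test} {p : Cmd} :
    Wp w L (.loop c p) s t Q ↔
      if c.eval s.reg = true then Wp w L p s (t + 1) (fun s' t' => Wp w L (.loop c p) s' t' Q)
      else Q s (t + 1) := by
  constructor
  · rintro ⟨_, _, h, hq⟩
    cases h with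
    | loopStop hc => rw [if_neg (by simp [hc])]; exact hq
    | loopStep hc hp hl =>
      rw [if_pos hc]
      exact ⟨_, _, hp, _, _, hl, by simpa only [Nat.add_assoc] using hq⟩
  · intro h
    split_ifs at h with hc
    · obtain ⟨_, _, hp, _, _, hl, hq⟩ := h
      exact ⟨_, _, .loopStep hc hp hl, by simpa only [Nat.add_assoc] using hq⟩
    · exact ⟨_, _, .loopStop (by simpa using hc), h⟩

theorem Wp.mono {p : Cmd} {Q' : State → ℕ → Prop} (h : Wp w L p s t Q)
    (hQ : ∀ s' t', Q s' t' → Q' s' t') : Wp w L p s t Q' := by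
  obtain ⟨s', t', h1, h2⟩ := h
  exact ⟨s', t', h1, hQ _ _ h2⟩

end Wp

/-! ### Trees with signs in the memory -/

/-- Trees with signs: `true` is the negative sign. -/
abbrev SignedTree (n : ℕ) := BinaryTree (Bool × Fin n)

namespace SignedTree
variable {n : ℕ}

/-- The elements of a tree with signs, in preorder. -/
def elems : SignedTree n → List (Fin n)
  | .nil => []
  | .node (_, x) l r => x :: (elems l ++ elems r)

/-- Change the sign of the root. -/
def negate : SignedTree n → SignedTree n
  | .nil => .nil
  | .node (b, x) l r => .node (!b, x) l r

@[simp] theorem elems_nil : elems (.nil : SignedTree n) = [] := rfl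
@[simp] theorem elems_node (b : Bool) (x : Fin n) (l r : SignedTree n) :
    elems (.node (b, x) l r) = x :: (elems l ++ elems r) := rfl
@[simp] theorem elems_negate (T : SignedTree n) : elems (negate T) = elems T := by
  rcases T with _ | ⟨⟨b, x⟩, l, r⟩ <;> rfl
@[simp] theorem rootOr_negate (d : ℕ) (T : SignedTree n) : rootOr d (negate T) = rootOr d T := by
  rcases T with _ | ⟨⟨b, x⟩, l, r⟩ <;> rfl
@[simp] theorem unfold_negate (rev : Bool) (T : SignedTree n) :
    unfold rev (negate T) = unfold (!rev) T := by
  rcases T with _ | ⟨⟨b, x⟩, l, r⟩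
  · rfl
  · cases b <;> cases rev <;> simp [negate, unfold]

theorem length_elems (T : SignedTree n) : (elems T).length = T.numNodes := by
  induction T with
  | nil => rfl
  | node a l r hl hr => obtain ⟨b, x⟩ := a; simp [hl, hr]

end SignedTree

open SignedTree

section Memory
variable {n : ℕ}

@[simp] theorem rootOr_nil (d : ℕ) : rootOr d (.nil : SignedTree n) = d := rfl
@[simp] theorem rootOr_node (d : ℕ) (b : Bool) (x : Fin n) (l r : SignedTree n) :
    rootOr d (.node (b, x) l r) = x := rfl

/-- `A` stores the tree `T`, except perhaps for the link and the side of its root. -/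
def StoredCore (A : Memory) : SignedTree n → Prop
  | .nil => True
  | .node (neg, x) l r =>
    A 0 x = rootOr (rootOr n r) l ∧ A 2 x = (BinaryTree.node (neg, x) l r).numNodes ∧
    A 3 x = neg.toNat ∧ Stored A (rootOr x r) 0 l ∧ Stored A x 1 r

theorem stored_node {A : Memory} {link side : ℕ} {b : Bool} {x : Fin n} {l r : SignedTree n} :
    Stored A link side (.node (b, x) l r) ↔
      A 1 x = link ∧ A 4 x = side ∧ StoredCore A (.node (b, x) l r) := by
  simp only [Stored, StoredCore]; tauto

theorem Stored.core {A : Memory} {link side : ℕ} {T : SignedTree n}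
    (h : Stored A link side T) : StoredCore A T := by
  rcases T with _ | ⟨⟨b, x⟩, l, r⟩
  · trivial
  · exact (stored_node.1 h).2.2

theorem Stored.congr_matrix {A A' : Memory} {T : SignedTree n} :
    ∀ {link side : ℕ}, (∀ c < 5, ∀ x ∈ elems T, A' c x = A c x) →
      Stored A link side T → Stored A' link side T := by
  induction T with
  | nil => intro _ _ _ _; trivial
  | node a l r hl hr =>
    obtain ⟨b, x⟩ := a
    intro link side h hs
    simp only [elems_node, List.mem_cons, List.mem_append, forall_eq_or_imp] at h
    simp only [Stored] at hs ⊢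
    rw [(h 0 (by omega)).1, (h 1 (by omega)).1, (h 2 (by omega)).1, (h 3 (by omega)).1,
      (h 4 (by omega)).1]
    exact ⟨hs.1, hs.2.1, hs.2.2.1, hs.2.2.2.1, hs.2.2.2.2.1,
      hl (fun c hc y hy => (h c hc).2 y (.inl hy)) hs.2.2.2.2.2.1,
      hr (fun c hc y hy => (h c hc).2 y (.inr hy)) hs.2.2.2.2.2.2⟩

theorem Stored.congr {A A' : Memory} {T : SignedTree n} {link side : ℕ}
    (h : ∀ c, ∀ x ∈ elems T, A' c x = A c x) (hs : Stored A link side T) :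
    Stored A' link side T := hs.congr_matrix fun c _ => h c

theorem StoredCore.congr {A A' : Memory} {T : SignedTree n}
    (h : ∀ c, ∀ x ∈ elems T, A' c x = A c x) (hs : StoredCore A T) : StoredCore A' T := by
  rcases T with _ | ⟨⟨b, x⟩, l, r⟩
  · trivial
  · have h1 : Stored A (A 1 x) (A 4 x) (.node (b, x) l r) := stored_node.2 ⟨rfl, rfl, hs⟩
    exact (h1.congr h).core

/-- Only the link and the side of the root may change. -/
theorem StoredCore.congr_root {A A' : Memory} {T : SignedTree n} (hnd : (elems T).Nodup)
    (h : ∀ c, ∀ x ∈ elems T, ((c = 1 ∨ c = 4) → (x : ℕ) ≠ rootOr n T) → A' c x = A c x)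
    (hs : StoredCore A T) : StoredCore A' T := by
  rcases T with _ | ⟨⟨b, x⟩, l, r⟩
  · trivial
  · simp only [elems_node, List.nodup_cons, List.mem_append, not_or] at hnd
    have key : ∀ y, y ∈ elems l ∨ y ∈ elems r → ∀ c, A' c y = A c y := by
      intro y hy c
      refine h c y (by simp only [elems_node, List.mem_cons, List.mem_append]; exact .inr hy)
        fun _ => ?_
      simp only [rootOr_node, ne_eq, Fin.val_inj]
      rintro rfl
      tauto
    have hx : ∀ c, c ≠ 1 → c ≠ 4 → A' c x = A c x := fun c h1 h4 =>
      h c x (by simp) fun h => by omega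
    obtain ⟨h0, h2, h3, hl, hr⟩ := hs
    exact ⟨by rw [hx 0 (by simp) (by simp), h0], by rw [hx 2 (by simp) (by simp), h2],
      by rw [hx 3 (by simp) (by simp), h3], hl.congr fun c y hy => key y (.inl hy) c,
      hr.congr fun c y hy => key y (.inr hy) c⟩

theorem StoredCore.size {A : Memory} {T : SignedTree n} {x : ℕ} (h : StoredCore A T)
    (hx : x = rootOr n T) (hlt : x < n) : A 2 x = T.numNodes := by
  rcases T with _ | ⟨⟨b, y⟩, l, r⟩
  · simp at hx; omega
  · rw [hx]; exact h.2.1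

/-- The memories agree outside of the elements in `S`. -/
def Agree (S : List (Fin n)) (A A' : Memory) : Prop :=
  A' 5 0 = A 5 0 ∧ ∀ c, ∀ x : Fin n, x ∉ S → A' c x = A c x

theorem Agree.refl (S : List (Fin n)) (A : Memory) : Agree S A A := ⟨rfl, fun _ _ _ => rfl⟩

theorem Agree.trans {S S' : List (Fin n)} {A B C : Memory} (h : Agree S A B)
    (h' : Agree S' B C) {S'' : List (Fin n)} (h1 : S ⊆ S'') (h2 : S' ⊆ S'') : Agree S'' A C :=
  ⟨h'.1.trans h.1, fun c x hx =>
    (h'.2 c x fun hm => hx (h2 hm)).trans (h.2 c x fun hm => hx (h1 hm))⟩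

theorem Agree.mono {S S' : List (Fin n)} {A B : Memory} (h : Agree S A B) (h1 : S ⊆ S') :
    Agree S' A B := ⟨h.1, fun c x hx => h.2 c x fun hm => hx (h1 hm)⟩

theorem StoredCore.agree {S : List (Fin n)} {A A' : Memory} {T : SignedTree n}
    (h : StoredCore A T) (hA : Agree S A A') (hd : List.Disjoint (elems T) S) :
    StoredCore A' T := h.congr fun c x hx => hA.2 c x fun hS => hd hx hS

theorem Stored.agree {S : List (Fin n)} {A A' : Memory} {T : SignedTree n} {link side : ℕ}
    (h : Stored A link side T) (hA : Agree S A A') (hd : List.Disjoint (elems T) S) :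
    Stored A' link side T := h.congr fun c x hx => hA.2 c x fun hS => hd hx hS

end Memory

/-! ### Elementary procedures on the matrix

Register 0 holds `n`, which also codes NIL, and the registers 4 and 5 hold `0` and `1`. -/

/-- The constants that all procedures rely on are in their registers. -/
structure Env (n : ℕ) (s : State) : Prop where
  r0 : s.reg 0 = n
  r4 : s.reg 4 = 0
  r5 : s.reg 5 = 1

/-- Copy register `x` to `d`. A difference, unlike a sum, never wraps around. -/
def mov (d x : ℕ) : Cmd := .bin .sub d x 4

/-- Change the sign of the tree with root in register `v`. -/
def negateCmd (v : ℕ) : Cmd :=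
  .branch (.lt v 0) (.seq (.load 6 3 v) (.seq (.bin .sub 6 5 6) (.store 3 v 6))) .skip

/-- Make the node in register `v` a root. -/
def detachCmd (v : ℕ) : Cmd :=
  .branch (.lt v 0) (.seq (.store 1 v 0) (.store 4 v 4)) .skip

/-- Read the children of the node in register `v`, regardless of its sign. -/
def childrenCmd (v a b : ℕ) : Cmd :=
  .seq (.load a 0 v) <| .seq (mov b 0) <|
  .branch (.lt a 0)
    (.seq (.load 6 4 a) <|
      .branch (.eq 6 5) (.seq (mov b a) (mov a 0))
        (.seq (.load 6 1 a) (.branch (.eq 6 v) .skip (mov b 6))))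
    .skip

/-- Give the children in the registers `a` and `b` to the node in register `v`. -/
def assembleCmd (v a b : ℕ) : Cmd :=
  .seq (mov 6 5) <| .seq
  (.branch (.lt a 0)
    (.seq (.store 0 v a) <| .seq (.store 4 a 4) <| .seq (.load 7 2 a) <| .seq (.bin .add 6 6 7) <|
      .branch (.lt b 0)
        (.seq (.store 1 a b) <| .seq (.store 1 b v) <| .seq (.store 4 b 5) <|
          .seq (.load 7 2 b) (.bin .add 6 6 7))
        (.store 1 a v))
    (.branch (.lt b 0)
      (.seq (.store 0 v b) <| .seq (.store 1 b v) <| .seq (.store 4 b 5) <|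
          .seq (.load 7 2 b) (.bin .add 6 6 7))
      (.store 0 v 0))) <|
  .seq (.store 2 v 6) (.store 3 v 4)

section
variable {n w : ℕ} {s : State} {t : ℕ} {Q : State → ℕ → Prop}

theorem lt_two_pow_clog {m : ℕ} (h : m ≤ n) : m < 2 ^ Nat.clog 2 (n + 1) :=
  (Nat.lt_succ_of_le h).trans_le (Nat.le_pow_clog (by norm_num) _)

theorem agree_of_cells {A A' : Memory} {S : List (Fin n)}
    (h : ∀ c y, (c < 5 → ∀ x ∈ S, (x : ℕ) ≠ y) → A' c y = A c y) : Agree S A A' :=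
  ⟨h 5 0 fun h => by omega, fun c y hy => h c y fun _ x hx hxy => hy (Fin.ext hxy ▸ hx)⟩

theorem StoredCore.negate {A A' : Memory} {T : SignedTree n} (hT : StoredCore A T)
    (hnd : (elems T).Nodup)
    (h3 : ∀ (b : Bool) (x : Fin n) l r, T = .node (b, x) l r → A' 3 x = (!b).toNat)
    (h : ∀ c y, ¬ (c = 3 ∧ y = rootOr n T) → A' c y = A c y) : StoredCore A' (negate T) := by
  rcases T with _ | ⟨⟨b, x⟩, l, r⟩
  · trivial
  · simp only [elems_node, List.nodup_cons, List.mem_append, not_or] at hnd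
    simp only [rootOr_node] at h
    have key : ∀ y : Fin n, y ≠ x → ∀ c, A' c y = A c y := fun y hy c =>
      h c y fun h => hy (Fin.ext h.2)
    obtain ⟨h0, h2, -, hl, hr⟩ := hT
    exact ⟨by rw [h _ _ (by simp), h0], by rw [h _ _ (by simp), h2]; rfl, h3 _ _ _ _ rfl,
      hl.congr fun c y hy => key y (fun h => hnd.1.1 (h ▸ hy)) c,
      hr.congr fun c y hy => key y (fun h => hnd.1.2 (h ▸ hy)) c⟩

theorem wp_negate {v : ℕ} {T : SignedTree n} (he : Env n s) (hv : v ≠ 6)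
    (hr : s.reg v = rootOr n T) (hT : StoredCore s.mem T) (hnd : (elems T).Nodup)
    (k : ∀ s' t', (∀ r, r ≠ 6 → s'.reg r = s.reg r) → StoredCore s'.mem (negate T) →
      Agree (elems T) s.mem s'.mem → t' ≤ t + 4 → Q s' t') :
    Wp w (fstLayout n) (negateCmd v) s t Q := by
  rcases T with _ | ⟨⟨b, x⟩, l, r⟩
  · simp only [negateCmd, ↓wp_branch, ↓wp_skip, Test.eval, hr, he.r0, rootOr_nil]
    simp only [lt_irrefl, decide_false, Bool.false_eq_true, if_false]
    exact k _ _ (fun _ _ => rfl) trivial (.refl _ _) (by omega)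
  · simp only [negateCmd, ↓wp_branch, ↓wp_skip, ↓wp_seq, ↓wp_load, ↓wp_bin, ↓wp_store, Test.eval,
      BinOp.eval, hr, he.r0, he.r5, rootOr_node, Function.update_apply, hv]
    have h3 : s.mem 3 x = b.toNat := hT.2.2.1
    simp only [fstLayout, h3, Fin.is_lt, decide_true, if_true, Nat.reduceLT, if_false, true_and,
      Nat.reduceEqDiff, or_false]
    have hb : 1 - b.toNat = (!b).toNat := by cases b <;> rfl
    refine ⟨by cases b <;> simp, k _ _ (fun r hr6 => by simp [Function.update_apply, hr6]) ?_ ?_ le_rfl⟩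
    · refine hT.negate hnd ?_ ?_
      · rintro _ _ _ _ ⟨⟩; simp [hb, setCell_apply]
      · intro c y h
        dsimp only
        rw [setCell_apply, if_neg (by simpa using h)]
    · apply agree_of_cells
      intro c y h
      dsimp only
      rw [setCell_apply, if_neg]
      rintro ⟨rfl, rfl⟩
      exact h (by omega) x (by simp) rfl

theorem wp_detach {v : ℕ} {T : SignedTree n} (he : Env n s)
    (hr : s.reg v = rootOr n T) (hT : StoredCore s.mem T) (hnd : (elems T).Nodup)
    (k : ∀ s' t', s'.reg = s.reg → Stored s'.mem n 0 T →
      Agree (elems T) s.mem s'.mem → t' ≤ t + 3 → Q s' t') :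
    Wp w (fstLayout n) (detachCmd v) s t Q := by
  rcases T with _ | ⟨⟨b, x⟩, l, r⟩
  · simp only [detachCmd, ↓wp_branch, ↓wp_skip, Test.eval, hr, he.r0, rootOr_nil]
    simp only [lt_irrefl, decide_false, Bool.false_eq_true, if_false]
    exact k _ _ rfl trivial (.refl _ _) (by omega)
  · simp only [detachCmd, ↓wp_branch, ↓wp_skip, ↓wp_seq, ↓wp_store, Test.eval,
      hr, he.r0, he.r4, rootOr_node]
    simp only [fstLayout, Fin.is_lt, decide_true, if_true, Nat.reduceLT, if_false, true_and,
      Nat.reduceEqDiff, or_false, lt_two_pow_clog le_rfl, Nat.two_pow_pos]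
    refine k _ _ rfl ?_ ?_ le_rfl
    · refine stored_node.2 ⟨by simp [setCell_apply], by simp [setCell_apply], ?_⟩
      refine hT.congr_root hnd fun c y _ h => ?_
      simp only [rootOr_node] at h
      dsimp only
      rw [setCell_apply, if_neg (fun hc => h (.inr hc.1) hc.2),
        setCell_apply, if_neg (fun hc => h (.inl hc.1) hc.2)]
    · apply agree_of_cells
      intro c y h
      dsimp only
      rw [setCell_apply, if_neg, setCell_apply, if_neg]
      all_goals
        rintro ⟨rfl, rfl⟩
        exact h (by omega) x (by simp) rfl

theorem wp_children {v a b : ℕ} {x : Fin n} {neg : Bool} {l r : SignedTree n} (he : Env n s)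
    (hv : v ≠ 6) (ha : 6 < a) (hb : 6 < b) (hav : a ≠ v) (hbv : b ≠ v) (hab : a ≠ b)
    (hr : s.reg v = x) (hT : StoredCore s.mem (.node (neg, x) l r))
    (hnd : (elems (.node (neg, x) l r)).Nodup)
    (k : ∀ s' t', (∀ r, r ≠ 6 → r ≠ a → r ≠ b → s'.reg r = s.reg r) → s'.mem = s.mem →
      s'.reg a = rootOr n l → s'.reg b = rootOr n r → t' ≤ t + 8 → Q s' t') :
    Wp w (fstLayout n) (childrenCmd v a b) s t Q := by
  have h4a : ¬ 4 = a := by omega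
  have h4b : ¬ 4 = b := by omega
  have h0a : ¬ 0 = a := by omega
  have h0b : ¬ 0 = b := by omega
  have h5a : ¬ 5 = a := by omega
  have h5b : ¬ 5 = b := by omega
  have h6a : ¬ a = 6 := by omega
  have h6b : ¬ b = 6 := by omega
  have h6a' : ¬ 6 = a := by omega
  have h6b' : ¬ 6 = b := by omega
  obtain ⟨h0, -, -, hl, hr'⟩ := hT
  simp only [elems_node, List.nodup_cons, List.mem_append, not_or] at hnd
  rcases l with _ | ⟨⟨bl, y⟩, ll, lr⟩ <;> rcases r with _ | ⟨⟨br, z⟩, rl, rr⟩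
  all_goals
    simp only [Stored, rootOr_nil, rootOr_node] at h0 hl hr'
    simp only
     [childrenCmd, mov, BinOp.eval, ↓wp_branch, ↓wp_skip, ↓wp_seq, ↓wp_load, ↓wp_bin, Test.eval, hr, he.r0, he.r4,
      he.r5, Function.update_apply, hav, hbv, hab, Ne.symm hab, Ne.symm hav, Ne.symm hbv, hv, Ne.symm hv,
      h4a, h4b, h0a, h0b, h5a, h5b, h6a, h6b, h6a', h6b', h0, fstLayout, if_true, if_false, Fin.is_lt,
      Nat.reduceLT, hl, hr', Nat.sub_zero, Fin.val_inj,
      true_and, lt_irrefl, decide_true, decide_false, Bool.false_eq_true, Nat.reduceEqDiff]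
  · exact k _ _ (fun r h1 h2 h3 => by simp [Function.update_apply, h1, h2, h3]) rfl
      (by simp [Function.update_apply, hab]) (by simp) (by omega)
  · exact k _ _ (fun r h1 h2 h3 => by simp [Function.update_apply, h1, h2, h3]) rfl
      (by simp) (by simp [Function.update_apply, Ne.symm hab]) (by omega)
  · exact k _ _ (fun r h1 h2 h3 => by simp [Function.update_apply, h1, h2, h3]) rfl
      (by simp [Function.update_apply, *]) (by simp [Function.update_apply, *]) (by omega)
  · have hzx : z ≠ x := by rintro rfl; simp at hnd
    simp only [hzx, if_false, decide_false, Bool.false_eq_true]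
    exact k _ _ (fun r h1 h2 h3 => by simp [Function.update_apply, h1, h2, h3]) rfl
      (by simp [Function.update_apply, *]) (by simp) (by omega)

theorem StoredCore.assemble {A A' : Memory} {x : Fin n} {l r : SignedTree n}
    (hl : StoredCore A l) (hr : StoredCore A r) (hnd : (x :: (elems l ++ elems r)).Nodup)
    (h0 : A' 0 x = rootOr (rootOr n r) l) (h2 : A' 2 x = l.numNodes + r.numNodes + 1)
    (h3 : A' 3 x = 0)
    (hl' : ∀ y : Fin n, (y : ℕ) = rootOr n l → A' 1 y = rootOr x r ∧ A' 4 y = 0)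
    (hr' : ∀ y : Fin n, (y : ℕ) = rootOr n r → A' 1 y = x ∧ A' 4 y = 1)
    (h : ∀ c y, ¬ (y = (x : ℕ) ∧ (c = 0 ∨ c = 2 ∨ c = 3)) →
      ¬ ((y = rootOr n l ∨ y = rootOr n r) ∧ (c = 1 ∨ c = 4)) → A' c y = A c y) :
    StoredCore A' (.node (false, x) l r) := by
  have hroot : ∀ {T : SignedTree n} {y : Fin n}, (y : ℕ) = rootOr n T → y ∈ elems T := by
    intro T y h
    rcases T with _ | ⟨⟨b, z⟩, _, _⟩
    · exact absurd h y.isLt.ne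
    · simp [Fin.ext h]
  simp only [List.nodup_cons, List.mem_append, not_or, List.nodup_append] at hnd
  obtain ⟨⟨hxl, hxr⟩, hndl, hndr, hd⟩ := hnd
  have cl : StoredCore A' l := by
    refine hl.congr_root hndl fun c y hy hc => h c y ?_ ?_
    · rintro ⟨hyx, -⟩; exact hxl (Fin.ext hyx ▸ hy)
    · rintro ⟨h1 | h1, h2⟩
      · exact hc h2 h1
      · exact hd _ hy _ (hroot h1) rfl
  have cr : StoredCore A' r := by
    refine hr.congr_root hndr fun c y hy hc => h c y ?_ ?_
    · rintro ⟨hyx, -⟩; exact hxr (Fin.ext hyx ▸ hy)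
    · rintro ⟨h1 | h1, h2⟩
      · exact hd _ (hroot h1) _ hy rfl
      · exact hc h2 h1
  refine ⟨h0, h2, h3, ?_, ?_⟩
  · rcases l with _ | ⟨⟨b, y⟩, _, _⟩
    · trivial
    · exact stored_node.2 ⟨(hl' y rfl).1, (hl' y rfl).2, cl⟩
  · rcases r with _ | ⟨⟨b, y⟩, _, _⟩
    · trivial
    · exact stored_node.2 ⟨(hr' y rfl).1, (hr' y rfl).2, cr⟩

theorem wp_assemble {v a b : ℕ} {x : Fin n} {l r : SignedTree n} (he : Env n s) (hw : n < 2 ^ w)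
    (v6 : v ≠ 6) (v7 : v ≠ 7) (a6 : a ≠ 6) (a7 : a ≠ 7) (b6 : b ≠ 6) (b7 : b ≠ 7)
    (hv' : s.reg v = x) (ha' : s.reg a = rootOr n l) (hb' : s.reg b = rootOr n r)
    (hl : StoredCore s.mem l) (hr : StoredCore s.mem r)
    (hnd : (x :: (elems l ++ elems r)).Nodup)
    (k : ∀ s' t', (∀ r, r ≠ 6 → r ≠ 7 → s'.reg r = s.reg r) →
      StoredCore s'.mem (.node (false, x) l r) →
      Agree (x :: (elems l ++ elems r)) s.mem s'.mem → t' ≤ t + 15 → Q s' t') :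
    Wp w (fstLayout n) (assembleCmd v a b) s t Q := by
  have hlen := hnd.length_le_card
  simp only [List.length_cons, List.length_append, length_elems, Fintype.card_fin] at hlen
  have hsz := lt_two_pow_clog hlen
  have hsz' := hlen.trans_lt hw
  have hdisj : ∀ y ∈ elems l, ∀ z ∈ elems r, (y : ℕ) ≠ z := by
    intro y hy z hz h
    simp only [List.nodup_cons, List.nodup_append] at hnd
    exact hnd.2.2.2 _ hy _ hz (Fin.ext h)
  have hxl : ∀ y ∈ elems l, (y : ℕ) ≠ x := by
    rintro y hy h; rw [Fin.ext h] at hy; simp [hy] at hnd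
  have hxr : ∀ y ∈ elems r, (y : ℕ) ≠ x := by
    rintro y hy h; rw [Fin.ext h] at hy; simp [hy] at hnd
  have hxn := lt_two_pow_clog x.isLt.le
  have hn' := lt_two_pow_clog (le_refl n)
  have e1 : (1 + l.numNodes) % 2 ^ w = 1 + l.numNodes := Nat.mod_eq_of_lt (by omega)
  have e2 : (1 + r.numNodes) % 2 ^ w = 1 + r.numNodes := Nat.mod_eq_of_lt (by omega)
  have e3 : (1 + l.numNodes + r.numNodes) % 2 ^ w = 1 + l.numNodes + r.numNodes :=
    Nat.mod_eq_of_lt (by omega)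
  rcases l with _ | ⟨⟨bl, y⟩, ll, lr⟩ <;> rcases r with _ | ⟨⟨br, z⟩, rl, rr⟩
  all_goals
    have hl2 := hl
    have hr2 := hr
    simp only [StoredCore, rootOr_nil, rootOr_node, BinaryTree.numNodes] at ha' hb' hl2 hr2 hsz hsz' hlen e1 e2 e3
    simp only
     [assembleCmd, mov, BinOp.eval, ↓wp_branch, ↓wp_skip, ↓wp_seq, ↓wp_load, ↓wp_bin, ↓wp_store,
      Test.eval, he.r0, he.r4, he.r5, Function.update_apply, hv', ha', hb', v6, v7, a6, a7, b6, b7,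
      hl2, hr2, fstLayout, if_true, if_false, Fin.is_lt, Nat.reduceLT, Nat.sub_zero, Fin.val_inj,
      true_and, lt_irrefl, decide_true, decide_false, Bool.false_eq_true, Nat.reduceEqDiff,
      setCell_apply, hxn, hn', true_or, or_true, false_or, or_false, Nat.two_pow_pos,
      lt_two_pow_clog (Fin.is_lt _).le, Nat.reducePow, false_and, and_false, e1, e2, e3]
    refine ⟨lt_two_pow_clog (by omega), k _ _ (fun r h1 h2 => by
        simp [Function.update_apply, h1, h2]) ?_ ?_ (by omega)⟩
    · refine hl.assemble hr hnd ?_ ?_ ?_ ?_ ?_ ?_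
      · simp [setCell_apply]
      · simp [setCell_apply]
        try omega
      · simp [setCell_apply]
      · intro u hu
        first
        | exact absurd hu u.isLt.ne
        | (simp only [rootOr_node] at hu
           simp [setCell_apply, hu, hdisj y (by simp) z (by simp)])
        | (simp only [rootOr_node] at hu
           simp [setCell_apply, hu])
      · intro u hu
        first
        | exact absurd hu u.isLt.ne
        | (simp only [rootOr_node] at hu
           simp [setCell_apply, hu, (hdisj y (by simp) z (by simp)).symm])
        | (simp only [rootOr_node] at hu
           simp [setCell_apply, hu])
      · intro c u h1 h2
        simp only [rootOr_node, rootOr_nil] at h1 h2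
        dsimp only
        repeat rw [setCell_ne (by omega)]
    · apply agree_of_cells
      intro c u h
      dsimp only
      by_cases hc : c < 5
      · replace h := h hc
        simp only [elems_node, elems_nil, List.mem_cons, List.mem_append, List.nil_append,
          List.append_nil, List.not_mem_nil] at h
        have hx := h x (by simp)
        try have hy := h y (by simp)
        try have hz := h z (by simp)
        repeat rw [setCell_ne (by omega)]
      · repeat rw [setCell_ne (by omega)]
end

/-! ### The way from a node up to the root, in the memory -/

/-- A step of the way up in a tree with signs: the parent `p` with its sign, its other subtree `t`,
and whether the way comes from the right child of `p`. -/
structure SignedFrame (n : ℕ) where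
  right : Bool
  neg : Bool
  p : Fin n
  t : SignedTree n

section
variable {n : ℕ}

/-- The frame of a splay tree with the given data. -/
def mkFrame {α : Type} (right : Bool) (p : α) (t : BinaryTree α) : Frame α :=
  if right then .inRight p t else .inLeft p t

/-- The elements on and beside the way up. -/
def pathElems : List (SignedFrame n) → List (Fin n)
  | [] => []
  | f :: path => f.p :: (elems f.t ++ pathElems path)

/-- Whether an odd number of signs on the way up is negative. -/
def pathRev : List (SignedFrame n) → Bool
  | [] => false
  | f :: path => xor f.neg (pathRev path)

/-- The way up in the tree that is meant. -/
def unfoldPath : List (SignedFrame n) → List (Frame (Fin n))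
  | [] => []
  | f :: path =>
    mkFrame (xor f.right (pathRev (f :: path))) f.p (unfold (pathRev (f :: path)) f.t) ::
      unfoldPath path

/-- Put a tree at the lower end of a way. -/
def plug : SignedTree n → List (SignedFrame n) → SignedTree n
  | T, [] => T
  | T, f :: path =>
    plug (if f.right then .node (f.neg, f.p) f.t T else .node (f.neg, f.p) T f.t) path

/-- The frame with the same meaning, up to a reversal of everything, that has a positive sign. -/
def SignedFrame.flip (f : SignedFrame n) : SignedFrame n :=
  ⟨!f.right, false, f.p, negate f.t⟩

@[simp] theorem SignedFrame.flip_p (f : SignedFrame n) : f.flip.p = f.p := rfl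
@[simp] theorem SignedFrame.flip_t (f : SignedFrame n) : f.flip.t = negate f.t := rfl
@[simp] theorem SignedFrame.flip_neg (f : SignedFrame n) : f.flip.neg = false := rfl
@[simp] theorem SignedFrame.flip_right (f : SignedFrame n) : f.flip.right = !f.right := rfl

/-- The tree that results when a node without sign and with subtrees `l` and `r` is splayed up the
given way. -/
def splayed (x : Fin n) (l r : SignedTree n) (path : List (SignedFrame n)) : BinaryTree (Fin n) :=
  if pathRev path then splayUp x (unfold true r) (unfold true l) (unfoldPath path)
  else splayUp x (unfold false l) (unfold false r) (unfoldPath path)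

theorem splayed_flip {x : Fin n} {l r : SignedTree n} {f : SignedFrame n}
    {path : List (SignedFrame n)} (hf : f.neg = true) :
    splayed x l r (f :: path) = splayed x (negate r) (negate l) (f.flip :: path) := by
  cases h : pathRev path <;> simp [splayed, pathRev, unfoldPath, hf, h]

theorem splayed_flip_flip {x : Fin n} {l r : SignedTree n} {f g : SignedFrame n}
    {path : List (SignedFrame n)} (hf : f.neg = false) (hg : g.neg = true) :
    splayed x l r (f :: g :: path) =
      splayed x (negate r) (negate l) (f.flip :: g.flip :: path) := by
  cases h : pathRev path <;> simp [splayed, pathRev, unfoldPath, hf, hg, h]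

/-- The subtrees of the splayed node after a zig. -/
def zig (f : SignedFrame n) (l r : SignedTree n) : SignedTree n × SignedTree n :=
  if f.right then (.node (false, f.p) f.t l, r) else (l, .node (false, f.p) r f.t)

/-- The subtrees of the splayed node after a zig-zig or zig-zag. -/
def zigzig (f g : SignedFrame n) (l r : SignedTree n) : SignedTree n × SignedTree n :=
  if f.right then
    if g.right then (.node (false, f.p) (.node (false, g.p) g.t f.t) l, r)
    else (.node (false, f.p) f.t l, .node (false, g.p) r g.t)
  else
    if g.right then (.node (false, g.p) g.t l, .node (false, f.p) r f.t)
    else (l, .node (false, f.p) r (.node (false, g.p) f.t g.t))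

theorem splayed_zig {x : Fin n} {l r : SignedTree n} {f : SignedFrame n} (hf : f.neg = false) :
    splayed x l r [f] = splayed x (zig f l r).1 (zig f l r).2 [] := by
  cases h : f.right <;> simp [splayed, pathRev, unfoldPath, hf, h, zig, mkFrame, splayUp, unfold]

theorem splayed_zigzig {x : Fin n} {l r : SignedTree n} {f g : SignedFrame n}
    {path : List (SignedFrame n)} (hf : f.neg = false) (hg : g.neg = false) :
    splayed x l r (f :: g :: path) =
      splayed x (zigzig f g l r).1 (zigzig f g l r).2 path := by
  cases h : f.right <;> cases h' : g.right <;> cases hp : pathRev path <;>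
    simp [splayed, pathRev, unfoldPath, hf, hg, h, h', hp, zigzig, mkFrame, splayUp, unfold]

/-- The memory holds the way up from the node `h`. -/
def PathStored (A : Memory) : ℕ → List (SignedFrame n) → Prop
  | h, [] => A 1 h = n ∧ A 4 h = 0
  | h, f :: path =>
    A 1 h = (if f.right then (f.p : ℕ) else rootOr f.p f.t) ∧ A 4 h = f.right.toNat ∧
    A 0 f.p = (if f.right then rootOr h f.t else h) ∧ A 3 f.p = f.neg.toNat ∧
    (if f.right then Stored A h 0 f.t else Stored A f.p 1 f.t) ∧ PathStored A f.p path

/-- The first step of a way is known: the parent is `p` (NIL at the end), the sibling is `t` (perhaps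
NIL), and `side` is 1 if the way comes from the right; and the memory holds the rest of the way. -/
def Held (A : Memory) (p side t : ℕ) : List (SignedFrame n) → Prop
  | [] => p = n
  | f :: path => p = f.p ∧ side = f.right.toNat ∧ t = rootOr n f.t ∧ A 3 f.p = f.neg.toNat ∧
      StoredCore A f.t ∧ PathStored A f.p path

theorem PathStored.congr {A A' : Memory} {path : List (SignedFrame n)} :
    ∀ {h : ℕ}, (∀ c, A' c h = A c h) → (∀ c, ∀ x ∈ pathElems path, A' c x = A c x) →
    PathStored A h path → PathStored A' h path := by
  induction path with
  | nil => intro h hh _ hp; simpa only [PathStored, hh] using hp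
  | cons f path ih =>
    intro h hh hc hp
    simp only [pathElems, List.mem_cons, List.mem_append, forall_eq_or_imp] at hc
    obtain ⟨h1, h2, h3, h4, h5, h6⟩ := hp
    refine ⟨by rw [hh, h1], by rw [hh, h2], by rw [(hc _).1, h3], by rw [(hc _).1, h4], ?_,
      ih (fun c => (hc c).1) (fun c x hx => (hc c).2 x (.inr hx)) h6⟩
    have ht : ∀ c, ∀ x ∈ elems f.t, A' c x = A c x := fun c x hx => (hc c).2 x (.inl hx)
    split_ifs at h5 ⊢
    · exact h5.congr ht
    · exact h5.congr ht

theorem Held.agree {A A' : Memory} {p side t : ℕ} {path : List (SignedFrame n)} {S : List (Fin n)}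
    (h : Held A p side t path) (hA : Agree S A A') (hd : List.Disjoint (pathElems path) S) :
    Held A' p side t path := by
  have hc : ∀ c, ∀ x ∈ pathElems path, A' c x = A c x := fun c x hx => hA.2 c x fun hS => hd hx hS
  cases path with
  | nil => exact h
  | cons f path =>
    simp only [pathElems, List.mem_cons, List.mem_append, forall_eq_or_imp] at hc
    obtain ⟨h1, h2, h3, h4, h5, h6⟩ := h
    exact ⟨h1, h2, h3, by rw [(hc _).1, h4], h5.congr fun c x hx => (hc c).2 x (.inl hx),
      h6.congr (fun c => (hc c).1) fun c x hx => (hc c).2 x (.inr hx)⟩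

theorem PathStored.agree {A A' : Memory} {x : Fin n} {path : List (SignedFrame n)}
    {S : List (Fin n)} (h : PathStored A x path) (hA : Agree S A A')
    (hd : List.Disjoint (x :: pathElems path) S) : PathStored A' x path :=
  h.congr (fun c => hA.2 c x fun hS => hd (by simp) hS)
    fun c y hy => hA.2 c y fun hS => hd (by simp [hy]) hS

/-- Read the first step of the way up from the node in register `h`: its parent, side, and
sibling. -/
def frameCmd (h p side t : ℕ) : Cmd :=
  .seq (.load p 1 h) <| .branch (.lt p 0)
    (.seq (.load side 4 h) <| .seq (.load t 0 p) <| .branch (.eq t h)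
      (mov t 0)
      (.branch (.eq side 5) .skip (.seq (mov t p) (.load p 1 p))))
    .skip

theorem wp_frame {w : ℕ} {s : State} {t₀ : ℕ} {Q : State → ℕ → Prop} {h p side t : ℕ} {x : Fin n}
    {path : List (SignedFrame n)} (he : Env n s) (hp : 6 < p) (hs : 6 < side) (ht : 6 < t)
    (hph : p ≠ h) (hsh : side ≠ h) (hth : t ≠ h) (hps : p ≠ side) (hpt : p ≠ t) (hst : side ≠ t)
    (hx : s.reg h = x) (hP : PathStored s.mem x path) (hnd : (x :: pathElems path).Nodup)
    (k : ∀ s' t', (∀ r, r ≠ p → r ≠ side → r ≠ t → s'.reg r = s.reg r) → s'.mem = s.mem →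
      Held s.mem (s'.reg p) (s'.reg side) (s'.reg t) path → t' ≤ t₀ + 8 → Q s' t') :
    Wp w (fstLayout n) (frameCmd h p side t) s t₀ Q := by
  have h0p : ¬ 0 = p := by omega
  have h4p : ¬ 4 = p := by omega
  have h5p : ¬ 5 = p := by omega
  have h0s : ¬ 0 = side := by omega
  have h4s : ¬ 4 = side := by omega
  have h5s : ¬ 5 = side := by omega
  have h0t : ¬ 0 = t := by omega
  have h4t : ¬ 4 = t := by omega
  have h5t : ¬ 5 = t := by omega
  have hhs := Ne.symm hsh
  have hht := Ne.symm hth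
  have hhp := Ne.symm hph
  have hsp := Ne.symm hps
  have htp := Ne.symm hpt
  have hts := Ne.symm hst
  cases path with
  | nil =>
    obtain ⟨h1, h2⟩ := hP
    simp only [frameCmd, ↓wp_branch, ↓wp_skip, ↓wp_seq, ↓wp_load, Test.eval, hx,
      he.r0, Function.update_apply, h1, fstLayout, Fin.is_lt, Nat.reduceLT, if_true, if_false, h0p,
      true_and, lt_irrefl, decide_false, Bool.false_eq_true]
    exact k _ _ (fun r h1 h2 h3 => by simp [Function.update_apply, h1]) rfl (by simp [Held])
      (by omega)
  | cons f path =>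
    obtain ⟨h1, h2, h3, h4, h5, h6⟩ := hP
    rcases f with ⟨_ | _, neg, y, _ | ⟨⟨b, z⟩, zl, zr⟩⟩
    all_goals
      simp only [rootOr_nil, rootOr_node, if_true, if_false, Bool.false_eq_true, Bool.toNat_true,
        Bool.toNat_false] at h1 h2 h3 h4 h5 h6
    · simp only [frameCmd, mov, BinOp.eval, ↓wp_branch, ↓wp_skip, ↓wp_seq, ↓wp_load, ↓wp_bin,
        Test.eval, hx, he.r0, he.r4, he.r5, Function.update_apply, h1, h2, h3, fstLayout, Fin.is_lt,
        Nat.reduceLT, if_true, if_false, h0p, h4p, h5p, h0s, h4s, h5s, h0t, h4t, h5t, hhs, hht,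
        hhp, hsp, htp, hts, hps, hpt, hst, true_and, decide_true, decide_false, Nat.sub_zero,
        Bool.false_eq_true, Fin.val_inj, Nat.zero_ne_one]
      refine k _ _ (fun r h1 h2 h3 => by simp [Function.update_apply, h1, h2, h3]) rfl ?_ (by omega)
      simp [Held, Function.update_apply, StoredCore, *]
    · have h7 := h5.core
      obtain ⟨h51, h52⟩ := (stored_node.1 h5).2.2
      have h5' := (stored_node.1 h5).1
      have hzx : z ≠ x := by rintro rfl; simp [pathElems] at hnd
      have hroot : s.mem 0 z ≠ x := by
        rw [h51]
        rcases zl with _ | ⟨⟨_, u⟩, _, _⟩ <;> rcases zr with _ | ⟨⟨_, v⟩, _, _⟩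
        · simpa using x.isLt.ne'
        all_goals
          simp only [rootOr_nil, rootOr_node, ne_eq, Fin.val_inj]
          rintro rfl
          simp [pathElems] at hnd
      simp only [frameCmd, mov, BinOp.eval, ↓wp_branch, ↓wp_skip, ↓wp_seq, ↓wp_load, ↓wp_bin,
        Test.eval, hx, he.r0, he.r4, he.r5, Function.update_apply, h1, h2, h3, fstLayout, Fin.is_lt,
        Nat.reduceLT, if_true, if_false, h0p, h4p, h5p, h0s, h4s, h5s, h0t, h4t, h5t, hhs, hht,
        hhp, hsp, htp, hts, hps, hpt, hst, true_and, decide_true, decide_false, Nat.sub_zero,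
        Bool.false_eq_true, Fin.val_inj, Nat.zero_ne_one, hroot, h5']
      refine k _ _ (fun r h1 h2 h3 => by simp [Function.update_apply, h1, h2, h3]) rfl ?_ (by omega)
      simp [Held, Function.update_apply, StoredCore, *]
    · simp only [frameCmd, mov, BinOp.eval, ↓wp_branch, ↓wp_skip, ↓wp_seq, ↓wp_load, ↓wp_bin,
        Test.eval, hx, he.r0, he.r4, he.r5, Function.update_apply, h1, h2, h3, fstLayout, Fin.is_lt,
        Nat.reduceLT, if_true, if_false, h0p, h4p, h5p, h0s, h4s, h5s, h0t, h4t, h5t, hhs, hht,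
        hhp, hsp, htp, hts, hps, hpt, hst, true_and, decide_true, decide_false, Nat.sub_zero,
        Bool.false_eq_true, Fin.val_inj, Nat.zero_ne_one]
      refine k _ _ (fun r h1 h2 h3 => by simp [Function.update_apply, h1, h2, h3]) rfl ?_ (by omega)
      simp [Held, Function.update_apply, StoredCore, *]
    · have hzx : z ≠ x := by rintro rfl; simp [pathElems] at hnd
      have h7 := h5.core
      simp only [frameCmd, mov, BinOp.eval, ↓wp_branch, ↓wp_skip, ↓wp_seq, ↓wp_load, ↓wp_bin,
        Test.eval, hx, he.r0, he.r4, he.r5, Function.update_apply, h1, h2, h3, fstLayout, Fin.is_lt,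
        Nat.reduceLT, if_true, if_false, h0p, h4p, h5p, h0s, h4s, h5s, h0t, h4t, h5t, hhs, hht,
        hhp, hsp, htp, hts, hps, hpt, hst, true_and, decide_true, decide_false, Nat.sub_zero,
        Bool.false_eq_true, Fin.val_inj, Nat.zero_ne_one, hzx]
      refine k _ _ (fun r h1 h2 h3 => by simp [Function.update_apply, h1, h2, h3]) rfl ?_ (by omega)
      simp [Held, Function.update_apply, *]
end

/-! ### Splaying in the memory

The splayed node is in register 10, the roots of its subtrees in registers 11 and 12, and the first
step of the way up, as read by `frameCmd`, in registers 13 to 15. Registers 16 to 21 hold the next two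
steps. -/

/-- Reverse the pair of subtrees of the splayed node. -/
def swapCmd : Cmd :=
  .seq (negateCmd 11) <| .seq (negateCmd 12) <| .seq (mov 6 11) <| .seq (mov 11 12) (mov 12 6)

/-- Make the sign of the first step of the way positive. -/
def absorbCmd : Cmd :=
  .seq (.load 6 3 13) <| .branch (.eq 6 5)
    (.seq (negateCmd 15) <| .seq swapCmd (.bin .sub 14 5 14)) .skip

/-- Make the sign of the second step of the way positive, if that of the first one is. -/
def absorbSecondCmd : Cmd :=
  .seq (.load 6 3 16) <| .branch (.eq 6 5)
    (.seq (negateCmd 18) <| .seq (.bin .sub 17 5 17) <|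
      .seq (negateCmd 15) <| .seq swapCmd (.bin .sub 14 5 14)) .skip

/-- The last step, at a child of the root: register 14 tells whether the node is a right child. -/
def zigCmd : Cmd :=
  .branch (.eq 14 5) (.seq (assembleCmd 13 15 11) (mov 11 13))
    (.seq (assembleCmd 13 12 15) (mov 12 13))

/-- A zig-zig or zig-zag step, as the registers 14 and 17, which tell whether the node and its parent
are right children, agree or not. -/
def zigzigCmd : Cmd :=
  .branch (.eq 14 5)
    (.branch (.eq 17 5)
      (.seq (assembleCmd 16 18 15) <| .seq (assembleCmd 13 16 11) (mov 11 13))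
      (.seq (assembleCmd 13 15 11) <| .seq (assembleCmd 16 12 18) <|
        .seq (mov 11 13) (mov 12 16)))
    (.branch (.eq 17 5)
      (.seq (assembleCmd 16 18 11) <| .seq (assembleCmd 13 12 15) <|
        .seq (mov 11 16) (mov 12 13))
      (.seq (assembleCmd 16 15 18) <| .seq (assembleCmd 13 12 16) (mov 12 13)))

/-- One step up, by two rotations if there is a grandparent and by one if the parent is the root. -/
def splayStepCmd : Cmd :=
  .seq absorbCmd <| .seq (frameCmd 13 16 17 18) <| .branch (.lt 16 0)
    (.seq absorbSecondCmd <| .seq (frameCmd 16 19 20 21) <| .seq zigzigCmd <|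
      .seq (mov 13 19) <| .seq (mov 14 20) (mov 15 21))
    (.seq zigCmd (mov 13 0))

/-- Splay the node in register 10; the roots of its new subtrees are left in the registers 11
and 12, the node itself is not yet written. -/
def splayCmd : Cmd :=
  .seq (childrenCmd 10 11 12) <| .seq (.load 6 3 10) <| .seq (.branch (.eq 6 5) swapCmd .skip) <|
  .seq (frameCmd 10 13 14 15) (.loop (.lt 13 0) splayStepCmd)

section
variable {n w : ℕ} {s : State} {t : ℕ} {Q : State → ℕ → Prop}

theorem Env.congr {s s' : State} (h : Env n s) (hr : ∀ r, r < 6 → s'.reg r = s.reg r) :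
    Env n s' :=
  ⟨by rw [hr 0 (by omega), h.r0], by rw [hr 4 (by omega), h.r4], by rw [hr 5 (by omega), h.r5]⟩

theorem nodup_of_count {l l' : List (Fin n)} (h : l.Nodup)
    (hc : ∀ a, l'.count a ≤ l.count a) : l'.Nodup :=
  List.nodup_iff_count_le_one.2 fun a => (hc a).trans (List.nodup_iff_count_le_one.1 h a)

theorem disjoint_of_count {l l₁ l₂ : List (Fin n)} (h : l.Nodup)
    (hc : ∀ a, l₁.count a + l₂.count a ≤ l.count a) : List.Disjoint l₁ l₂ := by
  intro a h1 h2
  have := List.nodup_iff_count_le_one.1 h a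
  have := hc a
  have := List.count_pos_iff.2 h1
  have := List.count_pos_iff.2 h2
  omega

theorem subset_of_count {l₁ l₂ : List (Fin n)} (h : ∀ a, l₁.count a ≤ l₂.count a) : l₁ ⊆ l₂ := by
  intro a h1
  have := List.count_pos_iff.2 h1
  exact List.count_pos_iff.1 (this.trans_le (h a))

/-- The node `x`, whose subtrees `l` and `r` are at hand, is at the lower end of the way `path`. -/
structure AtHand (s : State) (x : Fin n) (l r : SignedTree n) (path : List (SignedFrame n)) :
    Prop where
  env : Env n s
  hx : s.reg 10 = x
  hl : s.reg 11 = rootOr n l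
  hr : s.reg 12 = rootOr n r
  cl : StoredCore s.mem l
  cr : StoredCore s.mem r
  nodup : (x :: (elems l ++ elems r ++ pathElems path)).Nodup

theorem wp_swap {x : Fin n} {l r : SignedTree n} {path : List (SignedFrame n)}
    (h : AtHand s x l r path)
    (k : ∀ s' t', (∀ i, i ≠ 6 → i ≠ 11 → i ≠ 12 → s'.reg i = s.reg i) →
      AtHand s' x (negate r) (negate l) path →
      Agree (elems l ++ elems r) s.mem s'.mem → t' ≤ t + 11 → Q s' t') :
    Wp w (fstLayout n) swapCmd s t Q := by
  have hnd := h.nodup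
  have d : List.Disjoint (elems l) (elems r) := disjoint_of_count hnd fun a => by
    simp only [List.count_append, List.count_cons]; omega
  have ndl : (elems l).Nodup := nodup_of_count hnd fun a => by
    simp only [List.count_append, List.count_cons]; omega
  have ndr : (elems r).Nodup := nodup_of_count hnd fun a => by
    simp only [List.count_append, List.count_cons]; omega
  simp only [swapCmd, ↓wp_seq]
  refine wp_negate h.env (by simp) h.hl h.cl ndl fun s1 t1 f1 c1 a1 ht1 => ?_
  have e1 := h.env.congr (s' := s1) fun r hr => f1 r (by omega)
  refine wp_negate e1 (by simp) (T := r) (by rw [f1 12 (by simp), h.hr])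
    (h.cr.agree a1 d.symm) ndr fun s2 t2 f2 c2 a2 ht2 => ?_
  have e2 := e1.congr (s' := s2) fun r hr => f2 r (by omega)
  simp only [mov, BinOp.eval, ↓wp_bin, Function.update_apply, e2.r4, Nat.reduceEqDiff, if_true,
    if_false, Nat.sub_zero, OfNat.ofNat_ne_zero, OfNat.zero_ne_ofNat]
  refine k _ _ (fun i h1 h2 h3 => by simp [Function.update_apply, *]) ?_
    (a1.trans a2 (by simp) (by simp)) (by omega)
  constructor
  · exact e2.congr fun i hi => by simp [Function.update_apply, show i ≠ 6 by omega,
      show i ≠ 11 by omega, show i ≠ 12 by omega]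
  · simp [Function.update_apply, f1, f2, h.hx]
  · simp [Function.update_apply, f1, f2, h.hr]
  · simp [Function.update_apply, f1, f2, h.hl]
  · exact c2
  · exact c1.agree a2 (by simpa using d)
  · refine nodup_of_count hnd fun a => ?_
    simp only [List.count_append, List.count_cons, elems_negate]; omega

/-- Moreover, the first step of the way is at hand. -/
structure AtHandStep (s : State) (x : Fin n) (l r : SignedTree n) (f : SignedFrame n)
    (path : List (SignedFrame n)) : Prop extends AtHand s x l r (f :: path) where
  hp : s.reg 13 = f.p
  hright : s.reg 14 = f.right.toNat
  ht : s.reg 15 = rootOr n f.t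
  ct : StoredCore s.mem f.t
  hneg : f.neg = false

theorem wp_absorb {x : Fin n} {l r : SignedTree n} {f : SignedFrame n}
    {path : List (SignedFrame n)} (h : AtHand s x l r (f :: path))
    (hh : Held s.mem (s.reg 13) (s.reg 14) (s.reg 15) (f :: path))
    (k : ∀ s' t' l' r' f', (∀ i, i < 6 ∨ 15 < i → s'.reg i = s.reg i) →
      AtHandStep s' x l' r' f' path → PathStored s'.mem f'.p path →
      splayed x l r (f :: path) = splayed x l' r' (f' :: path) →
      (∀ a, (elems l').count a + (elems r').count a + (pathElems [f']).count a =
        (elems l).count a + (elems r).count a + (pathElems [f]).count a) →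
      Agree (elems l ++ elems r ++ elems f.t) s.mem s'.mem → t' ≤ t + 18 → Q s' t') :
    Wp w (fstLayout n) absorbCmd s t Q := by
  obtain ⟨h1, h2, h3, h4, h5, h6⟩ := hh
  have hnd := h.nodup
  cases hneg : f.neg
  · simp only [absorbCmd, ↓wp_seq, ↓wp_load, ↓wp_branch, ↓wp_skip, h1, fstLayout, Fin.is_lt,
      Nat.reduceLT, if_true, true_and, Test.eval, Function.update_apply, h4, hneg,
      Bool.toNat_false, Nat.reduceEqDiff, if_false, h.env.r5, decide_false, Bool.false_eq_true,
      Nat.zero_ne_one]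
    refine k _ _ l r f (fun i hi => by simp [Function.update_apply, show i ≠ 6 by omega]) ?_ h6 rfl
      (fun _ => rfl) (.refl _ _) (by omega)
    refine ⟨⟨?_, ?_, ?_, ?_, h.cl, h.cr, h.nodup⟩, ?_, ?_, ?_, h5, hneg⟩
    · exact h.env.congr fun i hi => by simp [Function.update_apply, show i ≠ 6 by omega]
    all_goals simp [Function.update_apply, h.hx, h.hl, h.hr, h1, h2, h3]
  · simp only [absorbCmd, ↓wp_seq, ↓wp_load, ↓wp_branch, ↓wp_skip, h1, fstLayout, Fin.is_lt,
      Nat.reduceLT, if_true, true_and, Test.eval, Function.update_apply, h4, hneg,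
      Bool.toNat_true, Nat.reduceEqDiff, if_false, h.env.r5, decide_true, Bool.false_eq_true,
      Nat.zero_ne_one]
    refine wp_negate (T := f.t) ?_ (by simp) (by simp [Function.update_apply, h3]) h5 ?_
      fun s1 t1 f1 c1 a1 ht1 => ?_
    · exact h.env.congr fun i hi => by simp [Function.update_apply, show i ≠ 6 by omega]
    · exact nodup_of_count hnd fun a => by
        simp only [List.count_append, List.count_cons, pathElems]; omega
    simp only [Function.update_apply] at f1
    dsimp only at a1
    have d1 : List.Disjoint (elems l ++ elems r) (elems f.t) := disjoint_of_count hnd fun a => by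
      simp only [List.count_append, List.count_cons, pathElems]; omega
    have h' : AtHand s1 x l r (f.flip :: path) := by
      refine ⟨?_, ?_, ?_, ?_, ?_, ?_, ?_⟩
      · exact h.env.congr fun i hi => by simp [f1, show i ≠ 6 by omega]
      · simp [f1, h.hx]
      · simp [f1, h.hl]
      · simp [f1, h.hr]
      · exact h.cl.agree a1 (List.disjoint_append_left.1 d1).1
      · exact h.cr.agree a1 (List.disjoint_append_left.1 d1).2
      · exact nodup_of_count hnd fun a => by simp [pathElems]
    refine wp_swap h' fun s2 t2 f2 h2' a2 ht2 => ?_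
    simp only [↓wp_bin, BinOp.eval]
    refine k _ _ (negate r) (negate l) f.flip ?_ ?_ ?_ (splayed_flip hneg) ?_ ?_ (by omega)
    · intro i hi
      simp [Function.update_apply, f1, f2, show i ≠ 6 by omega,
        show i ≠ 11 by omega, show i ≠ 12 by omega, show i ≠ 14 by omega]
    · refine ⟨⟨?_, ?_, ?_, ?_, h2'.cl, h2'.cr, h2'.nodup⟩, ?_, ?_, ?_, ?_, rfl⟩
      · exact h2'.env.congr fun i hi => by simp [Function.update_apply, show i ≠ 14 by omega]
      · simp [Function.update_apply, h2'.hx]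
      · simp [Function.update_apply, h2'.hl]
      · simp [Function.update_apply, h2'.hr]
      · simp [Function.update_apply, f1, f2, h1]
      · cases hr : f.right <;> simp [Function.update_apply, f1, f2, h2, h.env.r5, hr]
      · simp [Function.update_apply, f1, f2, h3]
      · exact c1.agree a2 (by simpa using d1.symm)
    · refine (h6.agree a1 ?_).agree a2 ?_ <;>
      · exact disjoint_of_count hnd fun a => by
          simp only [List.count_append, List.count_cons, pathElems, SignedFrame.flip_p]; omega
    · intro a; simp [pathElems]; omega
    · exact a1.trans a2 (by simp) (by simp)

/-- The first two steps of the way are at hand. -/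
structure AtHandSteps (s : State) (x : Fin n) (l r : SignedTree n) (f g : SignedFrame n)
    (path : List (SignedFrame n)) : Prop extends AtHandStep s x l r f (g :: path) where
  hp₂ : s.reg 16 = g.p
  hright₂ : s.reg 17 = g.right.toNat
  ht₂ : s.reg 18 = rootOr n g.t
  ct₂ : StoredCore s.mem g.t
  hneg₂ : g.neg = false

theorem wp_absorbSecond {x : Fin n} {l r : SignedTree n} {f g : SignedFrame n}
    {path : List (SignedFrame n)} (h : AtHandStep s x l r f (g :: path))
    (hh : Held s.mem (s.reg 16) (s.reg 17) (s.reg 18) (g :: path))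
    (k : ∀ s' t' l' r' f' g', (∀ i, i < 6 ∨ 21 < i → s'.reg i = s.reg i) →
      AtHandSteps s' x l' r' f' g' path → PathStored s'.mem g'.p path →
      splayed x l r (f :: g :: path) = splayed x l' r' (f' :: g' :: path) →
      (∀ a, (elems l').count a + (elems r').count a + (pathElems [f', g']).count a =
        (elems l).count a + (elems r).count a + (pathElems [f, g]).count a) →
      Agree (elems l ++ elems r ++ elems f.t ++ elems g.t) s.mem s'.mem → t' ≤ t + 23 → Q s' t') :
    Wp w (fstLayout n) absorbSecondCmd s t Q := by
  obtain ⟨h1, h2, h3, h4, h5, h6⟩ := hh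
  have hnd := h.nodup
  cases hneg : g.neg
  · simp only [absorbSecondCmd, ↓wp_seq, ↓wp_load, ↓wp_branch, ↓wp_skip, h1, fstLayout, Fin.is_lt,
      Nat.reduceLT, if_true, true_and, Test.eval, Function.update_apply, h4, hneg,
      Bool.toNat_false, Nat.reduceEqDiff, if_false, h.env.r5, decide_false, Bool.false_eq_true,
      Nat.zero_ne_one]
    refine k _ _ l r f g (fun i hi => by simp [Function.update_apply, show i ≠ 6 by omega]) ?_ h6
      rfl (fun _ => rfl) (.refl _ _) (by omega)
    refine ⟨⟨⟨?_, ?_, ?_, ?_, h.cl, h.cr, h.nodup⟩, ?_, ?_, ?_, h.ct, h.hneg⟩, ?_, ?_, ?_, h5,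
      hneg⟩
    · exact h.env.congr fun i hi => by simp [Function.update_apply, show i ≠ 6 by omega]
    all_goals simp [Function.update_apply, h.hx, h.hl, h.hr, h1, h2, h3, h.hp, h.hright, h.ht]
  · simp only [absorbSecondCmd, ↓wp_seq, ↓wp_load, ↓wp_branch, ↓wp_skip, h1, fstLayout,
      Fin.is_lt, Nat.reduceLT, if_true, true_and, Test.eval, Function.update_apply, h4, hneg,
      Bool.toNat_true, Nat.reduceEqDiff, if_false, h.env.r5, decide_true, Bool.false_eq_true,
      Nat.zero_ne_one]
    have d1 : List.Disjoint (elems l ++ elems r ++ elems f.t) (elems g.t) :=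
      disjoint_of_count hnd fun a => by
        simp only [List.count_append, List.count_cons, pathElems]; omega
    have d2 : List.Disjoint (elems l ++ elems r) (elems f.t) :=
      disjoint_of_count hnd fun a => by
        simp only [List.count_append, List.count_cons, pathElems]; omega
    refine wp_negate (T := g.t) ?_ (by simp) (by simp [Function.update_apply, h3]) h5 ?_
      fun s1 t1 f1 c1 a1 ht1 => ?_
    · exact h.env.congr fun i hi => by simp [Function.update_apply, show i ≠ 6 by omega]
    · exact nodup_of_count hnd fun a => by
        simp only [List.count_append, List.count_cons, pathElems]; omega
    simp only [Function.update_apply] at f1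
    dsimp only at a1
    have e1 : Env n s1 := h.env.congr fun i hi => by simp [f1, show i ≠ 6 by omega]
    simp only [↓wp_bin, BinOp.eval]
    refine wp_negate (T := f.t) ?_ (by simp) (by simp [Function.update_apply, f1, h.ht])
      (h.ct.agree a1 (List.disjoint_append_left.1 d1).2) ?_ fun s2 t2 f2 c2 a2 ht2 => ?_
    · exact e1.congr fun i hi => by simp [Function.update_apply, show i ≠ 17 by omega]
    · exact nodup_of_count hnd fun a => by
        simp only [List.count_append, List.count_cons, pathElems]; omega
    simp only [Function.update_apply] at f2
    dsimp only at a2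
    have h' : AtHand s2 x l r (f.flip :: g.flip :: path) := by
      have d3 := List.disjoint_append_left.1 (List.disjoint_append_left.1 d1).1
      refine ⟨?_, ?_, ?_, ?_, ?_, ?_, ?_⟩
      · exact e1.congr fun i hi => by simp [f2, show i ≠ 6 by omega, show i ≠ 17 by omega]
      · simp [f2, f1, h.hx]
      · simp [f2, f1, h.hl]
      · simp [f2, f1, h.hr]
      · exact (h.cl.agree a1 d3.1).agree a2 (List.disjoint_append_left.1 d2).1
      · exact (h.cr.agree a1 d3.2).agree a2 (List.disjoint_append_left.1 d2).2
      · exact nodup_of_count hnd fun a => by simp [pathElems]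
    refine wp_swap h' fun s3 t3 f3 h3' a3 ht3 => ?_
    refine k _ _ (negate r) (negate l) f.flip g.flip ?_ ?_ ?_ (splayed_flip_flip h.hneg hneg)
      ?_ ?_ (by omega)
    · intro i hi
      simp [Function.update_apply, f1, f2, f3, show i ≠ 6 by omega,
        show i ≠ 11 by omega, show i ≠ 12 by omega, show i ≠ 14 by omega, show i ≠ 17 by omega]
    · refine ⟨⟨⟨?_, ?_, ?_, ?_, h3'.cl, h3'.cr, h3'.nodup⟩, ?_, ?_, ?_, ?_, rfl⟩,
        ?_, ?_, ?_, ?_, rfl⟩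
      · exact h3'.env.congr fun i hi => by simp [Function.update_apply, show i ≠ 14 by omega]
      · simp [Function.update_apply, h3'.hx]
      · simp [Function.update_apply, h3'.hl]
      · simp [Function.update_apply, h3'.hr]
      · simp [Function.update_apply, f1, f2, f3, h.hp]
      · cases hr : f.right <;> simp [Function.update_apply, f1, f2, f3, h.hright, h.env.r5, hr]
      · simp [Function.update_apply, f1, f2, f3, h.ht]
      · exact c2.agree a3 (by simpa using d2.symm)
      · simp [Function.update_apply, f1, f2, f3, h1]
      · cases hr : g.right <;> simp [Function.update_apply, f1, f2, f3, h2, h.env.r5, hr]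
      · simp [Function.update_apply, f1, f2, f3, h3]
      · refine (c1.agree a2 ?_).agree a3 ?_ <;>
        · exact disjoint_of_count hnd fun a => by
            simp only [List.count_append, List.count_cons, pathElems, elems_negate]; omega
    · refine ((h6.agree a1 ?_).agree a2 ?_).agree a3 ?_ <;>
      · exact disjoint_of_count hnd fun a => by
          simp only [List.count_append, List.count_cons, pathElems, SignedFrame.flip_p]; omega
    · intro a; simp [pathElems]; omega
    · exact (a1.trans a2 (S'' := elems f.t ++ elems g.t) (by simp) (by simp)).trans a3
        (by simp) (by simp)

theorem wp_zig (hw : n < 2 ^ w) {x : Fin n} {l r : SignedTree n} {f : SignedFrame n}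
    (h : AtHandStep s x l r f [])
    (k : ∀ s' t', (∀ i, i < 6 ∨ 21 < i → s'.reg i = s.reg i) →
      AtHand s' x (zig f l r).1 (zig f l r).2 [] →
      Agree (elems l ++ elems r ++ pathElems [f]) s.mem s'.mem → t' ≤ t + 17 → Q s' t') :
    Wp w (fstLayout n) zigCmd s t Q := by
  have hnd := h.nodup
  cases hr : f.right
  · simp only [zigCmd, ↓wp_seq, ↓wp_branch, Test.eval, h.hright, hr, h.env.r5, Bool.toNat_false,
      Nat.zero_ne_one, decide_false, Bool.false_eq_true, if_false]
    refine wp_assemble h.env hw (by simp) (by simp) (by simp) (by simp) (by simp) (by simp) h.hp h.hr h.ht h.cr h.ct ?_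
      fun s1 t1 f1 c1 a1 ht1 => ?_
    · exact nodup_of_count hnd fun a => by
        simp only [List.count_append, List.count_cons, pathElems]; omega
    have e1 : Env n s1 := h.env.congr fun i hi => f1 i (by omega) (by omega)
    simp only [mov, ↓wp_bin, BinOp.eval, e1.r4, Nat.sub_zero]
    refine k _ _ ?_ ?_ ?_ (by omega)
    · intro i hi
      simp [Function.update_apply, f1, show i ≠ 6 by omega, show i ≠ 7 by omega,
        show i ≠ 12 by omega]
    · simp only [zig, hr, Bool.false_eq_true, if_false]
      refine ⟨?_, ?_, ?_, ?_, ?_, c1, ?_⟩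
      · exact e1.congr fun i hi => by simp [Function.update_apply, show i ≠ 12 by omega]
      · simp [Function.update_apply, f1, h.hx]
      · simp [Function.update_apply, f1, h.hl]
      · simp [Function.update_apply, f1, h.hp]
      · exact h.cl.agree a1 (disjoint_of_count hnd fun a => by
          simp only [List.count_append, List.count_cons, pathElems]; omega)
      · exact nodup_of_count hnd fun a => by
          simp only [List.count_append, List.count_cons, pathElems, elems_node, List.count_nil]
          omega
    · exact a1.mono (subset_of_count fun a => by
        simp only [List.count_append, List.count_cons, pathElems]; omega)
  · simp only [zigCmd, ↓wp_seq, ↓wp_branch, Test.eval, h.hright, hr, h.env.r5, Bool.toNat_true,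
      decide_true, Bool.false_eq_true, if_true]
    refine wp_assemble h.env hw (by simp) (by simp) (by simp) (by simp) (by simp) (by simp) h.hp h.ht h.hl h.ct h.cl ?_
      fun s1 t1 f1 c1 a1 ht1 => ?_
    · exact nodup_of_count hnd fun a => by
        simp only [List.count_append, List.count_cons, pathElems]; omega
    have e1 : Env n s1 := h.env.congr fun i hi => f1 i (by omega) (by omega)
    simp only [mov, ↓wp_bin, BinOp.eval, e1.r4, Nat.sub_zero]
    refine k _ _ ?_ ?_ ?_ (by omega)
    · intro i hi
      simp [Function.update_apply, f1, show i ≠ 6 by omega, show i ≠ 7 by omega,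
        show i ≠ 11 by omega]
    · simp only [zig, hr, if_true]
      refine ⟨?_, ?_, ?_, ?_, c1, ?_, ?_⟩
      · exact e1.congr fun i hi => by simp [Function.update_apply, show i ≠ 11 by omega]
      · simp [Function.update_apply, f1, h.hx]
      · simp [Function.update_apply, f1, h.hp]
      · simp [Function.update_apply, f1, h.hr]
      · exact h.cr.agree a1 (disjoint_of_count hnd fun a => by
          simp only [List.count_append, List.count_cons, pathElems]; omega)
      · exact nodup_of_count hnd fun a => by
          simp only [List.count_append, List.count_cons, pathElems, elems_node, List.count_nil]
          omega
    · exact a1.mono (subset_of_count fun a => by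
        simp only [List.count_append, List.count_cons, pathElems]; omega)

theorem wp_zigzig (hw : n < 2 ^ w) {x : Fin n} {l r : SignedTree n} {f g : SignedFrame n}
    {path : List (SignedFrame n)} (h : AtHandSteps s x l r f g path)
    (k : ∀ s' t', (∀ i, i < 6 ∨ 18 < i → s'.reg i = s.reg i) →
      AtHand s' x (zigzig f g l r).1 (zigzig f g l r).2 path →
      Agree (elems l ++ elems r ++ pathElems [f, g]) s.mem s'.mem → t' ≤ t + 34 → Q s' t') :
    Wp w (fstLayout n) zigzigCmd s t Q := by
  have hnd := h.nodup
  cases hf : f.right <;> cases hg : g.right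
  · simp only [zigzigCmd, ↓wp_seq, ↓wp_branch, Test.eval, h.hright, h.hright₂, hf, hg, h.env.r5,
      Bool.toNat_false, Nat.zero_ne_one, decide_false, Bool.false_eq_true, if_false]
    refine wp_assemble h.env hw (by simp) (by simp) (by simp) (by simp) (by simp) (by simp) h.hp₂ h.ht h.ht₂ h.ct h.ct₂ ?_
      fun s1 t1 f1 c1 a1 ht1 => ?_
    · exact nodup_of_count hnd fun a => by
        simp only [List.count_append, List.count_cons, pathElems]; omega
    have e1 : Env n s1 := h.env.congr fun i hi => f1 i (by omega) (by omega)
    refine wp_assemble e1 hw (by simp) (by simp) (by simp) (by simp) (by simp) (by simp) (x := f.p) (by simp [f1, h.hp])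
      (l := r) (by simp [f1, h.hr]) (by simp [f1, h.hp₂])
      (h.cr.agree a1 ?_) c1 ?_ fun s2 t2 f2 c2 a2 ht2 => ?_
    · exact disjoint_of_count hnd fun a => by
        simp only [List.count_append, List.count_cons, pathElems]; omega
    · exact nodup_of_count hnd fun a => by
        simp only [List.count_append, List.count_cons, pathElems, elems_node]; omega
    have e2 : Env n s2 := e1.congr fun i hi => f2 i (by omega) (by omega)
    simp only [mov, ↓wp_bin, BinOp.eval, e2.r4, Nat.sub_zero]
    refine k _ _ ?_ ?_ ?_ (by omega)
    · intro i hi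
      simp [Function.update_apply, f1, f2, show i ≠ 6 by omega, show i ≠ 7 by omega,
        show i ≠ 12 by omega]
    · simp only [zigzig, hf, hg, Bool.false_eq_true, if_false]
      refine ⟨?_, ?_, ?_, ?_, ?_, c2, ?_⟩
      · exact e2.congr fun i hi => by simp [Function.update_apply, show i ≠ 12 by omega]
      · simp [Function.update_apply, f1, f2, h.hx]
      · simp [Function.update_apply, f1, f2, h.hl]
      · simp [Function.update_apply, f1, f2, h.hp]
      · refine (h.cl.agree a1 ?_).agree a2 ?_ <;>
        · exact disjoint_of_count hnd fun a => by
            simp only [List.count_append, List.count_cons, pathElems, elems_node]; omega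
      · exact nodup_of_count hnd fun a => by
          simp only [List.count_append, List.count_cons, pathElems, elems_node, List.count_nil]
          omega
    · refine a1.trans a2 ?_ ?_ <;>
      · exact subset_of_count fun a => by
          simp only [List.count_append, List.count_cons, pathElems, elems_node]; omega
  · simp only [zigzigCmd, ↓wp_seq, ↓wp_branch, Test.eval, h.hright, h.hright₂, hf, hg, h.env.r5,
      Bool.toNat_false, Bool.toNat_true, Nat.zero_ne_one, decide_false, decide_true,
      Bool.false_eq_true, if_false, if_true]
    refine wp_assemble h.env hw (by simp) (by simp) (by simp) (by simp) (by simp) (by simp) h.hp₂ h.ht₂ h.hl h.ct₂ h.cl ?_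
      fun s1 t1 f1 c1 a1 ht1 => ?_
    · exact nodup_of_count hnd fun a => by
        simp only [List.count_append, List.count_cons, pathElems, elems_node]; omega
    have e1 : Env n s1 := h.env.congr fun i hi => f1 i (by omega) (by omega)
    refine wp_assemble e1 hw (by simp) (by simp) (by simp) (by simp) (by simp) (by simp) (x := f.p) (by simp [f1, h.hp])
      (l := r) (by simp [f1, h.hr]) (r := f.t) (by simp [f1, h.ht])
      (h.cr.agree a1 ?_) (h.ct.agree a1 ?_) ?_ fun s2 t2 f2 c2 a2 ht2 => ?_
    · exact disjoint_of_count hnd fun a => by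
        simp only [List.count_append, List.count_cons, pathElems, elems_node]; omega
    · exact disjoint_of_count hnd fun a => by
        simp only [List.count_append, List.count_cons, pathElems, elems_node]; omega
    · exact nodup_of_count hnd fun a => by
        simp only [List.count_append, List.count_cons, pathElems, elems_node]; omega
    have e2 : Env n s2 := e1.congr fun i hi => f2 i (by omega) (by omega)
    simp only [mov, ↓wp_bin, BinOp.eval, e2.r4, Nat.sub_zero, Function.update_apply,
      Nat.reduceEqDiff, if_false]
    refine k _ _ ?_ ?_ ?_ (by omega)
    · intro i hi
      simp [Function.update_apply, f1, f2, show i ≠ 6 by omega, show i ≠ 7 by omega,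
        show i ≠ 11 by omega, show i ≠ 12 by omega]
    · have d : StoredCore s2.mem (.node (false, g.p) g.t l) := c1.agree a2 ?_
      · simp only [zigzig, hf, hg, Bool.false_eq_true, if_false, if_true]
        refine ⟨?_, ?_, ?_, ?_, d, c2, ?_⟩
        · exact e2.congr fun i hi => by
            simp [Function.update_apply, show i ≠ 11 by omega, show i ≠ 12 by omega]
        · simp [Function.update_apply, f1, f2, h.hx]
        · simp [Function.update_apply, f1, f2, h.hp₂]
        · simp [Function.update_apply, f1, f2, h.hp]
        · exact nodup_of_count hnd fun a => by
            simp only [List.count_append, List.count_cons, pathElems, elems_node, List.count_nil]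
            omega
      · exact disjoint_of_count hnd fun a => by
          simp only [List.count_append, List.count_cons, pathElems, elems_node]; omega
    · refine a1.trans a2 ?_ ?_ <;>
      · exact subset_of_count fun a => by
          simp only [List.count_append, List.count_cons, pathElems, elems_node]; omega
  · simp only [zigzigCmd, ↓wp_seq, ↓wp_branch, Test.eval, h.hright, h.hright₂, hf, hg, h.env.r5,
      Bool.toNat_false, Bool.toNat_true, Nat.zero_ne_one, decide_false, decide_true,
      Bool.false_eq_true, if_false, if_true]
    refine wp_assemble h.env hw (by simp) (by simp) (by simp) (by simp) (by simp) (by simp) h.hp h.ht h.hl h.ct h.cl ?_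
      fun s1 t1 f1 c1 a1 ht1 => ?_
    · exact nodup_of_count hnd fun a => by
        simp only [List.count_append, List.count_cons, pathElems, elems_node]; omega
    have e1 : Env n s1 := h.env.congr fun i hi => f1 i (by omega) (by omega)
    refine wp_assemble e1 hw (by simp) (by simp) (by simp) (by simp) (by simp) (by simp) (x := g.p) (by simp [f1, h.hp₂])
      (l := r) (by simp [f1, h.hr]) (r := g.t) (by simp [f1, h.ht₂])
      (h.cr.agree a1 ?_) (h.ct₂.agree a1 ?_) ?_ fun s2 t2 f2 c2 a2 ht2 => ?_
    · exact disjoint_of_count hnd fun a => by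
        simp only [List.count_append, List.count_cons, pathElems, elems_node]; omega
    · exact disjoint_of_count hnd fun a => by
        simp only [List.count_append, List.count_cons, pathElems, elems_node]; omega
    · exact nodup_of_count hnd fun a => by
        simp only [List.count_append, List.count_cons, pathElems, elems_node]; omega
    have e2 : Env n s2 := e1.congr fun i hi => f2 i (by omega) (by omega)
    simp only [mov, ↓wp_bin, BinOp.eval, e2.r4, Nat.sub_zero, Function.update_apply,
      Nat.reduceEqDiff, if_false]
    refine k _ _ ?_ ?_ ?_ (by omega)
    · intro i hi
      simp [Function.update_apply, f1, f2, show i ≠ 6 by omega, show i ≠ 7 by omega,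
        show i ≠ 11 by omega, show i ≠ 12 by omega]
    · have d : StoredCore s2.mem (.node (false, f.p) f.t l) := c1.agree a2 ?_
      · simp only [zigzig, hf, hg, Bool.false_eq_true, if_false, if_true]
        refine ⟨?_, ?_, ?_, ?_, d, c2, ?_⟩
        · exact e2.congr fun i hi => by
            simp [Function.update_apply, show i ≠ 11 by omega, show i ≠ 12 by omega]
        · simp [Function.update_apply, f1, f2, h.hx]
        · simp [Function.update_apply, f1, f2, h.hp]
        · simp [Function.update_apply, f1, f2, h.hp₂]
        · exact nodup_of_count hnd fun a => by
            simp only [List.count_append, List.count_cons, pathElems, elems_node, List.count_nil]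
            omega
      · exact disjoint_of_count hnd fun a => by
          simp only [List.count_append, List.count_cons, pathElems, elems_node]; omega
    · refine a1.trans a2 ?_ ?_ <;>
      · exact subset_of_count fun a => by
          simp only [List.count_append, List.count_cons, pathElems, elems_node]; omega
  · simp only [zigzigCmd, ↓wp_seq, ↓wp_branch, Test.eval, h.hright, h.hright₂, hf, hg, h.env.r5,
      Bool.toNat_true, decide_true, if_true]
    refine wp_assemble h.env hw (by simp) (by simp) (by simp) (by simp) (by simp) (by simp) h.hp₂ h.ht₂ h.ht h.ct₂ h.ct ?_
      fun s1 t1 f1 c1 a1 ht1 => ?_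
    · exact nodup_of_count hnd fun a => by
        simp only [List.count_append, List.count_cons, pathElems]; omega
    have e1 : Env n s1 := h.env.congr fun i hi => f1 i (by omega) (by omega)
    refine wp_assemble e1 hw (by simp) (by simp) (by simp) (by simp) (by simp) (by simp) (x := f.p) (by simp [f1, h.hp])
      (r := l) (by simp [f1, h.hp₂]) (by simp [f1, h.hl])
      c1 (h.cl.agree a1 ?_) ?_ fun s2 t2 f2 c2 a2 ht2 => ?_
    · exact disjoint_of_count hnd fun a => by
        simp only [List.count_append, List.count_cons, pathElems]; omega
    · exact nodup_of_count hnd fun a => by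
        simp only [List.count_append, List.count_cons, pathElems, elems_node]; omega
    have e2 : Env n s2 := e1.congr fun i hi => f2 i (by omega) (by omega)
    simp only [mov, ↓wp_bin, BinOp.eval, e2.r4, Nat.sub_zero]
    refine k _ _ ?_ ?_ ?_ (by omega)
    · intro i hi
      simp [Function.update_apply, f1, f2, show i ≠ 6 by omega, show i ≠ 7 by omega,
        show i ≠ 11 by omega]
    · simp only [zigzig, hf, hg, if_true]
      refine ⟨?_, ?_, ?_, ?_, c2, ?_, ?_⟩
      · exact e2.congr fun i hi => by simp [Function.update_apply, show i ≠ 11 by omega]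
      · simp [Function.update_apply, f1, f2, h.hx]
      · simp [Function.update_apply, f1, f2, h.hp]
      · simp [Function.update_apply, f1, f2, h.hr]
      · refine (h.cr.agree a1 ?_).agree a2 ?_ <;>
        · exact disjoint_of_count hnd fun a => by
            simp only [List.count_append, List.count_cons, pathElems, elems_node]; omega
      · exact nodup_of_count hnd fun a => by
          simp only [List.count_append, List.count_cons, pathElems, elems_node, List.count_nil]
          omega
    · refine a1.trans a2 ?_ ?_ <;>
      · exact subset_of_count fun a => by
          simp only [List.count_append, List.count_cons, pathElems, elems_node]; omega

/-- `s'` results from `s` by some steps of splaying. -/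
structure SplayedTo (s s' : State) (x : Fin n) (l r : SignedTree n) (path : List (SignedFrame n))
    (l' r' : SignedTree n) (path' : List (SignedFrame n)) : Prop where
  regs : ∀ i, i < 6 ∨ 21 < i → s'.reg i = s.reg i
  atHand : AtHand s' x l' r' path'
  held : Held s'.mem (s'.reg 13) (s'.reg 14) (s'.reg 15) path'
  same : splayed x l r path = splayed x l' r' path'
  count : ∀ a, (elems l').count a + (elems r').count a + (pathElems path').count a =
    (elems l).count a + (elems r).count a + (pathElems path).count a
  agree : Agree (elems l ++ elems r ++ pathElems path) s.mem s'.mem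

theorem pathElems_count_zigzig {f g : SignedFrame n} {l r : SignedTree n} (a : Fin n) :
    (elems (zigzig f g l r).1).count a + (elems (zigzig f g l r).2).count a =
      (elems l).count a + (elems r).count a + (pathElems [f, g]).count a := by
  cases hf : f.right <;> cases hg : g.right <;>
  · simp only [zigzig, hf, hg, Bool.false_eq_true, if_false, if_true, elems_node, pathElems,
      List.count_cons, List.count_append, List.count_nil]
    omega

theorem pathElems_count_zig {f : SignedFrame n} {l r : SignedTree n} (a : Fin n) :
    (elems (zig f l r).1).count a + (elems (zig f l r).2).count a =
      (elems l).count a + (elems r).count a + (pathElems [f]).count a := by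
  cases hf : f.right <;>
  · simp only [zig, hf, Bool.false_eq_true, if_false, if_true, elems_node, pathElems,
      List.count_cons, List.count_append, List.count_nil]
    omega

theorem wp_splayStep (hw : n < 2 ^ w) {x : Fin n} {l r : SignedTree n} {f : SignedFrame n}
    {path : List (SignedFrame n)} (h : AtHand s x l r (f :: path))
    (hh : Held s.mem (s.reg 13) (s.reg 14) (s.reg 15) (f :: path))
    (k : ∀ s' t' l' r' path', SplayedTo s s' x l r (f :: path) l' r' path' →
      path'.length ≤ path.length → t' ≤ t + 100 → Q s' t') :
    Wp w (fstLayout n) splayStepCmd s t Q := by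
  simp only [splayStepCmd, ↓wp_seq]
  refine wp_absorb h hh fun s1 t1 l1 r1 f1 q1 h1 p1 e1 cnt1 a1 ht1 => ?_
  have hnd1 := h1.nodup
  refine wp_frame h1.env (by simp) (by simp) (by simp) (by simp) (by simp) (by simp) (by simp)
    (by simp) (by simp) h1.hp p1 ?_ fun s2 t2 q2 m2 hh2 ht2 => ?_
  · exact nodup_of_count hnd1 fun a => by
      simp only [List.count_append, List.count_cons, pathElems]; omega
  have env2 : Env n s2 := h1.env.congr fun i hi => q2 i (by omega) (by omega) (by omega)
  have h2 : AtHandStep s2 x l1 r1 f1 path := by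
    refine ⟨⟨env2, ?_, ?_, ?_, m2 ▸ h1.cl, m2 ▸ h1.cr, h1.nodup⟩, ?_, ?_, ?_, m2 ▸ h1.ct, h1.hneg⟩
    · simp [q2, h1.hx]
    · simp [q2, h1.hl]
    · simp [q2, h1.hr]
    · simp [q2, h1.hp]
    · simp [q2, h1.hright]
    · simp [q2, h1.ht]
  rw [← m2] at hh2
  cases path with
  | nil =>
    simp only [↓wp_branch, ↓wp_seq, Test.eval, env2.r0, show s2.reg 16 = n from hh2, lt_irrefl,
      decide_false, Bool.false_eq_true, if_false]
    refine wp_zig hw h2 fun s3 t3 q3 h3 a3 ht3 => ?_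
    simp only [mov, ↓wp_bin, BinOp.eval, h3.env.r4, h3.env.r0, Nat.sub_zero]
    refine k _ _ _ _ [] ⟨?_, ⟨?_, ?_, ?_, ?_, h3.cl, h3.cr, h3.nodup⟩, ?_, ?_, ?_, ?_⟩ le_rfl
      (by omega)
    · intro i hi
      simp only [Function.update_apply, show i ≠ 13 by omega, if_false]
      rw [q3 i (by omega), q2 i (by omega) (by omega) (by omega), q1 i (by omega)]
    · exact h3.env.congr fun i hi => by simp [Function.update_apply, show i ≠ 13 by omega]
    · simp [Function.update_apply, h3.hx]
    · simp [Function.update_apply, h3.hl]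
    · simp [Function.update_apply, h3.hr]
    · simp [Held, Function.update_apply]
    · rw [e1, splayed_zig h1.hneg]
    · intro a
      have := pathElems_count_zig (f := f1) (l := l1) (r := r1) a
      have := cnt1 a
      simp only [pathElems, List.count_nil] at *
      omega
    · rw [m2] at a3
      refine a1.trans a3 (subset_of_count fun a => ?_) (subset_of_count fun a => ?_)
      · simp only [List.count_append, List.count_cons, pathElems]; omega
      · have := cnt1 a
        simp only [List.count_append]; omega
  | cons g path =>
    obtain ⟨g1, g2, g3, g4, g5, g6⟩ := id hh2
    simp only [↓wp_branch, ↓wp_seq, Test.eval, env2.r0, g1, Fin.is_lt, decide_true, if_true]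
    refine wp_absorbSecond h2 hh2 fun s3 t3 l3 r3 f3 g3 q3 h3 p3 e3 cnt3 a3 ht3 => ?_
    have hnd3 := h3.nodup
    refine wp_frame h3.env (by simp) (by simp) (by simp) (by simp) (by simp) (by simp) (by simp)
      (by simp) (by simp) h3.hp₂ p3 ?_ fun s4 t4 q4 m4 hh4 ht4 => ?_
    · exact nodup_of_count hnd3 fun a => by
        simp only [List.count_append, List.count_cons, pathElems]; omega
    have env4 : Env n s4 := h3.env.congr fun i hi => q4 i (by omega) (by omega) (by omega)
    have h4 : AtHandSteps s4 x l3 r3 f3 g3 path := by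
      refine ⟨⟨⟨env4, ?_, ?_, ?_, m4 ▸ h3.cl, m4 ▸ h3.cr, h3.nodup⟩, ?_, ?_, ?_, m4 ▸ h3.ct,
        h3.hneg⟩, ?_, ?_, ?_, m4 ▸ h3.ct₂, h3.hneg₂⟩
      · simp [q4, h3.hx]
      · simp [q4, h3.hl]
      · simp [q4, h3.hr]
      · simp [q4, h3.hp]
      · simp [q4, h3.hright]
      · simp [q4, h3.ht]
      · simp [q4, h3.hp₂]
      · simp [q4, h3.hright₂]
      · simp [q4, h3.ht₂]
    rw [← m4] at hh4
    refine wp_zigzig hw h4 fun s5 t5 q5 h5 a5 ht5 => ?_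
    simp only [mov, ↓wp_bin, BinOp.eval, h5.env.r4, Nat.sub_zero, Function.update_apply,
      Nat.reduceEqDiff, if_false, OfNat.ofNat_ne_zero, OfNat.zero_ne_ofNat]
    refine k _ _ _ _ path ⟨?_, ⟨?_, ?_, ?_, ?_, h5.cl, h5.cr, h5.nodup⟩, ?_, ?_, ?_, ?_⟩
      (by simp) (by omega)
    · intro i hi
      simp only [Function.update_apply, show i ≠ 13 by omega, show i ≠ 14 by omega,
        show i ≠ 15 by omega, if_false]
      rw [q5 i (by omega), q4 i (by omega) (by omega) (by omega), q3 i (by omega),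
        q2 i (by omega) (by omega) (by omega), q1 i (by omega)]
    · exact h5.env.congr fun i hi => by simp [Function.update_apply, show i ≠ 13 by omega,
        show i ≠ 14 by omega, show i ≠ 15 by omega]
    · simp [Function.update_apply, h5.hx]
    · simp [Function.update_apply, h5.hl]
    · simp [Function.update_apply, h5.hr]
    · simp only [Function.update_apply, Nat.reduceEqDiff, if_true, if_false]
      rw [q5 19 (by simp), q5 20 (by simp), q5 21 (by simp)]
      refine hh4.agree a5 (disjoint_of_count hnd3 fun a => ?_)
      simp only [List.count_append, List.count_cons, pathElems, List.count_nil]; omega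
    · rw [e1, e3, splayed_zigzig h3.hneg h3.hneg₂]
    · intro a
      have := pathElems_count_zigzig (f := f3) (g := g3) (l := l3) (r := r3) a
      have := cnt1 a
      have := cnt3 a
      simp only [pathElems, List.count_nil, List.count_append, List.count_cons] at *
      omega
    · rw [m2] at a3
      rw [m4] at a5
      refine a1.trans (a3.trans a5 (S'' := elems l1 ++ elems r1 ++ pathElems [f1, g])
        (subset_of_count fun a => ?_) (subset_of_count fun a => ?_))
        (subset_of_count fun a => ?_) (subset_of_count fun a => ?_)
      · simp only [List.count_append, List.count_cons, pathElems]; omega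
      · have := cnt3 a
        simp only [List.count_append]; omega
      · simp only [List.count_append, List.count_cons, pathElems]; omega
      · have := cnt1 a
        simp only [List.count_append, List.count_cons, pathElems, List.count_nil] at *; omega

theorem SplayedTo.trans {s₁ s₂ s₃ : State} {x : Fin n} {l₁ r₁ l₂ r₂ l₃ r₃ : SignedTree n}
    {p₁ p₂ p₃ : List (SignedFrame n)} (h : SplayedTo s₁ s₂ x l₁ r₁ p₁ l₂ r₂ p₂)
    (h' : SplayedTo s₂ s₃ x l₂ r₂ p₂ l₃ r₃ p₃) : SplayedTo s₁ s₃ x l₁ r₁ p₁ l₃ r₃ p₃ where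
  regs i hi := (h'.regs i hi).trans (h.regs i hi)
  atHand := h'.atHand
  held := h'.held
  same := h.same.trans h'.same
  count a := (h'.count a).trans (h.count a)
  agree := h.agree.trans h'.agree (List.Subset.refl _) (subset_of_count fun a => by
    have := h.count a
    simp only [List.count_append] at *; omega)

theorem wp_splayLoop (hw : n < 2 ^ w) {x : Fin n} : ∀ (m : ℕ) {s : State} {t : ℕ}
    {l r : SignedTree n} {path : List (SignedFrame n)}, path.length ≤ m → AtHand s x l r path →
    Held s.mem (s.reg 13) (s.reg 14) (s.reg 15) path →
    (∀ s' t' l' r', SplayedTo s s' x l r path l' r' [] →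
      t' ≤ t + 101 * path.length + 1 → Q s' t') →
    Wp w (fstLayout n) (.loop (.lt 13 0) splayStepCmd) s t Q := by
  intro m
  induction m with
  | zero =>
    intro s t l r path hm h hh k
    obtain rfl : path = [] := List.eq_nil_of_length_eq_zero (by omega)
    rw [wp_loop, if_neg (by simp [Test.eval, h.env.r0, show s.reg 13 = n from hh])]
    exact k _ _ l r ⟨fun _ _ => rfl, h, hh, rfl, fun _ => rfl, .refl _ _⟩ (by omega)
  | succ m ih =>
    intro s t l r path hm h hh k
    cases path with
    | nil =>
      rw [wp_loop, if_neg (by simp [Test.eval, h.env.r0, show s.reg 13 = n from hh])]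
      exact k _ _ l r ⟨fun _ _ => rfl, h, hh, rfl, fun _ => rfl, .refl _ _⟩ (by omega)
    | cons f path =>
      rw [wp_loop, if_pos (by simp [Test.eval, h.env.r0, hh.1])]
      refine wp_splayStep hw h hh fun s1 t1 l1 r1 p1 h1 hlen ht1 => ?_
      simp only [List.length_cons] at hm
      refine ih (by omega) h1.atHand h1.held fun s2 t2 l2 r2 h2 ht2 => k s2 t2 l2 r2 (h1.trans h2) ?_
      simp only [List.length_cons]
      omega

theorem count_plug (a : Fin n) {T : SignedTree n} {path : List (SignedFrame n)} :
    (elems (plug T path)).count a = (elems T).count a + (pathElems path).count a := by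
  induction path generalizing T with
  | nil => simp [plug, pathElems]
  | cons f path ih =>
    rw [plug, ih]
    split_ifs <;>
    · simp only [elems_node, pathElems, List.count_cons, List.count_append]; omega

theorem stored_plug {A : Memory} {b : Bool} {x : Fin n} {path : List (SignedFrame n)} :
    ∀ {l r : SignedTree n}, Stored A n 0 (plug (.node (b, x) l r) path) →
      StoredCore A (.node (b, x) l r) ∧ PathStored A x path := by
  induction path generalizing b x with
  | nil =>
    intro l r h
    obtain ⟨h1, h2, h3⟩ := stored_node.1 h
    exact ⟨h3, h1, h2⟩
  | cons f path ih =>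
    intro l r h
    rw [plug] at h
    cases hr : f.right
    · simp only [hr, Bool.false_eq_true, if_false] at h
      obtain ⟨⟨h0, -, h3, h4, h5⟩, h6⟩ := ih h
      obtain ⟨h41, h42, h43⟩ := stored_node.1 h4
      refine ⟨h43, ?_⟩
      simp only [PathStored, hr, Bool.false_eq_true, if_false]
      exact ⟨h41, h42, h0, h3, h5, h6⟩
    · simp only [hr, if_true] at h
      obtain ⟨⟨h0, -, h3, h4, h5⟩, h6⟩ := ih h
      obtain ⟨h51, h52, h53⟩ := stored_node.1 h5
      refine ⟨h53, ?_⟩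
      simp only [PathStored, hr, if_true]
      exact ⟨h51, h52, h0, h3, h4, h6⟩

/-- Put a tree at the lower end of a way in a splay tree. -/
def plugFrames {α : Type} : BinaryTree α → List (Frame α) → BinaryTree α
  | T, [] => T
  | T, .inLeft p t :: path => plugFrames (.node p T t) path
  | T, .inRight p t :: path => plugFrames (.node p t T) path

theorem unfold_plug {path : List (SignedFrame n)} : ∀ {T : SignedTree n},
    unfold false (plug T path) = plugFrames (unfold (pathRev path) T) (unfoldPath path) := by
  induction path with
  | nil => intro T; rfl
  | cons f path ih =>
    intro T
    rw [plug, ih, unfoldPath]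
    cases hr : f.right <;> cases hn : f.neg <;> cases hp : pathRev path <;>
      simp [unfold, pathRev, hr, hn, hp, mkFrame, plugFrames]

theorem locate_eq_none {α : Type} [DecidableEq α] {x : α} {T : BinaryTree α} :
    ∀ {path : List (Frame α)}, x ∉ inorder T → locate x T path = none := by
  induction T with
  | nil => intro path _; rfl
  | node y l r hl hr =>
    intro path h
    simp only [inorder, List.mem_append, List.mem_cons, not_or] at h
    rw [locate, if_neg (Ne.symm h.2.1), hl h.1, hr h.2.2]

theorem inorder_plugFrames {α : Type} (path : List (Frame α)) :
    ∃ a b, ∀ T : BinaryTree α, inorder (plugFrames T path) = a ++ inorder T ++ b := by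
  induction path with
  | nil => exact ⟨[], [], fun T => by simp [plugFrames]⟩
  | cons f path ih =>
    obtain ⟨a, b, h⟩ := ih
    rcases f with ⟨p, t⟩ | ⟨p, t⟩
    · exact ⟨a, p :: (inorder t ++ b), fun T => by simp [plugFrames, h, inorder]⟩
    · exact ⟨a ++ inorder t ++ [p], b, fun T => by simp [plugFrames, h, inorder]⟩

theorem locate_plugFrames {α : Type} [DecidableEq α] {x : α} {path : List (Frame α)} :
    ∀ {T : BinaryTree α} {z}, (inorder (plugFrames T path)).Nodup → x ∈ inorder T →
      locate x T path = some z → locate x (plugFrames T path) [] = some z := by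
  induction path with
  | nil => intro T z _ _ h; exact h
  | cons f path ih =>
    intro T z hnd hx h
    rcases f with ⟨p, t⟩ | ⟨p, t⟩
    · simp only [plugFrames] at hnd ⊢
      refine ih hnd (by simp [inorder, hx]) ?_
      obtain ⟨a, b, hab⟩ := inorder_plugFrames path
      rw [hab] at hnd
      have hpx : p ≠ x := by rintro rfl; simp [inorder, List.nodup_append] at hnd; grind
      rw [locate, if_neg hpx, h]
    · simp only [plugFrames] at hnd ⊢
      refine ih hnd (by simp [inorder, hx]) ?_
      obtain ⟨a, b, hab⟩ := inorder_plugFrames path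
      rw [hab] at hnd
      have hpx : p ≠ x := by rintro rfl; simp [inorder, List.nodup_append] at hnd; grind
      have hxt : x ∉ inorder t := by intro h; simp [inorder, List.nodup_append] at hnd; grind
      rw [locate, if_neg hpx, locate_eq_none hxt, h]

theorem splay_plugFrames {α : Type} [DecidableEq α] {x : α} {l r : BinaryTree α}
    {path : List (Frame α)} (hnd : (inorder (plugFrames (.node x l r) path)).Nodup) :
    splay x (plugFrames (.node x l r) path) = splayUp x l r path := by
  have : locate x (plugFrames (.node x l r) path) [] = some (l, r, path) :=
    locate_plugFrames hnd (by simp [inorder]) (by simp [locate])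
  rw [splay, this]

theorem count_inorder_unfold (a : Fin n) (T : SignedTree n) : ∀ rev : Bool,
    (inorder (unfold rev T)).count a = (elems T).count a := by
  induction T with
  | nil => intro rev; rfl
  | node v l r hl hr =>
    obtain ⟨b, x⟩ := v
    intro rev
    rw [unfold]
    split_ifs <;>
    · simp only [inorder, elems_node, List.count_append, List.count_cons, hl, hr]; omega

theorem perm_inorder_unfold (rev : Bool) (T : SignedTree n) :
    (inorder (unfold rev T)).Perm (elems T) :=
  List.perm_iff_count.2 fun a => count_inorder_unfold a T rev

theorem wp_splay (hw : n < 2 ^ w) {b : Bool} {x : Fin n} {l r : SignedTree n}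
    {path : List (SignedFrame n)} (he : Env n s) (hx : s.reg 10 = x)
    (hS : Stored s.mem n 0 (plug (.node (b, x) l r) path))
    (hnd : (elems (plug (.node (b, x) l r) path)).Nodup)
    (k : ∀ s' t' l' r', (∀ i, i < 6 ∨ 21 < i → s'.reg i = s.reg i) → AtHand s' x l' r' [] →
      splay x (unfold false (plug (.node (b, x) l r) path)) =
        .node x (unfold false l') (unfold false r') →
      Agree (elems (plug (.node (b, x) l r) path)) s.mem s'.mem →
      t' ≤ t + 101 * path.length + 40 → Q s' t') :
    Wp w (fstLayout n) splayCmd s t Q := by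
  obtain ⟨hc, hp⟩ := stored_plug hS
  have hnd' : (x :: (elems l ++ elems r ++ pathElems path)).Nodup :=
    nodup_of_count hnd fun a => by
      rw [count_plug]; simp only [elems_node, List.count_cons, List.count_append]; omega
  have hnd2 : (elems (.node (b, x) l r)).Nodup := nodup_of_count hnd' fun a => by
    simp only [elems_node, List.count_cons, List.count_append]; omega
  have hspl : splay x (unfold false (plug (.node (b, x) l r) path)) =
      splayed x (if b then negate r else l) (if b then negate l else r) path := by
    have h1 := (perm_inorder_unfold false (plug (.node (b, x) l r) path)).nodup_iff.2 hnd
    rw [unfold_plug] at h1 ⊢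
    cases b <;> cases h : pathRev path <;> simp only [unfold, h, splayed] at h1 ⊢ <;>
      simpa using splay_plugFrames h1
  have h3 : s.mem 3 x = b.toNat := hc.2.2.1
  have hl := hc.2.2.2.1.core
  have hr := hc.2.2.2.2.core
  simp only [splayCmd, ↓wp_seq]
  refine wp_children he (by simp) (by simp) (by simp) (by simp) (by simp) (by simp) hx hc hnd2
    fun s1 t1 q1 m1 hl1 hr1 ht1 => ?_
  have e1 : Env n s1 := he.congr fun i hi => q1 i (by omega) (by omega) (by omega)
  have hx1 : s1.reg 10 = x := by simp [q1, hx]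
  -- Both for a positive and for a negative sign, it remains to run the loop.
  have main : ∀ (l1 r1 : SignedTree n) (s2 : State) (t2 : ℕ), AtHand s2 x l1 r1 path →
      splay x (unfold false (plug (.node (b, x) l r) path)) = splayed x l1 r1 path →
      (∀ a, (elems l1).count a + (elems r1).count a = (elems l).count a + (elems r).count a) →
      (∀ i, i < 6 ∨ 21 < i → s2.reg i = s.reg i) →
      Agree (elems l ++ elems r) s.mem s2.mem → t2 ≤ t + 25 →
      Wp w (fstLayout n) (.seq (frameCmd 10 13 14 15) (.loop (.lt 13 0) splayStepCmd)) s2 t2 Q := by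
    intro l1 r1 s2 t2 h2 hs2 cnt q2 a2 ht2
    rw [wp_seq]
    refine wp_frame h2.env (by simp) (by simp) (by simp) (by simp) (by simp) (by simp) (by simp)
      (by simp) (by simp) h2.hx (hp.agree a2 ?_) ?_ fun s3 t3 q3 m3 hh3 ht3 => ?_
    · exact disjoint_of_count hnd' fun a => by
        simp only [List.count_cons, List.count_append]; omega
    · exact nodup_of_count hnd' fun a => by
        simp only [List.count_cons, List.count_append]; omega
    have h3 : AtHand s3 x l1 r1 path := by
      refine ⟨h2.env.congr fun i hi => q3 i (by omega) (by omega) (by omega), ?_, ?_, ?_,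
        m3 ▸ h2.cl, m3 ▸ h2.cr, h2.nodup⟩
      · simp [q3, h2.hx]
      · simp [q3, h2.hl]
      · simp [q3, h2.hr]
    rw [← m3] at hh3
    refine wp_splayLoop hw path.length le_rfl h3 hh3 fun s4 t4 l4 r4 h4 ht4 => ?_
    refine k s4 t4 l4 r4 (fun i hi => ?_) h4.atHand ?_ ?_ (by omega)
    · rw [h4.regs i hi, q3 i (by omega) (by omega) (by omega), q2 i hi]
    · rw [hs2, h4.same]; rfl
    · have a4 := h4.agree
      rw [m3] at a4
      refine a2.trans a4 (subset_of_count fun a => ?_) (subset_of_count fun a => ?_)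
      · rw [count_plug]; simp only [elems_node, List.count_cons, List.count_append]; omega
      · rw [count_plug]
        have := cnt a
        simp only [elems_node, List.count_cons, List.count_append] at *; omega
  simp only [↓wp_seq, ↓wp_load, ↓wp_branch, ↓wp_skip, Test.eval, Function.update_apply, hx1, m1, h3,
    e1.r5, fstLayout, Fin.is_lt, Nat.reduceLT, if_true, if_false, true_and, Nat.reduceEqDiff]
  cases b
  · simp only [Bool.toNat_false, Nat.zero_ne_one, decide_false, Bool.false_eq_true, if_false]
    rw [← wp_seq]
    refine main l r _ _ ⟨?_, ?_, ?_, ?_, hl, hr, hnd'⟩ (by simpa using hspl) (fun a => rfl) ?_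
      (.refl _ _) (by omega)
    · exact e1.congr fun i hi => by simp [Function.update_apply, show i ≠ 6 by omega]
    · simp [Function.update_apply, hx1]
    · simp [Function.update_apply, hl1]
    · simp [Function.update_apply, hr1]
    · intro i hi
      simp [Function.update_apply, show i ≠ 6 by omega,
        q1 i (by omega) (by omega) (by omega)]
  · simp only [Bool.toNat_true, decide_true, if_true]
    refine wp_swap (x := x) (l := l) (r := r) (path := path) ⟨?_, ?_, ?_, ?_, hl, hr, hnd'⟩
      fun s2 t2 q2 h2 a2 ht2 => ?_
    · exact e1.congr fun i hi => by simp [Function.update_apply, show i ≠ 6 by omega]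
    · simp [Function.update_apply, hx1]
    · simp [Function.update_apply, hl1]
    · simp [Function.update_apply, hr1]
    rw [← wp_seq]
    refine main _ _ _ _ h2 (by simpa using hspl) (fun a => by simp; omega) ?_ a2 (by omega)
    intro i hi
    rw [q2 i (by omega) (by omega) (by omega)]
    simp [Function.update_apply, show i ≠ 6 by omega, q1 i (by omega) (by omega) (by omega)]
end

/-! ### Access by rank -/

/-- With the roots of the subtrees of the node in register 22, in their order, in the registers 25
and 26: stop at this node or go on to one of them. -/
def descendCmd : Cmd :=
  .seq (.seq (mov 28 4) (.branch (.lt 25 0) (.load 28 2 25) .skip)) <|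
  .branch (.lt 23 28) (mov 22 25)
    (.branch (.eq 23 28) (mov 27 4)
      (.seq (.bin .sub 23 23 28) <| .seq (.bin .sub 23 23 5) (mov 22 26)))

/-- In register 24 there is a bit that tells whether the subtree of the current node, in register
22, is to be read reversed; register 23 holds the rank of the node that is looked for, and register
27 is `0` as soon as it is found. -/
def findStepCmd : Cmd :=
  .seq (.load 6 3 22) <| .seq (.branch (.eq 6 5) (.bin .sub 24 5 24) .skip) <|
  .seq (childrenCmd 22 25 26) <|
  .seq (.branch (.eq 24 5) (.seq (mov 6 25) <| .seq (mov 25 26) (mov 26 6)) .skip) descendCmd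

/-- In the tree with root in register 22, find the node with the rank that is in register 23. -/
def findCmd : Cmd :=
  .seq (mov 24 4) <| .seq (mov 27 5) (.loop (.eq 27 5) findStepCmd)

section
variable {n w : ℕ} {s : State} {t : ℕ} {Q : State → ℕ → Prop}

theorem plug_append {T : SignedTree n} {path : List (SignedFrame n)} {f : SignedFrame n} :
    plug T (path ++ [f]) = plug (plug T path) [f] := by
  induction path generalizing T with
  | nil => rfl
  | cons g path ih => rw [List.cons_append, plug, ih]; rfl

theorem length_inorder_unfold (rev : Bool) (T : SignedTree n) :
    (inorder (unfold rev T)).length = T.numNodes := by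
  rw [(perm_inorder_unfold rev T).length_eq, length_elems]

/-- The state of the search for the node of rank `q` in `T`. -/
structure Searching (s : State) (T : SignedTree n) (q : ℕ) (rev : Bool) : Prop where
  env : Env n s
  root : s.reg 22 = rootOr n T
  rank : s.reg 23 = q
  rev : s.reg 24 = rev.toNat
  flag : s.reg 27 = 1
  core : StoredCore s.mem T
  nodup : (elems T).Nodup

theorem wp_descend {s₀ : State} {x : Fin n} {A B : SignedTree n} {q : ℕ} {rev : Bool}
    (e : Env n s) (m2 : s.mem = s₀.mem)
    (h22 : s.reg 22 = x) (h23 : s.reg 23 = q) (h24 : s.reg 24 = rev.toNat)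
    (h25 : s.reg 25 = rootOr n A) (h26 : s.reg 26 = rootOr n B) (h27 : s.reg 27 = 1)
    (cA : StoredCore s₀.mem A) (cB : StoredCore s₀.mem B)
    (nA : (elems A).Nodup) (nB : (elems B).Nodup)
    (q2 : ∀ i, (i < 6 ∨ 6 < i) → (i < 22 ∨ 28 < i) → s.reg i = s₀.reg i)
    (k : ∀ s' t', (∀ i, (i < 6 ∨ 6 < i) → (i < 22 ∨ 28 < i) → s'.reg i = s₀.reg i) →
      s'.mem = s₀.mem → t' ≤ t + 15 →
      (q < A.numNodes ∧ Searching s' A q rev ∨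
        q = A.numNodes ∧ s'.reg 22 = x ∧ s'.reg 27 = 0 ∨
        A.numNodes < q ∧ Searching s' B (q - A.numNodes - 1) rev) → Q s' t') :
    Wp w (fstLayout n) descendCmd s t Q := by
  rw [descendCmd, wp_seq]
  refine Wp.mono (Q := fun s3 t3 => s3.mem = s₀.mem ∧ t3 ≤ t + 3 ∧ s3.reg 28 = A.numNodes ∧
    ∀ i, i ≠ 28 → s3.reg i = s.reg i) ?_ ?_
  · rcases A with _ | ⟨⟨b', y⟩, al, ar⟩
    · simp only [mov, BinOp.eval, ↓wp_seq, ↓wp_bin, ↓wp_branch, ↓wp_skip, Test.eval,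
        Function.update_apply, e.r4, e.r0, h25, rootOr_nil, Nat.reduceEqDiff, if_true, if_false,
        lt_irrefl, decide_false, Bool.false_eq_true, OfNat.ofNat_ne_zero, OfNat.zero_ne_ofNat]
      exact ⟨m2, by omega, by simp, fun i hi => by simp [hi]⟩
    · have hs : s₀.mem 2 y = _ := cA.2.1
      simp only [mov, BinOp.eval, ↓wp_seq, ↓wp_bin, ↓wp_branch, ↓wp_load, Test.eval,
        Function.update_apply, e.r4, e.r0, h25, rootOr_node, Nat.reduceEqDiff, if_true, if_false,
        Fin.is_lt, decide_true, OfNat.ofNat_ne_zero, OfNat.zero_ne_ofNat, fstLayout,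
        Nat.reduceLT, true_and]
      exact ⟨m2, by omega, by simp [m2, hs], fun i hi => by simp [hi]⟩
  · rintro s3 t3 ⟨m3, ht3, h28, q3⟩
    have e3 : Env n s3 := e.congr fun i hi => q3 i (by omega)
    have g22 := (q3 22 (by simp)).trans h22
    have g23 := (q3 23 (by simp)).trans h23
    have g24 := (q3 24 (by simp)).trans h24
    have g25 := (q3 25 (by simp)).trans h25
    have g26 := (q3 26 (by simp)).trans h26
    have g27 := (q3 27 (by simp)).trans h27
    have frame : ∀ i, (i < 6 ∨ 6 < i) → (i < 22 ∨ 28 < i) → s3.reg i = s₀.reg i := fun i h1 h2 =>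
      (q3 i (by omega)).trans (q2 i h1 h2)
    rcases lt_trichotomy q A.numNodes with hq | hq | hq
    · simp only [mov, BinOp.eval, ↓wp_branch, ↓wp_bin, Test.eval, g23, h28, hq, decide_true,
        if_true, e3.r4, Nat.sub_zero]
      refine k _ _ (fun i h1 h2 => ?_) m3 (by omega) (.inl ⟨hq, ?_, ?_, ?_, ?_, ?_, ?_, nA⟩)
      · simp [Function.update_apply, show i ≠ 22 by omega, frame i h1 h2]
      · exact e3.congr fun i hi => by simp [Function.update_apply, show i ≠ 22 by omega]
      · simp [g25]
      · simp [Function.update_apply, g23]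
      · simp [Function.update_apply, g24]
      · simp [Function.update_apply, g27]
      · rwa [m3]
    · simp only [mov, BinOp.eval, ↓wp_branch, ↓wp_bin, Test.eval, g23, h28, hq, decide_true,
        if_true, e3.r4, Nat.sub_zero, lt_irrefl, decide_false, if_false, Bool.false_eq_true]
      refine k _ _ (fun i h1 h2 => ?_) m3 (by omega) (.inr (.inl ⟨hq, ?_, ?_⟩))
      · simp [Function.update_apply, show i ≠ 27 by omega, frame i h1 h2]
      · simp [Function.update_apply, g22]
      · simp
    · simp only [mov, BinOp.eval, ↓wp_branch, ↓wp_bin, ↓wp_seq, Test.eval, g23, h28, hq.not_gt,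
        hq.ne', if_true, e3.r4, e3.r5, Nat.sub_zero, decide_false, if_false, Bool.false_eq_true,
        Function.update_apply, Nat.reduceEqDiff, OfNat.ofNat_ne_zero, OfNat.zero_ne_ofNat]
      refine k _ _ (fun i h1 h2 => ?_) m3 (by omega)
        (.inr (.inr ⟨hq, ?_, ?_, ?_, ?_, ?_, ?_, nB⟩))
      · simp [Function.update_apply, show i ≠ 22 by omega, show i ≠ 23 by omega, frame i h1 h2]
      · exact e3.congr fun i hi => by
          simp [Function.update_apply, show i ≠ 22 by omega, show i ≠ 23 by omega]
      · simp [Function.update_apply, g26]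
      · simp [Function.update_apply]
      · simp [Function.update_apply, g24]
      · simp [Function.update_apply, g27]
      · rwa [m3]

theorem wp_findStep {b : Bool} {x : Fin n} {l r : SignedTree n} {q : ℕ} {rev : Bool}
    (h : Searching s (.node (b, x) l r) q rev)
    (k : ∀ s' t', (∀ i, (i < 6 ∨ 6 < i) → (i < 22 ∨ 28 < i) → s'.reg i = s.reg i) →
      s'.mem = s.mem → t' ≤ t + 40 →
      (q < (if xor rev b then r else l).numNodes ∧
          Searching s' (if xor rev b then r else l) q (xor rev b) ∨
        q = (if xor rev b then r else l).numNodes ∧ s'.reg 22 = x ∧ s'.reg 27 = 0 ∨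
        (if xor rev b then r else l).numNodes < q ∧
          Searching s' (if xor rev b then l else r)
            (q - (if xor rev b then r else l).numNodes - 1) (xor rev b)) → Q s' t') :
    Wp w (fstLayout n) findStepCmd s t Q := by
  have hc := h.core
  have h3 : s.mem 3 x = b.toNat := hc.2.2.1
  have hnd := h.nodup
  have hroot : s.reg 22 = x := h.root
  have hl := hc.2.2.2.1.core
  have hr := hc.2.2.2.2.core
  have ndl : (elems l).Nodup := nodup_of_count hnd fun a => by
    simp only [elems_node, List.count_cons, List.count_append]; omega
  have ndr : (elems r).Nodup := nodup_of_count hnd fun a => by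
    simp only [elems_node, List.count_cons, List.count_append]; omega
  simp only [findStepCmd, ↓wp_seq]
  simp only [↓wp_seq, ↓wp_load, hroot, h3, fstLayout, Fin.is_lt, Nat.reduceLT, if_true, true_and]
  refine Wp.mono (Q := fun s1 t1 => s1.mem = s.mem ∧ t1 ≤ t + 3 ∧
    s1.reg 24 = (xor rev b).toNat ∧ ∀ i, i ≠ 6 → i ≠ 24 → s1.reg i = s.reg i) ?_ ?_
  · cases b
    · simp only [↓wp_branch, ↓wp_skip, Test.eval, Function.update_apply, Bool.toNat_false, h.env.r5,
        Nat.reduceEqDiff, if_true, if_false, Nat.zero_ne_one, decide_false, Bool.false_eq_true]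
      exact ⟨trivial, by omega, by simp [h.rev], fun i h1 h2 => by simp [h1]⟩
    · simp only [↓wp_branch, ↓wp_bin, Test.eval, Function.update_apply, Bool.toNat_true, h.env.r5,
        Nat.reduceEqDiff, if_true, if_false, decide_true, BinOp.eval]
      refine ⟨trivial, by omega, ?_, fun i h1 h2 => by simp [h1, h2]⟩
      cases rev <;> simp [h.rev]
  rintro s1 t1 ⟨m1, ht1, g24, q1⟩
  refine wp_children (h.env.congr fun i hi => q1 i (by omega) (by omega)) (by simp) (by simp)
    (by simp) (by simp) (by simp) (by simp) (x := x) (by simp [q1, hroot]) (m1 ▸ hc) hnd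
    fun s2 t2 q2 m2 hl2 hr2 ht2 => ?_
  have e2 : Env n s2 := h.env.congr fun i hi => by
    rw [q2 i (by omega) (by omega) (by omega), q1 i (by omega) (by omega)]
  have frame : ∀ i, (i < 6 ∨ 6 < i) → (i < 22 ∨ 28 < i) → s2.reg i = s.reg i := fun i h1 h2 => by
    rw [q2 i (by omega) (by omega) (by omega), q1 i (by omega) (by omega)]
  have f22 : s2.reg 22 = x := by simp [q2, q1, hroot]
  have f23 : s2.reg 23 = q := by simp [q2, q1, h.rank]
  have f24 : s2.reg 24 = (xor rev b).toNat := by simp [q2, g24]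
  have f27 : s2.reg 27 = 1 := by simp [q2, q1, h.flag]
  cases hrev : xor rev b
  · simp only [hrev, Bool.false_eq_true, if_false] at k
    simp only [↓wp_branch, ↓wp_skip, Test.eval, f24, hrev, Bool.toNat_false, e2.r5, Nat.zero_ne_one,
      decide_false, Bool.false_eq_true, if_false]
    exact wp_descend e2 (m2.trans m1) f22 f23 (by rw [f24, hrev]) hl2 hr2 f27 hl hr ndl ndr
      frame fun s' t' h1 h2 h3 h4 => k s' t' h1 h2 (by omega) h4
  · simp only [hrev, if_true] at k
    simp only [↓wp_branch, ↓wp_seq, ↓wp_bin, mov, BinOp.eval, Test.eval, f24, hrev, Bool.toNat_true,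
      e2.r5, decide_true, if_true, e2.r4, Nat.sub_zero, Function.update_apply, Nat.reduceEqDiff,
      if_false, OfNat.ofNat_ne_zero, OfNat.zero_ne_ofNat]
    refine wp_descend (rev := true) ?_ (m2.trans m1) ?_ ?_ ?_ ?_ ?_ ?_ hr hl ndr ndl ?_
      fun s' t' h1 h2 h3 h4 => k s' t' h1 h2 (by omega) h4
    · exact e2.congr fun i hi => by
        simp [Function.update_apply, show i ≠ 6 by omega, show i ≠ 25 by omega,
          show i ≠ 26 by omega]
    · simp [Function.update_apply, f22]
    · simp [Function.update_apply, f23]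
    · simp [Function.update_apply, f24, hrev]
    · simp [Function.update_apply, hr2]
    · simp [Function.update_apply, hl2]
    · simp [Function.update_apply, f27]
    · intro i h1 h2
      simp [Function.update_apply, show i ≠ 6 by omega, show i ≠ 25 by omega,
        show i ≠ 26 by omega, frame i h1 h2]

theorem wp_findLoop {T : SignedTree n} : ∀ {s : State} {t q : ℕ} {rev : Bool},
    Searching s T q rev → q < T.numNodes →
    (∀ s' t' b (x : Fin n) l r path, (∀ i, (i < 6 ∨ 6 < i) → (i < 22 ∨ 28 < i) → s'.reg i = s.reg i) →
      s'.mem = s.mem → T = plug (.node (b, x) l r) path → s'.reg 22 = (x : ℕ) →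
      (inorder (unfold rev T))[q]? = some x → t' ≤ t + 50 * path.length + 50 → Q s' t') →
    Wp w (fstLayout n) (.loop (.eq 27 5) findStepCmd) s t Q := by
  induction T with
  | nil => intro s t q rev _ hq; simp at hq
  | node v l r ihl ihr =>
    obtain ⟨b, x⟩ := v
    intro s t q rev h hq k
    rw [wp_loop, if_pos (by simp [Test.eval, h.flag, h.env.r5])]
    refine wp_findStep h fun s1 t1 q1 m1 ht1 hcases => ?_
    have hinorder : inorder (unfold rev (.node (b, x) l r)) =
        inorder (unfold (xor rev b) (if xor rev b then r else l)) ++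
          x :: inorder (unfold (xor rev b) (if xor rev b then l else r)) := by
      cases hr : xor rev b <;> simp [unfold, hr, inorder]
    rcases hcases with ⟨hlt, h1⟩ | ⟨heq, h22, h27⟩ | ⟨hlt, h1⟩
    · -- The node is in the left subtree.
      have main : ∀ s' t' b' (x' : Fin n) l' r' path,
          (∀ i, (i < 6 ∨ 6 < i) → (i < 22 ∨ 28 < i) → s'.reg i = s1.reg i) → s'.mem = s1.mem →
          (if xor rev b then r else l) = plug (.node (b', x') l' r') path → s'.reg 22 = (x' : ℕ) →
          (inorder (unfold (xor rev b) (if xor rev b then r else l)))[q]? = some x' →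
          t' ≤ t1 + 50 * path.length + 50 → Q s' t' := by
        intro s' t' b' x' l' r' path q2 m2 hT h22 hget ht'
        refine k s' t' b' x' l' r'
          (path ++ [⟨xor rev b, b, x, if xor rev b then l else r⟩])
          (fun i h1 h2 => (q2 i h1 h2).trans (q1 i h1 h2)) (m2.trans m1) ?_ h22 ?_ ?_
        · rw [plug_append, ← hT]
          cases hr : xor rev b <;> simp [plug]
        · rw [hinorder, List.getElem?_append_left
            (by rw [length_inorder_unfold]; exact hlt), hget]
        · simp only [List.length_append, List.length_singleton]; omega
      cases hr : xor rev b
      · simp only [hr, Bool.false_eq_true, if_false] at h1 hlt main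
        exact ihl h1 hlt main
      · simp only [hr, if_true] at h1 hlt main
        exact ihr h1 hlt main
    · rw [wp_loop, if_neg]
      · refine k s1 _ b x l r [] q1 m1 rfl h22 ?_ (by simp; omega)
        rw [hinorder, List.getElem?_append_right (by rw [length_inorder_unfold]; omega),
          length_inorder_unfold, heq]
        simp
      · have : s1.reg 5 = 1 := (q1 5 (by simp) (by simp)).trans h.env.r5
        simp [Test.eval, h27, this]
    · have hsum : (if xor rev b then r else l : SignedTree n).numNodes +
          (if xor rev b then l else r : SignedTree n).numNodes + 1 =
            (BinaryTree.node (b, x) l r).numNodes := by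
        cases hr : xor rev b <;> simp [Nat.add_comm]
      have hlt' : q - (if xor rev b then r else l : SignedTree n).numNodes - 1 <
          (if xor rev b then l else r : SignedTree n).numNodes := by omega
      have main : ∀ s' t' b' (x' : Fin n) l' r' path,
          (∀ i, (i < 6 ∨ 6 < i) → (i < 22 ∨ 28 < i) → s'.reg i = s1.reg i) → s'.mem = s1.mem →
          (if xor rev b then l else r) = plug (.node (b', x') l' r') path → s'.reg 22 = (x' : ℕ) →
          (inorder (unfold (xor rev b) (if xor rev b then l else r)))[
            q - (if xor rev b then r else l : SignedTree n).numNodes - 1]? = some x' →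
          t' ≤ t1 + 50 * path.length + 50 → Q s' t' := by
        intro s' t' b' x' l' r' path q2 m2 hT h22 hget ht'
        refine k s' t' b' x' l' r'
          (path ++ [⟨!xor rev b, b, x, if xor rev b then r else l⟩])
          (fun i h1 h2 => (q2 i h1 h2).trans (q1 i h1 h2)) (m2.trans m1) ?_ h22 ?_ ?_
        · rw [plug_append, ← hT]
          cases hr : xor rev b <;> simp [plug]
        · rw [hinorder, List.getElem?_append_right (by rw [length_inorder_unfold]; omega),
            length_inorder_unfold, ← hget]
          obtain ⟨d, hd⟩ : ∃ d, q - (if xor rev b then r else l : SignedTree n).numNodes = d + 1 :=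
            ⟨_, (Nat.succ_pred_eq_of_pos (by omega)).symm⟩
          rw [hd]
          simp
        · simp only [List.length_append, List.length_singleton]; omega
      cases hr : xor rev b
      · simp only [hr, Bool.false_eq_true, if_false] at h1 hlt' main
        exact ihr h1 hlt' main
      · simp only [hr, if_true] at h1 hlt' main
        exact ihl h1 hlt' main

theorem wp_find {T : SignedTree n} {q : ℕ} (he : Env n s) (hroot : s.reg 22 = rootOr n T)
    (hq : s.reg 23 = q) (hT : StoredCore s.mem T) (hnd : (elems T).Nodup) (hlt : q < T.numNodes)
    (k : ∀ s' t' b (x : Fin n) l r path, (∀ i, (i < 6 ∨ 6 < i) → (i < 22 ∨ 28 < i) → s'.reg i = s.reg i) →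
      s'.mem = s.mem → T = plug (.node (b, x) l r) path → s'.reg 22 = (x : ℕ) →
      (inorder (unfold false T))[q]? = some x → t' ≤ t + 50 * path.length + 52 → Q s' t') :
    Wp w (fstLayout n) findCmd s t Q := by
  simp only [findCmd, mov, BinOp.eval, ↓wp_seq, ↓wp_bin, he.r4, he.r5, Function.update_apply,
    Nat.reduceEqDiff, if_false, Nat.sub_zero, OfNat.ofNat_ne_zero, OfNat.zero_ne_ofNat]
  refine wp_findLoop (T := T) (q := q) (rev := false) ⟨?_, ?_, ?_, ?_, ?_, hT, hnd⟩ hlt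
    fun s1 t1 b x l r path q1 m1 h1 h2 h3 h4 => k s1 t1 b x l r path ?_ m1 h1 h2 h3 (by omega)
  · exact he.congr fun i hi => by
      simp [Function.update_apply, show i ≠ 24 by omega, show i ≠ 27 by omega]
  · simp [Function.update_apply, hroot]
  · simp [Function.update_apply, hq]
  · simp [Function.update_apply]
  · simp [Function.update_apply]
  · intro i h1 h2
    rw [q1 i h1 h2]
    simp [Function.update_apply, show i ≠ 24 by omega, show i ≠ 27 by omega]
end

/-! ### The potential of splay trees -/

section
variable {α : Type}

/-- The potential of Sleator and Tarjan: the sum of the binary logarithms of the sizes of all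
subtrees. -/
noncomputable def pot : BinaryTree α → ℝ
  | .nil => 0
  | .node x l r => pot l + pot r + Real.logb 2 (BinaryTree.node x l r).numNodes

theorem logb_nat_mono {a b : ℕ} (ha : 1 ≤ a) (h : a ≤ b) :
    Real.logb 2 a ≤ Real.logb 2 b :=
  Real.logb_le_logb_of_le (by norm_num) (by exact_mod_cast ha) (by exact_mod_cast h)

theorem logb_nat_nonneg (a : ℕ) : 0 ≤ Real.logb 2 a := by
  rcases Nat.eq_zero_or_pos a with rfl | h
  · simp
  · exact Real.logb_nonneg (by norm_num) (by exact_mod_cast h)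

theorem pot_nonneg (T : BinaryTree α) : 0 ≤ pot T := by
  induction T with
  | nil => exact le_rfl
  | node x l r hl hr =>
    have := logb_nat_nonneg (BinaryTree.node x l r).numNodes
    rw [pot]; linarith

/-- Concavity of the logarithm, in the form in which it pays for a double rotation. -/
theorem logb_add_logb_le {a b c : ℕ} (ha : 1 ≤ a) (hb : 1 ≤ b) (h : a + b ≤ c) :
    Real.logb 2 a + Real.logb 2 b + 2 ≤ 2 * Real.logb 2 c := by
  have ha' : (0 : ℝ) < a := by exact_mod_cast ha
  have hb' : (0 : ℝ) < b := by exact_mod_cast hb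
  have h' : (a : ℝ) + b ≤ c := by exact_mod_cast h
  have h4 : Real.logb 2 4 = 2 := by
    rw [show (4 : ℝ) = 2 ^ (2 : ℕ) by norm_num, Real.logb_pow]; simp
  have h1 : Real.logb 2 (a * b * 4) ≤ Real.logb 2 ((c : ℝ) ^ 2) :=
    Real.logb_le_logb_of_le (by norm_num) (by positivity) (by nlinarith [sq_nonneg ((a : ℝ) - b)])
  rw [Real.logb_mul (by positivity) (by norm_num), Real.logb_mul ha'.ne' hb'.ne', h4,
    Real.logb_pow] at h1
  exact_mod_cast h1

theorem numNodes_plugFrames {path : List (Frame α)} : ∀ {T T' : BinaryTree α},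
    T.numNodes = T'.numNodes → (plugFrames T path).numNodes = (plugFrames T' path).numNodes := by
  induction path with
  | nil => intro T T' h; exact h
  | cons f path ih =>
    intro T T' h
    rcases f with ⟨p, t⟩ | ⟨p, t⟩ <;> exact ih (by simp [h])

theorem pot_plugFrames {path : List (Frame α)} : ∀ {T T' : BinaryTree α},
    T.numNodes = T'.numNodes →
      pot (plugFrames T path) - pot T = pot (plugFrames T' path) - pot T' := by
  induction path with
  | nil => intro T T' _; simp [plugFrames]
  | cons f path ih =>
    intro T T' h
    rcases f with ⟨p, t⟩ | ⟨p, t⟩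
    · have := ih (T := .node p T t) (T' := .node p T' t) (by simp [h])
      simp only [pot, plugFrames, BinaryTree.numNodes, h] at this ⊢
      linarith
    · have := ih (T := .node p t T) (T' := .node p t T') (by simp [h])
      simp only [pot, plugFrames, BinaryTree.numNodes, h] at this ⊢
      linarith

/-- The access lemma: the rotations are paid by the potential, up to `3 log₂ (size) + 1`. -/
theorem pot_splayUp (x : α) : ∀ (l r : BinaryTree α) (path : List (Frame α)),
    pot (splayUp x l r path) + path.length ≤ pot (plugFrames (.node x l r) path) +
      3 * (Real.logb 2 (plugFrames (.node x l r) path).numNodes -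
        Real.logb 2 (BinaryTree.node x l r).numNodes) + 1
  | l, r, [] => by simp [splayUp, plugFrames]
  | l, r, [.inLeft p c] => by
    have h1 := logb_nat_mono (a := r.numNodes + c.numNodes + 1)
      (b := l.numNodes + r.numNodes + 1 + c.numNodes + 1) (by omega) (by omega)
    have h2 := logb_nat_mono (a := l.numNodes + r.numNodes + 1)
      (b := l.numNodes + r.numNodes + 1 + c.numNodes + 1) (by omega) (by omega)
    have e : l.numNodes + (r.numNodes + c.numNodes + 1) + 1 =
      l.numNodes + r.numNodes + 1 + c.numNodes + 1 := by omega
    simp only [splayUp, plugFrames, pot, BinaryTree.numNodes, List.length_singleton, e, Nat.cast_one]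
    linarith
  | l, r, [.inRight p c] => by
    have h1 := logb_nat_mono (a := c.numNodes + l.numNodes + 1)
      (b := c.numNodes + (l.numNodes + r.numNodes + 1) + 1) (by omega) (by omega)
    have h2 := logb_nat_mono (a := l.numNodes + r.numNodes + 1)
      (b := c.numNodes + (l.numNodes + r.numNodes + 1) + 1) (by omega) (by omega)
    have e : c.numNodes + l.numNodes + 1 + r.numNodes + 1 =
      c.numNodes + (l.numNodes + r.numNodes + 1) + 1 := by omega
    simp only [splayUp, plugFrames, pot, BinaryTree.numNodes, List.length_singleton, e, Nat.cast_one]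
    linarith
  | l, r, .inLeft p c :: .inLeft g d :: path => by
    have ih := pot_splayUp x l (.node p r (.node g c d)) path
    have hs : (BinaryTree.node x l (.node p r (.node g c d))).numNodes =
        (BinaryTree.node g (.node p (.node x l r) c) d).numNodes := by simp; omega
    have hp := pot_plugFrames (path := path) hs
    rw [numNodes_plugFrames (path := path) hs] at ih
    have h1 := logb_nat_mono (a := r.numNodes + (c.numNodes + d.numNodes + 1) + 1)
      (b := l.numNodes + r.numNodes + 1 + c.numNodes + 1 + d.numNodes + 1) (by omega) (by omega)
    have h2 := logb_nat_mono (a := l.numNodes + r.numNodes + 1)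
      (b := l.numNodes + r.numNodes + 1 + c.numNodes + 1) (by omega) (by omega)
    have h3 := logb_add_logb_le (a := l.numNodes + r.numNodes + 1)
      (b := c.numNodes + d.numNodes + 1)
      (c := l.numNodes + r.numNodes + 1 + c.numNodes + 1 + d.numNodes + 1)
      (by omega) (by omega) (by omega)
    simp only [BinaryTree.numNodes] at hs
    simp only [splayUp, plugFrames, pot, BinaryTree.numNodes, List.length_cons, Nat.cast_add,
      Nat.cast_one, hs] at ih hp h1 h2 h3 ⊢
    linarith
  | l, r, .inRight p c :: .inRight g d :: path => by
    have ih := pot_splayUp x (.node p (.node g d c) l) r path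
    have hs : (BinaryTree.node x (.node p (.node g d c) l) r).numNodes =
        (BinaryTree.node g d (.node p c (.node x l r))).numNodes := by simp; omega
    have hp := pot_plugFrames (path := path) hs
    rw [numNodes_plugFrames (path := path) hs] at ih
    have h1 := logb_nat_mono (a := d.numNodes + c.numNodes + 1 + l.numNodes + 1)
      (b := d.numNodes + (c.numNodes + (l.numNodes + r.numNodes + 1) + 1) + 1)
      (by omega) (by omega)
    have h2 := logb_nat_mono (a := l.numNodes + r.numNodes + 1)
      (b := c.numNodes + (l.numNodes + r.numNodes + 1) + 1) (by omega) (by omega)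
    have h3 := logb_add_logb_le (a := l.numNodes + r.numNodes + 1)
      (b := d.numNodes + c.numNodes + 1)
      (c := d.numNodes + (c.numNodes + (l.numNodes + r.numNodes + 1) + 1) + 1)
      (by omega) (by omega) (by omega)
    simp only [BinaryTree.numNodes] at hs
    simp only [splayUp, plugFrames, pot, BinaryTree.numNodes, List.length_cons, Nat.cast_add,
      Nat.cast_one, hs] at ih hp h1 h2 h3 ⊢
    linarith
  | l, r, .inRight p c :: .inLeft g d :: path => by
    have ih := pot_splayUp x (.node p c l) (.node g r d) path
    have hs : (BinaryTree.node x (.node p c l) (.node g r d)).numNodes =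
        (BinaryTree.node g (.node p c (.node x l r)) d).numNodes := by simp; omega
    have hp := pot_plugFrames (path := path) hs
    rw [numNodes_plugFrames (path := path) hs] at ih
    have h1 := logb_nat_mono (a := l.numNodes + r.numNodes + 1)
      (b := c.numNodes + (l.numNodes + r.numNodes + 1) + 1 + d.numNodes + 1)
      (by omega) (by omega)
    have h2 := logb_nat_mono (a := l.numNodes + r.numNodes + 1)
      (b := c.numNodes + (l.numNodes + r.numNodes + 1) + 1) (by omega) (by omega)
    have h3 := logb_add_logb_le (a := c.numNodes + l.numNodes + 1)
      (b := r.numNodes + d.numNodes + 1)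
      (c := c.numNodes + (l.numNodes + r.numNodes + 1) + 1 + d.numNodes + 1)
      (by omega) (by omega) (by omega)
    simp only [BinaryTree.numNodes] at hs
    simp only [splayUp, plugFrames, pot, BinaryTree.numNodes, List.length_cons, Nat.cast_add,
      Nat.cast_one, hs] at ih hp h1 h2 h3 ⊢
    linarith
  | l, r, .inLeft p c :: .inRight g d :: path => by
    have ih := pot_splayUp x (.node g d l) (.node p r c) path
    have hs : (BinaryTree.node x (.node g d l) (.node p r c)).numNodes =
        (BinaryTree.node g d (.node p (.node x l r) c)).numNodes := by simp; omega
    have hp := pot_plugFrames (path := path) hs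
    rw [numNodes_plugFrames (path := path) hs] at ih
    have h1 := logb_nat_mono (a := l.numNodes + r.numNodes + 1)
      (b := d.numNodes + (l.numNodes + r.numNodes + 1 + c.numNodes + 1) + 1)
      (by omega) (by omega)
    have h2 := logb_nat_mono (a := l.numNodes + r.numNodes + 1)
      (b := l.numNodes + r.numNodes + 1 + c.numNodes + 1) (by omega) (by omega)
    have h3 := logb_add_logb_le (a := d.numNodes + l.numNodes + 1)
      (b := r.numNodes + c.numNodes + 1)
      (c := d.numNodes + (l.numNodes + r.numNodes + 1 + c.numNodes + 1) + 1)
      (by omega) (by omega) (by omega)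
    simp only [BinaryTree.numNodes] at hs
    simp only [splayUp, plugFrames, pot, BinaryTree.numNodes, List.length_cons, Nat.cast_add,
      Nat.cast_one, hs] at ih hp h1 h2 h3 ⊢
    linarith

theorem length_inorder (T : BinaryTree α) : (inorder T).length = T.numNodes := by
  induction T with
  | nil => rfl
  | node x l r hl hr => simp [inorder, hl, hr]; omega

theorem inorder_mirror (T : BinaryTree α) : inorder (mirror T) = (inorder T).reverse := by
  induction T with
  | nil => rfl
  | node x l r hl hr => simp [mirror, inorder, hl, hr]

theorem mirror_mirror (T : BinaryTree α) : mirror (mirror T) = T := by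
  induction T with
  | nil => rfl
  | node x l r hl hr => simp [mirror, hl, hr]

theorem numNodes_mirror (T : BinaryTree α) : (mirror T).numNodes = T.numNodes := by
  rw [← length_inorder, inorder_mirror, List.length_reverse, length_inorder]

theorem pot_mirror (T : BinaryTree α) : pot (mirror T) = pot T := by
  induction T with
  | nil => rfl
  | node x l r hl hr =>
    simp only [mirror, pot, hl, hr, BinaryTree.numNodes, numNodes_mirror,
      Nat.add_comm r.numNodes l.numNodes]
    ring

theorem inorder_splayUp (x : α) : ∀ (l r : BinaryTree α) (path : List (Frame α)),
    inorder (splayUp x l r path) = inorder (plugFrames (.node x l r) path)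
  | l, r, [] => rfl
  | l, r, [.inLeft p c] => by simp [splayUp, plugFrames, inorder]
  | l, r, [.inRight p c] => by simp [splayUp, plugFrames, inorder]
  | l, r, .inLeft p c :: .inLeft g d :: path => by
    rw [splayUp, inorder_splayUp]
    obtain ⟨a, b, h⟩ := inorder_plugFrames path
    simp [plugFrames, h, inorder]
  | l, r, .inRight p c :: .inRight g d :: path => by
    rw [splayUp, inorder_splayUp]
    obtain ⟨a, b, h⟩ := inorder_plugFrames path
    simp [plugFrames, h, inorder]
  | l, r, .inRight p c :: .inLeft g d :: path => by
    rw [splayUp, inorder_splayUp]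
    obtain ⟨a, b, h⟩ := inorder_plugFrames path
    simp [plugFrames, h, inorder]
  | l, r, .inLeft p c :: .inRight g d :: path => by
    rw [splayUp, inorder_splayUp]
    obtain ⟨a, b, h⟩ := inorder_plugFrames path
    simp [plugFrames, h, inorder]

end

/-! ### Trees in the memory -/

section
variable {n w : ℕ} {s : State} {t : ℕ} {Q : State → ℕ → Prop}

/-- The memory holds the tree `T`, up to lazy reversals. -/
def Rep (A : Memory) (T : BinaryTree (Fin n)) : Prop :=
  ∃ S : SignedTree n, unfold false S = T ∧ Stored A n 0 S

/-- The memory holds the tree `T`, except perhaps for the link and the side of its root. -/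
def RepCore (A : Memory) (T : BinaryTree (Fin n)) : Prop :=
  ∃ S : SignedTree n, unfold false S = T ∧ StoredCore A S

/-- The root of a tree, NIL if it is empty. -/
def rootVal : BinaryTree (Fin n) → ℕ
  | .nil => n
  | .node x _ _ => x

@[simp] theorem rootVal_nil : rootVal (.nil : BinaryTree (Fin n)) = n := rfl
@[simp] theorem rootVal_node (x : Fin n) (l r : BinaryTree (Fin n)) :
    rootVal (.node x l r) = x := rfl

theorem rootVal_unfold (rev : Bool) (S : SignedTree n) :
    rootVal (unfold rev S) = rootOr n S := by
  rcases S with _ | ⟨⟨b, x⟩, l, r⟩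
  · rfl
  · rw [unfold]; split_ifs <;> rfl

theorem unfold_not (S : SignedTree n) : ∀ rev : Bool, unfold (!rev) S = mirror (unfold rev S) := by
  induction S with
  | nil => intro rev; rfl
  | node v l r hl hr =>
    obtain ⟨b, x⟩ := v
    intro rev
    have hl' := hl true
    have hr' := hr true
    simp only [Bool.not_true] at hl' hr'
    cases rev <;> cases b <;> simp [unfold, mirror, hl', hr', mirror_mirror]

theorem Rep.core {A : Memory} {T : BinaryTree (Fin n)} (h : Rep A T) : RepCore A T := by
  obtain ⟨S, hS, h⟩ := h
  exact ⟨S, hS, h.core⟩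

theorem rep_nil (A : Memory) : Rep A (.nil : BinaryTree (Fin n)) := ⟨.nil, rfl, trivial⟩

theorem RepCore.agree {A A' : Memory} {T : BinaryTree (Fin n)} {S : List (Fin n)}
    (h : RepCore A T) (hA : Agree S A A') (hd : List.Disjoint (inorder T) S) : RepCore A' T := by
  obtain ⟨U, rfl, h⟩ := h
  refine ⟨U, rfl, h.agree hA fun a ha => hd ((perm_inorder_unfold _ _).mem_iff.2 ha)⟩

theorem Rep.agree {A A' : Memory} {T : BinaryTree (Fin n)} {S : List (Fin n)}
    (h : Rep A T) (hA : Agree S A A') (hd : List.Disjoint (inorder T) S) : Rep A' T := by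
  obtain ⟨U, rfl, h⟩ := h
  refine ⟨U, rfl, h.agree hA fun a ha => hd ((perm_inorder_unfold _ _).mem_iff.2 ha)⟩

theorem numNodes_unfold (rev : Bool) (S : SignedTree n) :
    (unfold rev S).numNodes = S.numNodes := by
  rw [← length_inorder, length_inorder_unfold]

theorem RepCore.size {A : Memory} {T : BinaryTree (Fin n)} (h : RepCore A T) (hT : T ≠ .nil) :
    A 2 (rootVal T) = T.numNodes := by
  obtain ⟨S, rfl, h⟩ := h
  rw [rootVal_unfold, numNodes_unfold]
  refine h.size rfl ?_
  rcases S with _ | ⟨⟨b, x⟩, l, r⟩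
  · exact absurd rfl hT
  · exact x.isLt

theorem Rep.link {A : Memory} {x : Fin n} {l r : BinaryTree (Fin n)}
    (h : Rep A (.node x l r)) : A 1 x = n := by
  obtain ⟨S, hS, h⟩ := h
  rw [← rootVal_node x l r, ← hS, rootVal_unfold]
  rcases S with _ | ⟨⟨b, y⟩, l, r⟩
  · simp [unfold] at hS
  · exact h.2.1

theorem Stored.link_lt {A : Memory} {T : SignedTree n} : ∀ {link side : ℕ}, Stored A link side T →
    link < n → ∀ x ∈ elems T, A 1 x < n := by
  induction T with
  | nil => intro _ _ _ _ x hx; simp at hx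
  | node v l r hl hr =>
    obtain ⟨b, y⟩ := v
    intro link side h hlt x hx
    simp only [elems_node, List.mem_cons, List.mem_append] at hx
    rcases hx with rfl | hx | hx
    · rw [h.2.1]; exact hlt
    · refine hl h.2.2.2.2.2.1 ?_ x hx
      rcases r with _ | ⟨⟨_, z⟩, _, _⟩
      · exact y.isLt
      · exact z.isLt
    · exact hr h.2.2.2.2.2.2 y.isLt x hx

theorem RepCore.link_lt {A : Memory} {x : Fin n} {T : BinaryTree (Fin n)} (h : RepCore A T)
    (hx : x ∈ inorder T) (hne : (x : ℕ) ≠ rootVal T) : A 1 x < n := by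
  obtain ⟨S, rfl, h⟩ := h
  rw [(perm_inorder_unfold _ _).mem_iff] at hx
  rw [rootVal_unfold] at hne
  rcases S with _ | ⟨⟨b, y⟩, l, r⟩
  · simp at hx
  · simp only [elems_node, List.mem_cons, List.mem_append] at hx
    simp only [rootOr_node, ne_eq, Fin.val_inj] at hne
    obtain ⟨-, -, -, h4, h5⟩ := h
    rcases hx with hx | hx | hx
    · exact absurd hx hne
    · refine h4.link_lt ?_ x hx
      rcases r with _ | ⟨⟨_, z⟩, _, _⟩
      · exact y.isLt
      · exact z.isLt
    · exact h5.link_lt y.isLt x hx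

theorem nodup_elems {S : SignedTree n} {rev : Bool} (h : (inorder (unfold rev S)).Nodup) :
    (elems S).Nodup := (perm_inorder_unfold rev S).nodup_iff.1 h

theorem Agree.of_elems {S : SignedTree n} {rev : Bool} {A A' : Memory} (h : Agree (elems S) A A') :
    Agree (inorder (unfold rev S)) A A' :=
  h.mono fun _ ha => (perm_inorder_unfold rev S).mem_iff.2 ha

theorem wp_mirror {v : ℕ} {T : BinaryTree (Fin n)} (he : Env n s) (hv : v ≠ 6)
    (hr : s.reg v = rootVal T) (hT : RepCore s.mem T) (hnd : (inorder T).Nodup)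
    (k : ∀ s' t', (∀ r, r ≠ 6 → s'.reg r = s.reg r) → RepCore s'.mem (mirror T) →
      Agree (inorder T) s.mem s'.mem → t' ≤ t + 4 → Q s' t') :
    Wp w (fstLayout n) (negateCmd v) s t Q := by
  obtain ⟨S, rfl, h⟩ := hT
  rw [rootVal_unfold] at hr
  exact wp_negate he hv hr h (nodup_elems hnd) fun s' t' q c a ht => k s' t' q
    ⟨_, by rw [unfold_negate, unfold_not], c⟩ a.of_elems ht

theorem wp_root {v : ℕ} {T : BinaryTree (Fin n)} (he : Env n s)
    (hr : s.reg v = rootVal T) (hT : RepCore s.mem T) (hnd : (inorder T).Nodup)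
    (k : ∀ s' t', s'.reg = s.reg → Rep s'.mem T →
      Agree (inorder T) s.mem s'.mem → t' ≤ t + 3 → Q s' t') :
    Wp w (fstLayout n) (detachCmd v) s t Q := by
  obtain ⟨S, rfl, h⟩ := hT
  rw [rootVal_unfold] at hr
  exact wp_detach he hr h (nodup_elems hnd) fun s' t' q c a ht => k s' t' q
    ⟨_, rfl, c⟩ a.of_elems ht

/-- Build a tree from its root and the subtrees. -/
def nodeCmd (v a b : ℕ) : Cmd := .seq (assembleCmd v a b) (detachCmd v)

theorem wp_node {v a b : ℕ} {x : Fin n} {l r : BinaryTree (Fin n)} (he : Env n s) (hw : n < 2 ^ w)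
    (v6 : v ≠ 6) (v7 : v ≠ 7) (a6 : a ≠ 6) (a7 : a ≠ 7) (b6 : b ≠ 6) (b7 : b ≠ 7)
    (hv' : s.reg v = x) (ha' : s.reg a = rootVal l) (hb' : s.reg b = rootVal r)
    (hl : RepCore s.mem l) (hr : RepCore s.mem r) (hnd : (inorder (.node x l r)).Nodup)
    (k : ∀ s' t', (∀ r, r ≠ 6 → r ≠ 7 → s'.reg r = s.reg r) → Rep s'.mem (.node x l r) →
      Agree (inorder (.node x l r)) s.mem s'.mem → t' ≤ t + 18 → Q s' t') :
    Wp w (fstLayout n) (nodeCmd v a b) s t Q := by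
  obtain ⟨L, rfl, hl⟩ := hl
  obtain ⟨R, rfl, hr⟩ := hr
  rw [rootVal_unfold] at ha' hb'
  have hu : unfold false (.node (false, x) L R) = .node x (unfold false L) (unfold false R) := by
    simp [unfold]
  have hnd' : (elems (.node (false, x) L R)).Nodup := nodup_elems (rev := false) (by rwa [hu])
  rw [nodeCmd, wp_seq]
  refine wp_assemble he hw v6 v7 a6 a7 b6 b7 hv' ha' hb' hl hr hnd' fun s1 t1 q1 c1 a1 ht1 => ?_
  refine wp_root (he.congr fun i hi => q1 i (by omega) (by omega)) (by rw [q1 v v6 v7, hv']; rfl)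
    ⟨_, hu, c1⟩ hnd fun s2 t2 q2 c2 a2 ht2 => ?_
  rw [← elems_node false] at a1
  have a1' := a1.of_elems (rev := false)
  rw [hu] at a1'
  exact k _ _ (fun r h1 h2 => by rw [q2, q1 r h1 h2]) c2
    (a1'.trans a2 (List.Subset.refl _) (List.Subset.refl _)) (by omega)

/-- The depth of a node. -/
def depth {α : Type} [DecidableEq α] (x : α) (T : BinaryTree α) : ℕ :=
  match locate x T [] with
  | some (_, _, path) => path.length
  | none => 0

theorem exists_plug {x : Fin n} {S : SignedTree n} (hx : x ∈ elems S) :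
    ∃ b l r path, S = plug (.node (b, x) l r) path := by
  induction S with
  | nil => simp at hx
  | node v l r hl hr =>
    obtain ⟨b, y⟩ := v
    simp only [elems_node, List.mem_cons, List.mem_append] at hx
    rcases hx with rfl | hx | hx
    · exact ⟨b, l, r, [], rfl⟩
    · obtain ⟨b', l', r', path, rfl⟩ := hl hx
      exact ⟨b', l', r', path ++ [⟨false, b, y, r⟩], by rw [plug_append]; rfl⟩
    · obtain ⟨b', l', r', path, rfl⟩ := hr hx
      exact ⟨b', l', r', path ++ [⟨true, b, y, l⟩], by rw [plug_append]; rfl⟩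

theorem exists_plugFrames {α : Type} {x : α} {T : BinaryTree α} (hx : x ∈ inorder T) :
    ∃ l r path, T = plugFrames (.node x l r) path := by
  have key : ∀ (T : BinaryTree α) (path : List (Frame α)), x ∈ inorder T →
      ∃ l r path', plugFrames T path = plugFrames (.node x l r) path' := by
    intro T
    induction T with
    | nil => intro _ h; simp [inorder] at h
    | node y l r hl hr =>
      intro path h
      simp only [inorder, List.mem_append, List.mem_cons] at h
      rcases h with h | rfl | h
      · exact hl (.inLeft y r :: path) h
      · exact ⟨l, r, path, rfl⟩
      · exact hr (.inRight y l :: path) h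
  exact key T [] hx

theorem depth_plugFrames {α : Type} [DecidableEq α] {x : α} {l r : BinaryTree α}
    {path : List (Frame α)} (hnd : (inorder (plugFrames (.node x l r) path)).Nodup) :
    depth x (plugFrames (.node x l r) path) = path.length := by
  have : locate x (plugFrames (.node x l r) path) [] = some (l, r, path) :=
    locate_plugFrames hnd (by simp [inorder]) (by simp [locate])
  rw [depth, this]

theorem length_unfoldPath (path : List (SignedFrame n)) :
    (unfoldPath path).length = path.length := by
  induction path with
  | nil => rfl
  | cons f path ih => simp [unfoldPath, ih]

theorem depth_plug {b : Bool} {x : Fin n} {l r : SignedTree n} {path : List (SignedFrame n)}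
    (hnd : (elems (plug (.node (b, x) l r) path)).Nodup) :
    depth x (unfold false (plug (.node (b, x) l r) path)) = path.length := by
  have h := (perm_inorder_unfold false _).nodup_iff.2 hnd
  rw [unfold_plug] at h ⊢
  rw [unfold] at h ⊢
  split_ifs at h ⊢ <;> rw [depth_plugFrames h, length_unfoldPath]

theorem inorder_splay {α : Type} [DecidableEq α] {x : α} {T : BinaryTree α}
    (hnd : (inorder T).Nodup) : inorder (splay x T) = inorder T := by
  by_cases hx : x ∈ inorder T
  · obtain ⟨l, r, path, rfl⟩ := exists_plugFrames hx
    rw [splay_plugFrames hnd, inorder_splayUp]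
  · rw [splay, locate_eq_none hx]

/-- The logarithmic cost of an operation. -/
noncomputable def cost (n : ℕ) : ℝ := 1 + Real.logb 2 n

theorem one_le_cost (n : ℕ) : 1 ≤ cost n := by
  have := logb_nat_nonneg n
  rw [cost]; linarith

theorem logb_size_le {T : BinaryTree (Fin n)} (h : (inorder T).Nodup) :
    Real.logb 2 T.numNodes ≤ cost n - 1 := by
  have h1 := h.length_le_card
  rw [length_inorder, Fintype.card_fin] at h1
  rw [cost]
  rcases Nat.eq_zero_or_pos T.numNodes with h0 | h0
  · rw [h0]
    have := logb_nat_nonneg n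
    simpa using this
  · have := logb_nat_mono h0 h1
    linarith

theorem pot_splay {x : Fin n} {T : BinaryTree (Fin n)} (hnd : (inorder T).Nodup)
    (hx : x ∈ inorder T) : pot (splay x T) + depth x T ≤ pot T + 3 * cost n := by
  have hs := logb_size_le hnd
  obtain ⟨l, r, path, rfl⟩ := exists_plugFrames hx
  rw [splay_plugFrames hnd, depth_plugFrames hnd]
  have := pot_splayUp x l r path
  have := logb_nat_nonneg (BinaryTree.node x l r).numNodes
  linarith

theorem wp_pieces (hw : n < 2 ^ w) {x : Fin n} {T : BinaryTree (Fin n)} (he : Env n s)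
    (hx : s.reg 10 = x) (hT : Rep s.mem T) (hnd : (inorder T).Nodup) (hxT : x ∈ inorder T)
    (k : ∀ s' t' l r, (∀ i, i < 6 ∨ 21 < i → s'.reg i = s.reg i) → s'.reg 10 = (x : ℕ) →
      s'.reg 11 = rootVal l → s'.reg 12 = rootVal r → RepCore s'.mem l → RepCore s'.mem r →
      splay x T = .node x l r → Agree (inorder T) s.mem s'.mem →
      t' ≤ t + 101 * depth x T + 40 → Q s' t') :
    Wp w (fstLayout n) splayCmd s t Q := by
  obtain ⟨S, rfl, h⟩ := hT
  obtain ⟨b, L, R, path, rfl⟩ := exists_plug ((perm_inorder_unfold _ _).mem_iff.1 hxT)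
  have hnd' := nodup_elems hnd
  rw [depth_plug hnd'] at k
  exact wp_splay hw he hx h hnd' fun s' t' l' r' q a e c ht => k s' t' _ _ q a.hx
    (by rw [rootVal_unfold]; exact a.hl) (by rw [rootVal_unfold]; exact a.hr) ⟨_, rfl, a.cl⟩
    ⟨_, rfl, a.cr⟩ e c.of_elems ht

theorem wp_rank {T : BinaryTree (Fin n)} {q : ℕ} (he : Env n s) (hroot : s.reg 22 = rootVal T)
    (hq : s.reg 23 = q) (hT : RepCore s.mem T) (hnd : (inorder T).Nodup)
    (hlt : q < (inorder T).length)
    (k : ∀ s' t', (∀ i, (i < 6 ∨ 6 < i) → (i < 22 ∨ 28 < i) → s'.reg i = s.reg i) →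
      s'.mem = s.mem → s'.reg 22 = ((inorder T)[q] : ℕ) → t' ≤ t + 50 * depth (inorder T)[q] T + 52 →
      Q s' t') :
    Wp w (fstLayout n) findCmd s t Q := by
  obtain ⟨S, rfl, h⟩ := hT
  rw [rootVal_unfold] at hroot
  refine wp_find he hroot hq h (nodup_elems hnd) (by rwa [length_inorder_unfold] at hlt)
    fun s' t' b x l r path h1 h2 h3 h4 h5 h6 => ?_
  have hx : (inorder (unfold false S))[q] = x := by
    rw [List.getElem?_eq_getElem hlt] at h5
    exact Option.some_injective _ h5
  refine k s' t' h1 h2 (by rw [hx, h4]) ?_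
  rw [hx]
  have hnd' := nodup_elems hnd
  subst h3
  rw [depth_plug hnd']
  exact h6
end

/-! ### Primitive changes of a forest -/

section
variable {n : ℕ}

/-- The trees of the forest `F` are those in the list `Ts`, which may also contain empty trees. -/
structure Part (F : Forest n) (Ts : List (BinaryTree (Fin n))) : Prop where
  nodup : (Ts.flatMap inorder).Nodup
  mem : ∀ x, x ∈ Ts.flatMap inorder
  eq : ∀ T ∈ Ts, ∀ x ∈ inorder T, F x = T

/-- At most `k` primitive changes turn a forest with the trees `Ts` into one with the
trees `Ts'`. -/
def Reach (k : ℕ) (Ts Ts' : List (BinaryTree (Fin n))) : Prop :=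
  ∀ F, Part F Ts → ∃ F' k', k' ≤ k ∧ Moves k' F F' ∧ Part F' Ts'

theorem Moves.trans {j k : ℕ} {F G H : Forest n} (h : Moves j F G) (h' : Moves k G H) :
    Moves (j + k) F H := by
  induction h' with
  | zero => exact h
  | succ _ hm ih => exact .succ (ih h) hm

theorem Reach.trans {j k : ℕ} {Ts₁ Ts₂ Ts₃ : List (BinaryTree (Fin n))} (h : Reach j Ts₁ Ts₂)
    (h' : Reach k Ts₂ Ts₃) : Reach (j + k) Ts₁ Ts₃ := by
  intro F hF
  obtain ⟨G, a, ha, hm, hG⟩ := h F hF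
  obtain ⟨H, b, hb, hm', hH⟩ := h' G hG
  exact ⟨H, a + b, by omega, hm.trans hm', hH⟩

theorem Reach.mono {j k : ℕ} {Ts Ts' : List (BinaryTree (Fin n))} (h : Reach j Ts Ts')
    (hjk : j ≤ k) : Reach k Ts Ts' := by
  intro F hF
  obtain ⟨G, a, ha, hm, hG⟩ := h F hF
  exact ⟨G, a, ha.trans hjk, hm, hG⟩

theorem Part.perm {F : Forest n} {Ts Ts' : List (BinaryTree (Fin n))} (hF : Part F Ts)
    (h : Ts.Perm Ts') : Part F Ts' where
  nodup := (h.flatMap_right inorder).nodup_iff.1 hF.nodup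
  mem x := (h.flatMap_right inorder).mem_iff.1 (hF.mem x)
  eq T hT := hF.eq T (h.mem_iff.2 hT)

theorem reach_perm {Ts Ts' : List (BinaryTree (Fin n))} (h : Ts.Perm Ts') : Reach 0 Ts Ts' :=
  fun F hF => ⟨F, 0, le_rfl, .zero F, hF.perm h⟩

theorem Part.disjoint {F : Forest n} {T U : BinaryTree (Fin n)} {Ts : List (BinaryTree (Fin n))}
    (hF : Part F (T :: Ts)) (hU : U ∈ Ts) {x : Fin n} (hT : x ∈ inorder T) (hx : x ∈ inorder U) :
    False := by
  have h := hF.nodup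
  rw [List.flatMap_cons, List.nodup_append] at h
  exact h.2.2 x hT x (List.mem_flatMap.2 ⟨U, hU, hx⟩) rfl

theorem Part.set_tree {F : Forest n} {T T' : BinaryTree (Fin n)} {Ts : List (BinaryTree (Fin n))}
    (hF : Part F (T :: Ts)) (hp : (inorder T).Perm (inorder T')) :
    Part (F.set T') (T' :: Ts) := by
  have hp' : ((T :: Ts).flatMap inorder).Perm ((T' :: Ts).flatMap inorder) := by
    simpa only [List.flatMap_cons] using hp.append_right _
  refine ⟨hp'.nodup_iff.1 hF.nodup, fun x => hp'.mem_iff.1 (hF.mem x), ?_⟩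
  intro U hU x hx
  rcases List.mem_cons.1 hU with rfl | hU
  · rw [Forest.set, if_pos hx]
  · rw [Forest.set, if_neg fun h => hF.disjoint hU (hp.mem_iff.2 h) hx]
    exact hF.eq U (List.mem_cons_of_mem _ hU) x hx

theorem Part.nodup_head {F : Forest n} {T : BinaryTree (Fin n)} {Ts : List (BinaryTree (Fin n))}
    (hF : Part F (T :: Ts)) : (inorder T).Nodup := by
  have h := hF.nodup
  rw [List.flatMap_cons, List.nodup_append] at h
  exact h.1

theorem reach_splay {T : BinaryTree (Fin n)} {Ts : List (BinaryTree (Fin n))} {x : Fin n}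
    (hx : x ∈ inorder T) : Reach 1 (T :: Ts) (splay x T :: Ts) := by
  intro F hF
  have hm := Move.splay F x
  rw [hF.eq T (by simp) x hx] at hm
  exact ⟨_, 1, le_rfl, .succ (.zero F) hm, hF.set_tree (by rw [inorder_splay hF.nodup_head])⟩

theorem reach_mirror {T : BinaryTree (Fin n)} {Ts : List (BinaryTree (Fin n))} :
    Reach 1 (T :: Ts) (mirror T :: Ts) := by
  intro F hF
  rcases T with _ | ⟨x, l, r⟩
  · exact ⟨F, 0, by omega, .zero F, hF⟩
  · have hm := Move.flip F x
    rw [hF.eq (.node x l r) (by simp) x (by simp [inorder]), mirrorAt, if_pos rfl] at hm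
    refine ⟨_, 1, le_rfl, .succ (.zero F) hm, hF.set_tree ?_⟩
    rw [inorder_mirror]
    exact (List.reverse_perm _).symm

theorem reach_split {x : Fin n} {l r : BinaryTree (Fin n)} {Ts : List (BinaryTree (Fin n))} :
    Reach 1 (.node x l r :: Ts) (.node x l .nil :: r :: Ts) := by
  intro F hF
  have hm := Move.split F x l r (hF.eq _ (by simp) x (by simp [inorder]))
  refine ⟨_, 1, le_rfl, .succ (.zero F) hm, ?_⟩
  have hcons : (BinaryTree.node x l r :: Ts).flatMap inorder =
      (BinaryTree.node x l .nil :: r :: Ts).flatMap inorder := by simp [inorder]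
  refine ⟨hcons ▸ hF.nodup, fun y => hcons ▸ hF.mem y, ?_⟩
  have hnd := hF.nodup_head
  have hd : ∀ y ∈ inorder (BinaryTree.node x l .nil), y ∉ inorder r := by
    intro y hy hr
    simp only [inorder, List.mem_append, List.mem_singleton] at hy
    simp only [inorder, List.nodup_append, List.nodup_cons, List.mem_cons] at hnd
    rcases hy with hy | rfl
    · exact hnd.2.2 y hy y (.inr hr) rfl
    · exact hnd.2.1.1 hr
  intro U hU y hy
  simp only [List.mem_cons] at hU
  rcases hU with rfl | rfl | hU
  · rw [Forest.set, if_neg (hd y hy), Forest.set, if_pos hy]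
  · rw [Forest.set, if_pos hy]
  · have h1 : y ∉ inorder (BinaryTree.node x l r) := fun h => hF.disjoint hU h hy
    simp only [inorder, List.mem_append, List.mem_cons, not_or] at h1
    rw [Forest.set, if_neg h1.2.2, Forest.set, if_neg (by simp [inorder, h1])]
    exact hF.eq U (List.mem_cons_of_mem _ hU) y hy

theorem reach_join {x : Fin n} {l T : BinaryTree (Fin n)} {Ts : List (BinaryTree (Fin n))} :
    Reach 1 (.node x l .nil :: T :: Ts) (.node x l T :: Ts) := by
  intro F hF
  have hcons : (BinaryTree.node x l T :: Ts).flatMap inorder =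
      (BinaryTree.node x l .nil :: T :: Ts).flatMap inorder := by simp [inorder]
  rcases T with _ | ⟨y, a, b⟩
  · refine ⟨F, 0, by omega, .zero F, hcons ▸ hF.nodup, fun y => hcons ▸ hF.mem y, ?_⟩
    intro U hU
    exact hF.eq U (by simp only [List.mem_cons] at hU ⊢; tauto)
  · have hFx := hF.eq (.node x l .nil) (by simp) x (by simp [inorder])
    have hFy := hF.eq (.node y a b) (by simp) y (by simp [inorder])
    have hm := Move.join F x y l hFx (by
      rw [hFx]
      exact fun h => hF.disjoint (U := .node y a b) (by simp) h (by simp [inorder]))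
    rw [hFy] at hm
    refine ⟨_, 1, le_rfl, .succ (.zero F) hm, hcons ▸ hF.nodup, fun y => hcons ▸ hF.mem y, ?_⟩
    intro U hU z hz
    rcases List.mem_cons.1 hU with rfl | hU
    · rw [Forest.set, if_pos hz]
    · have hnd := hF.nodup
      rw [← hcons, List.flatMap_cons, List.nodup_append] at hnd
      rw [Forest.set, if_neg fun h => hnd.2.2 z h z (List.mem_flatMap.2 ⟨U, hU, hz⟩) rfl]
      exact hF.eq U (by simp [hU]) z hz

/-- Cutting the left edge of a root: the reversed tree is split at its right edge. -/
theorem reach_split_left {x : Fin n} {l r : BinaryTree (Fin n)}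
    {Ts : List (BinaryTree (Fin n))} :
    Reach 4 (.node x l r :: Ts) (.node x .nil r :: l :: Ts) := by
  have h1 : Reach 1 (.node x l r :: Ts) (.node x (mirror r) (mirror l) :: Ts) := reach_mirror
  have h2 : Reach 1 (.node x (mirror r) .nil :: mirror l :: Ts)
      (.node x .nil r :: mirror l :: Ts) := by
    have := reach_mirror (T := .node x (mirror r) .nil) (Ts := mirror l :: Ts)
    rwa [mirror, mirror_mirror] at this
  have h3 : Reach 1 (mirror l :: .node x .nil r :: Ts) (l :: .node x .nil r :: Ts) := by
    have := reach_mirror (T := mirror l) (Ts := .node x .nil r :: Ts)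
    rwa [mirror_mirror] at this
  exact (((((h1.trans reach_split).trans h2).trans (reach_perm (.swap _ _ _))).trans h3).trans
    (reach_perm (.swap _ _ _)))

end

/-! ### Concatenation and rotation -/

section
variable {n w : ℕ} {s : State} {t : ℕ} {Q : State → ℕ → Prop}

/-- The memory holds the disjoint trees `Ts`, up to lazy reversals. -/
structure Holds (A : Memory) (Ts : List (BinaryTree (Fin n))) : Prop where
  nodup : (Ts.flatMap inorder).Nodup
  rep : ∀ T ∈ Ts, Rep A T

/-- The potential of a forest. -/
noncomputable def forestPot (Ts : List (BinaryTree (Fin n))) : ℝ := (Ts.map pot).sum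

@[simp] theorem forestPot_cons (T : BinaryTree (Fin n)) (Ts : List (BinaryTree (Fin n))) :
    forestPot (T :: Ts) = pot T + forestPot Ts := by simp [forestPot]

/-- Between the times `t` and `t'`, the trees `Ts` in the memory `A` are turned into the trees `Ts'`
in the memory `A'`, by at most `k` primitive changes and in amortized time `D` times `cost n`. A unit
of potential is worth 200 steps, which is more than a search followed by a splaying takes for each
level of the tree. -/
structure Transition (k : ℕ) (D : ℝ) (A : Memory) (t : ℕ) (Ts : List (BinaryTree (Fin n)))
    (A' : Memory) (t' : ℕ) (Ts' : List (BinaryTree (Fin n))) : Prop where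
  holds : Holds A' Ts'
  reach : Reach k Ts Ts'
  counter : A' 5 0 = A 5 0
  time : t' + 200 * forestPot Ts' ≤ t + 200 * forestPot Ts + D * cost n

theorem Transition.trans {k k' : ℕ} {D D' : ℝ} {A A' A'' : Memory} {t t' t'' : ℕ}
    {Ts Ts' Ts'' : List (BinaryTree (Fin n))} (h : Transition k D A t Ts A' t' Ts')
    (h' : Transition k' D' A' t' Ts' A'' t'' Ts'') : Transition (k + k') (D + D') A t Ts A'' t'' Ts'' where
  holds := h'.holds
  reach := h.reach.trans h'.reach
  counter := h'.counter.trans h.counter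
  time := by have := h.time; have := h'.time; linarith

theorem Holds.perm {A : Memory} {Ts Ts' : List (BinaryTree (Fin n))} (h : Holds A Ts)
    (hp : Ts.Perm Ts') : Holds A Ts' :=
  ⟨(hp.flatMap_right inorder).nodup_iff.1 h.nodup, fun T hT => h.rep T (hp.mem_iff.2 hT)⟩

theorem Holds.wait {A : Memory} {Ts : List (BinaryTree (Fin n))} {t t' c : ℕ} (h : Holds A Ts)
    (ht : t' ≤ t + c) : Transition 0 c A t Ts A t' Ts where
  holds := h
  reach := reach_perm (.refl _)
  counter := rfl
  time := by
    have h1 : (t' : ℝ) ≤ t + c := by exact_mod_cast ht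
    have h2 := one_le_cost n
    have h3 : (0 : ℝ) ≤ c := Nat.cast_nonneg c
    nlinarith

theorem Transition.perm {k : ℕ} {D : ℝ} {A A' : Memory} {t t' : ℕ}
    {Ts Ts' Ts'' : List (BinaryTree (Fin n))} (h : Transition k D A t Ts A' t' Ts')
    (hp : Ts'.Perm Ts'') : Transition k D A t Ts A' t' Ts'' where
  holds := h.holds.perm hp
  reach := h.reach.trans (reach_perm hp)
  counter := h.counter
  time := by
    have := h.time
    rwa [forestPot, (hp.map pot).sum_eq] at this

theorem Transition.perm_left {k : ℕ} {D : ℝ} {A A' : Memory} {t t' : ℕ}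
    {Ts Ts' Ts'' : List (BinaryTree (Fin n))} (h : Transition k D A t Ts A' t' Ts')
    (hp : Ts''.Perm Ts) : Transition k D A t Ts'' A' t' Ts' where
  holds := h.holds
  reach := by simpa using (reach_perm hp).trans h.reach
  counter := h.counter
  time := by
    have := h.time
    rwa [forestPot, forestPot, ← (hp.map pot).sum_eq] at this

theorem Transition.mono {k k' : ℕ} {D D' : ℝ} {A A' : Memory} {t t' : ℕ}
    {Ts Ts' : List (BinaryTree (Fin n))} (h : Transition k D A t Ts A' t' Ts')
    (hk : k ≤ k') (hD : D ≤ D') : Transition k' D' A t Ts A' t' Ts' where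
  holds := h.holds
  reach := h.reach.mono hk
  counter := h.counter
  time := by
    have h1 := h.time
    have h2 := one_le_cost n
    nlinarith

theorem Holds.replace {A A' : Memory} {Old New Ts : List (BinaryTree (Fin n))}
    (h : Holds A (Old ++ Ts)) (ha : Agree (Old.flatMap inorder) A A')
    (hp : (New.flatMap inorder).Perm (Old.flatMap inorder)) (hr : ∀ U ∈ New, Rep A' U) :
    Holds A' (New ++ Ts) := by
  refine ⟨?_, fun T hT => ?_⟩
  · have := h.nodup
    rw [List.flatMap_append] at this ⊢
    exact (hp.append_right _).nodup_iff.2 this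
  · rcases List.mem_append.1 hT with hT | hT
    · exact hr T hT
    · refine (h.rep T (List.mem_append_right _ hT)).agree ha fun x hx hx' => ?_
      have := h.nodup
      rw [List.flatMap_append, List.nodup_append] at this
      exact this.2.2 x hx' x (List.mem_flatMap.2 ⟨T, hT, hx⟩) rfl

theorem Holds.nodup_head {A : Memory} {T : BinaryTree (Fin n)} {Ts : List (BinaryTree (Fin n))}
    (h : Holds A (T :: Ts)) : (inorder T).Nodup := by
  have h := h.nodup
  rw [List.flatMap_cons, List.nodup_append] at h
  exact h.1

theorem Holds.nodup_two {A : Memory} {T U : BinaryTree (Fin n)} {Ts : List (BinaryTree (Fin n))}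
    (h : Holds A (T :: U :: Ts)) : (inorder T ++ inorder U).Nodup := by
  have h := h.nodup
  rw [List.flatMap_cons, List.flatMap_cons, ← List.append_assoc, List.nodup_append] at h
  exact h.1

/-- Append the tree with root in register 31 to the nonempty tree with root in register 30: the
last node of the latter is splayed, so that it has no right child. -/
def concatCmd : Cmd :=
  .seq (mov 22 30) <| .seq (.load 23 2 22) <| .seq (.bin .sub 23 23 5) <| .seq findCmd <|
  .seq (mov 10 22) <| .seq splayCmd <| .seq (nodeCmd 10 11 31) (mov 30 10)

theorem pot_join_le {x : Fin n} {l r : BinaryTree (Fin n)}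
    (hnd : (inorder (.node x l r)).Nodup) :
    pot (.node x l r) ≤ pot l + pot r + cost n - 1 := by
  have := logb_size_le hnd
  rw [pot]; linarith

theorem pot_pieces_le (x : Fin n) (l r : BinaryTree (Fin n)) :
    pot l + pot r ≤ pot (.node x l r) := by
  have := logb_nat_nonneg (BinaryTree.node x l r).numNodes
  rw [pot]; linarith

theorem wp_concat (hw : n < 2 ^ w) {T U : BinaryTree (Fin n)} {Ts : List (BinaryTree (Fin n))}
    (he : Env n s) (h30 : s.reg 30 = rootVal T) (h31 : s.reg 31 = rootVal U) (hT : T ≠ .nil)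
    (hs : Holds s.mem (T :: U :: Ts))
    (k : ∀ s' t' T', (∀ i, i < 6 ∨ 30 < i → s'.reg i = s.reg i) → s'.reg 30 = rootVal T' →
      inorder T' = inorder T ++ inorder U →
      Transition 2 1000 s.mem t (T :: U :: Ts) s'.mem t' (T' :: Ts) → Q s' t') :
    Wp w (fstLayout n) concatCmd s t Q := by
  have hnd := hs.nodup_head
  have hnd2 := hs.nodup_two
  have hrT : Rep s.mem T := hs.rep T (by simp)
  have hrU : Rep s.mem U := hs.rep U (by simp)
  have hsize := hrT.core.size hT
  have hlen := length_inorder T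
  have hpos : 0 < T.numNodes := by
    rcases T with _ | ⟨x, l, r⟩
    · exact absurd rfl hT
    · simp
  have hlt : rootVal T < n := by
    rcases T with _ | ⟨x, l, r⟩
    · exact absurd rfl hT
    · exact x.isLt
  simp only [concatCmd, mov, ↓wp_seq, ↓wp_bin, ↓wp_load, BinOp.eval, Function.update_apply, he.r4, he.r5,
    h30, fstLayout, Nat.reduceEqDiff, if_true, if_false, Nat.sub_zero, Nat.reduceLT, hlt, true_and,
    hsize]
  refine wp_rank (T := T) (q := T.numNodes - 1) ?_ ?_ ?_ ?_ hnd (by omega)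
    fun s1 t1 q1 m1 x1 ht1 => ?_
  · exact he.congr fun i hi => by simp [Function.update_apply]; split_ifs <;> first | rfl | omega
  · simp
  · simp
  · exact hrT.core
  dsimp only at q1 m1 x1 ht1
  have hlast : (inorder T)[T.numNodes - 1]'(by omega) = (inorder T).getLast (by
      intro h; rw [h] at hlen; simp at hlen; omega) := by
    rw [List.getLast_eq_getElem]; congr 1; omega
  set x := (inorder T)[T.numNodes - 1]'(by omega) with hx
  have hxT : x ∈ inorder T := List.getElem_mem _
  have q1' : ∀ i, i < 6 ∨ 28 < i → s1.reg i = s.reg i := fun i hi => by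
    rw [q1 i (by omega) (by omega)]
    simp only [Function.update_apply]
    rw [if_neg (by omega), if_neg (by omega), if_neg (by omega)]
  have r4 : s1.reg 4 = 0 := by rw [q1' 4 (by omega), he.r4]
  simp only [↓wp_seq, ↓wp_bin, BinOp.eval, r4, Nat.sub_zero, x1]
  refine wp_pieces hw (x := x) (T := T) ?_ ?_ ?_ hnd hxT fun s2 t2 l r q2 x2 l2 r2 cl cr e2 a2 ht2 => ?_
  · refine (he.congr (s' := s1) fun i hi => q1' i (by omega)).congr fun i hi => ?_
    simp [Function.update_apply]; omega
  · simp
  · simpa only [m1] using hrT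
  dsimp only at q2 a2
  rw [m1] at a2
  have q2' : ∀ i, i < 6 ∨ 28 < i → s2.reg i = s.reg i := fun i hi => by
    rw [q2 i (by omega), Function.update_apply, if_neg (by omega), q1' i hi]
  have hin : inorder T = inorder l ++ x :: inorder r := by
    rw [← inorder_splay (x := x) hnd, e2, inorder]
  -- The last node of the traversal has no right child when it is the root.
  have hr : inorder r = [] := by
    by_contra hne
    have h1 : (inorder T).getLast (by simp [hin]) = (inorder r).getLast hne := by
      simp only [hin]
      rw [List.getLast_append_of_ne_nil _ (List.cons_ne_nil x (inorder r)), List.getLast_cons hne]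
    have h2 : x ∈ inorder r := by
      have := List.getLast_mem hne
      rw [← h1, ← hlast] at this
      exact this
    rw [hin, List.nodup_append, List.nodup_cons] at hnd
    exact hnd.2.1.1 h2
  have hr : r = .nil := by
    rcases r with _ | ⟨_, _, _⟩
    · rfl
    · simp [inorder] at hr
  subst hr
  have hin' : inorder (.node x l U) = inorder T ++ inorder U := by
    rw [hin]; simp [inorder]
  have hcU : RepCore s2.mem U := hrU.core.agree a2 fun y hy hy' => by
    rw [List.nodup_append] at hnd2; exact hnd2.2.2 y hy' y hy rfl
  refine wp_node (l := l) (r := U) (x := x) ?_ hw (by omega) (by omega) (by omega) (by omega)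
    (by omega) (by omega) x2 l2 ?_ cl hcU ?_ fun s3 t3 q3 h3 a3 ht3 => ?_
  · exact he.congr fun i hi => q2' i (by omega)
  · rw [q2' 31 (by omega), h31]
  · rwa [hin']
  have r4 : s3.reg 4 = 0 := by rw [q3 4 (by omega) (by omega), q2' 4 (by omega), he.r4]
  simp only [wp_bin, BinOp.eval, r4, Nat.sub_zero]
  refine k _ _ (.node x l U) ?_ ?_ hin' ?_
  · intro i hi
    dsimp only
    rw [Function.update_apply, if_neg (by omega), q3 i (by omega) (by omega), q2' i (by omega)]
  · dsimp only
    rw [Function.update_apply, if_pos rfl, q3 10 (by omega) (by omega), x2]; rfl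
  · have ha : Agree ([T, U].flatMap inorder) s.mem s3.mem := by
      refine a2.trans a3 ?_ ?_
      · simp
      · simp [hin']
    refine ⟨hs.replace (Old := [T, U]) (New := [.node x l U]) ha (by simp [hin']) (by simpa using h3),
      ?_, ha.1, ?_⟩
    · have h1 := reach_splay (T := T) (Ts := U :: Ts) hxT
      rw [e2] at h1
      exact h1.trans reach_join
    · have hp := pot_splay hnd hxT
      rw [e2] at hp
      have hj := pot_join_le (x := x) (l := l) (r := U) (by rwa [hin'])
      have hc := pot_pieces_le x l .nil
      have h1 := one_le_cost n
      have ht : (t3 : ℝ) ≤ t + 151 * depth x T + 114 := by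
        exact_mod_cast (by omega : t3 ≤ t + 151 * depth x T + 114)
      have hd : (0 : ℝ) ≤ depth x T := Nat.cast_nonneg _
      simp only [forestPot_cons, Nat.cast_add, Nat.cast_one]
      have hnil : pot (.nil : BinaryTree (Fin n)) = 0 := rfl
      linarith

/-- Splay the node in register 10. Its children are in the registers 11 and 12 afterwards. -/
def splayToCmd : Cmd := .seq splayCmd (nodeCmd 10 11 12)

theorem wp_splayTo (hw : n < 2 ^ w) {x : Fin n} {T : BinaryTree (Fin n)}
    {Ts : List (BinaryTree (Fin n))} (he : Env n s) (h10 : s.reg 10 = x) (hx : x ∈ inorder T)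
    (hs : Holds s.mem (T :: Ts))
    (k : ∀ s' t' l r, (∀ i, i < 6 ∨ 21 < i → s'.reg i = s.reg i) → s'.reg 10 = (x : ℕ) →
      s'.reg 11 = rootVal l → inorder l ++ x :: inorder r = inorder T →
      Transition 1 700 s.mem t (T :: Ts) s'.mem t' (.node x l r :: Ts) → Q s' t') :
    Wp w (fstLayout n) splayToCmd s t Q := by
  have hnd := hs.nodup_head
  rw [splayToCmd, wp_seq]
  refine wp_pieces hw he h10 (hs.rep T (by simp)) hnd hx
    fun s1 t1 l r q1 x1 l1 r1 cl cr e1 a1 ht1 => ?_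
  have hin : inorder T = inorder (.node x l r) := by rw [← e1, inorder_splay hnd]
  refine wp_node (he.congr fun i hi => q1 i (by omega)) hw (by omega) (by omega) (by omega)
    (by omega) (by omega) (by omega) x1 l1 r1 cl cr (hin ▸ hnd) fun s2 t2 q2 h2 a2 ht2 => ?_
  refine k s2 t2 l r (fun i hi => ?_) ?_ ?_ hin.symm ?_
  · rw [q2 i (by omega) (by omega), q1 i hi]
  · rw [q2 10 (by omega) (by omega), x1]
  · rw [q2 11 (by omega) (by omega), l1]
  · have ha : Agree (inorder T) s.mem s2.mem :=
      a1.trans a2 (List.Subset.refl _) (by rw [hin]; exact List.Subset.refl _)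
    refine ⟨hs.replace (Old := [T]) (New := [.node x l r]) (by simpa using ha)
      (by simp [hin]) (by simpa using h2), e1 ▸ reach_splay hx, ha.1, ?_⟩
    have hp := pot_splay hnd hx
    rw [e1] at hp
    have h1 := one_le_cost n
    have ht : (t2 : ℝ) ≤ t + 101 * depth x T + 58 := by
      exact_mod_cast (by omega : t2 ≤ t + 101 * depth x T + 58)
    have hd : (0 : ℝ) ≤ depth x T := Nat.cast_nonneg _
    simp only [forestPot_cons]
    linarith

/-- Cut the tree of the node in register 10 before this node. The node becomes a root, and the
register 11 holds the root of the other tree. -/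
def cutCmd : Cmd := .seq splayCmd (.seq (detachCmd 11) (nodeCmd 10 0 12))

theorem wp_cut (hw : n < 2 ^ w) {x : Fin n} {T : BinaryTree (Fin n)}
    {Ts : List (BinaryTree (Fin n))} (he : Env n s) (h10 : s.reg 10 = x) (hx : x ∈ inorder T)
    (hs : Holds s.mem (T :: Ts))
    (k : ∀ s' t' l r, (∀ i, i < 6 ∨ 21 < i → s'.reg i = s.reg i) → s'.reg 10 = (x : ℕ) →
      s'.reg 11 = rootVal l → inorder l ++ x :: inorder r = inorder T →
      Transition 5 700 s.mem t (T :: Ts) s'.mem t' (.node x .nil r :: l :: Ts) → Q s' t') :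
    Wp w (fstLayout n) cutCmd s t Q := by
  have hnd := hs.nodup_head
  rw [cutCmd, wp_seq]
  refine wp_pieces hw he h10 (hs.rep T (by simp)) hnd hx
    fun s1 t1 l r q1 x1 l1 r1 cl cr e1 a1 ht1 => ?_
  have hin : inorder T = inorder (.node x l r) := by rw [← e1, inorder_splay hnd]
  have hnd' := hin ▸ hnd
  rw [inorder, List.nodup_append] at hnd'
  have he1 : Env n s1 := he.congr fun i hi => q1 i (by omega)
  rw [wp_seq]
  refine wp_root he1 l1 cl hnd'.1 fun s2 t2 q2 h2 a2 ht2 => ?_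
  have hx2 : s2.reg 10 = x := by rw [q2, x1]
  refine wp_node (x := x) (l := .nil) (r := r) (he1.congr fun i _ => by rw [q2]) hw (by omega)
    (by omega) (by omega) (by omega) (by omega) (by omega) hx2 (by rw [q2, he1.r0]; rfl)
    (by rw [q2, r1]) (rep_nil _).core
    (cr.agree a2 fun y hy hy' => hnd'.2.2 y hy' y (by simp [hy]) rfl)
    (by simpa [inorder] using hnd'.2.1) fun s3 t3 q3 h3 a3 ht3 => ?_
  refine k s3 t3 l r (fun i hi => ?_) ?_ ?_ hin.symm ?_
  · rw [q3 i (by omega) (by omega), q2, q1 i hi]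
  · rw [q3 10 (by omega) (by omega), q2, x1]
  · rw [q3 11 (by omega) (by omega), q2, l1]
  · have ha : Agree (inorder T) s.mem s3.mem :=
      (a1.trans a2 (List.Subset.refl _) (by rw [hin, inorder]; exact List.subset_append_left _ _)).trans
        a3 (List.Subset.refl _) (by
          rw [hin]; simp [inorder])
    have h2' : Rep s3.mem l := h2.agree a3 fun y hy hy' =>
      hnd'.2.2 y hy y (by simpa [inorder] using hy') rfl
    refine ⟨hs.replace (Old := [T]) (New := [.node x .nil r, l]) (by simpa using ha)
      ?_ (by simpa using ⟨h3, h2'⟩), (e1 ▸ reach_splay hx : Reach 1 (T :: Ts) _).trans reach_split_left,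
      ha.1, ?_⟩
    · simpa [hin, inorder] using List.perm_append_comm (l₁ := x :: inorder r) (l₂ := inorder l)
    have hp := pot_splay hnd hx
    rw [e1] at hp
    have h1 := one_le_cost n
    have ht : (t3 : ℝ) ≤ t + 101 * depth x T + 61 := by
      exact_mod_cast (by omega : t3 ≤ t + 101 * depth x T + 61)
    have hd : (0 : ℝ) ≤ depth x T := Nat.cast_nonneg _
    have hm : Real.logb 2 (BinaryTree.node x .nil r).numNodes ≤
        Real.logb 2 (BinaryTree.node x l r).numNodes :=
      logb_nat_mono (by simp) (by simp)
    have hnil : pot (.nil : BinaryTree (Fin n)) = 0 := rfl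
    simp only [forestPot_cons]
    simp only [pot] at hp ⊢
    linarith

/-- Rotate the traversal of the tree of the node in register 10 such that it begins with this node.
The register 30 holds the root afterwards. -/
def rotateCmd : Cmd := .seq cutCmd <| .seq (mov 31 11) <| .seq (mov 30 10) concatCmd

theorem wp_rotate (hw : n < 2 ^ w) {x : Fin n} {a b : List (Fin n)} {T : BinaryTree (Fin n)}
    {Ts : List (BinaryTree (Fin n))} (he : Env n s) (h10 : s.reg 10 = x)
    (hT : inorder T = a ++ x :: b) (hs : Holds s.mem (T :: Ts))
    (k : ∀ s' t' T', (∀ i, i < 6 ∨ 31 < i → s'.reg i = s.reg i) → s'.reg 30 = rootVal T' →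
      inorder T' = x :: b ++ a →
      Transition 7 1702 s.mem t (T :: Ts) s'.mem t' (T' :: Ts) → Q s' t') :
    Wp w (fstLayout n) rotateCmd s t Q := by
  have hnd := hs.nodup_head
  rw [rotateCmd, wp_seq]
  refine wp_cut hw he h10 (by simp [hT]) hs fun s1 t1 l r q1 x1 l1 e1 h1 => ?_
  have hlr : inorder l = a ∧ inorder r = b := by
    rw [hT] at e1 hnd
    have hxl : x ∉ inorder l := fun h => by
      rw [← e1, List.nodup_append] at hnd
      exact hnd.2.2 x h x (by simp) rfl
    have hxa : x ∉ a := fun h => by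
      rw [List.nodup_append] at hnd
      exact hnd.2.2 x h x (by simp) rfl
    have h := congrArg (List.takeWhile (· ≠ x)) e1
    rw [List.takeWhile_append_of_pos (fun y hy => by simpa using fun h : y = x => hxl (h ▸ hy)),
      List.takeWhile_append_of_pos (fun y hy => by simpa using fun h : y = x => hxa (h ▸ hy))] at h
    have hl : inorder l = a := by simpa using h
    rw [hl] at e1
    exact ⟨hl, by simpa using e1⟩
  have r4 : s1.reg 4 = 0 := by rw [q1 4 (by omega), he.r4]
  simp only [mov, ↓wp_seq, ↓wp_bin, BinOp.eval, Function.update_apply, r4, x1, l1, Nat.reduceEqDiff,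
    if_false, Nat.sub_zero]
  refine wp_concat hw (T := .node x .nil r) (U := l) (Ts := Ts) ?_ ?_ ?_ (by simp) h1.holds
    fun s2 t2 T' q2 x2 e2 h2 => ?_
  · exact (he.congr (s' := s1) fun i hi => q1 i (by omega)).congr fun i hi => by
      simp [Function.update_apply]; split_ifs <;> first | rfl | omega
  · simp
  · simp
  refine k s2 t2 T' (fun i hi => ?_) x2 (by simp [e2, inorder, hlr]) ?_
  · rw [q2 i (by omega)]
    dsimp only
    rw [Function.update_apply, if_neg (by omega), Function.update_apply, if_neg (by omega),
      q1 i (by omega)]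
  · exact ((h1.trans (h1.holds.wait (c := 2) (by omega))).trans h2).mono (by omega) (by norm_num)

/-- Reverse the tree with root in register `v`. -/
def reverseCmd (v : ℕ) : Cmd := .seq (negateCmd v) (detachCmd v)

theorem wp_reverse {v : ℕ} {T : BinaryTree (Fin n)} {Ts : List (BinaryTree (Fin n))}
    (he : Env n s) (hv : v ≠ 6) (hr : s.reg v = rootVal T) (hs : Holds s.mem (T :: Ts))
    (k : ∀ s' t', (∀ r, r ≠ 6 → s'.reg r = s.reg r) →
      Transition 1 7 s.mem t (T :: Ts) s'.mem t' (mirror T :: Ts) → Q s' t') :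
    Wp w (fstLayout n) (reverseCmd v) s t Q := by
  have hnd := hs.nodup_head
  have hroot : rootVal (mirror T) = rootVal T := by rcases T with _ | ⟨_, _, _⟩ <;> rfl
  have hp : (inorder (mirror T)).Perm (inorder T) := by
    rw [inorder_mirror]; exact List.reverse_perm _
  rw [reverseCmd, wp_seq]
  refine wp_mirror he hv hr (hs.rep T (by simp)).core hnd fun s1 t1 q1 c1 a1 ht1 => ?_
  refine wp_root (he.congr fun i hi => q1 i (by omega)) (by rw [q1 v hv, hr, hroot]) c1
    (hp.nodup_iff.2 hnd) fun s2 t2 q2 h2 a2 ht2 => ?_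
  refine k s2 t2 (fun r hr => by rw [q2, q1 r hr]) ?_
  have ha : Agree (inorder T) s.mem s2.mem := a1.trans a2 (List.Subset.refl _) hp.subset
  refine ⟨hs.replace (Old := [T]) (New := [mirror T]) (by simpa using ha) (by simpa using hp)
    (by simpa using h2), reach_mirror, ha.1, ?_⟩
  have h1 := one_le_cost n
  have ht : (t2 : ℝ) ≤ t + 7 := by exact_mod_cast (by omega : t2 ≤ t + 7)
  simp only [forestPot_cons, pot_mirror]
  linarith
end

/-! ### Cycles as lists -/

section
variable {n : ℕ} {π : Equiv.Perm (Fin n)} {l : List (Fin n)}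

/-- The list `l` is a cycle of `π`, written from some element on, or empty. -/
def Follows (l : List (Fin n)) (π : Equiv.Perm (Fin n)) : Prop :=
  ∀ x ∈ l, π x = l.formPerm x

theorem Follows.rotate {l' : List (Fin n)} (h : Follows l π) (hnd : l.Nodup) (hr : l ~r l') :
    Follows l' π := fun x hx => by
  rw [h x (hr.mem_iff.2 hx), List.formPerm_eq_of_isRotated hnd hr]

theorem Follows.apply_mem (h : Follows l π) {x : Fin n} (hx : x ∈ l) : π x ∈ l := by
  rw [h x hx]; exact List.formPerm_apply_mem_of_mem hx

theorem Follows.pow_getElem (h : Follows l π) (hnd : l.Nodup) (k a : ℕ) (ha : a < l.length) :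
    (π ^ k) l[a] = l[(a + k) % l.length]'(Nat.mod_lt _ (by omega)) := by
  rw [← List.formPerm_pow_apply_getElem l hnd k a ha]
  induction k with
  | zero => rfl
  | succ k ih =>
    rw [pow_succ', pow_succ', Equiv.Perm.mul_apply, Equiv.Perm.mul_apply, ih, h]
    rw [List.formPerm_pow_apply_getElem l hnd k a ha]
    exact List.getElem_mem _

theorem Follows.sameCycle (h : Follows l π) (hnd : l.Nodup) {x y : Fin n} (hx : x ∈ l) :
    π.SameCycle x y ↔ y ∈ l := by
  constructor
  · intro hs
    obtain ⟨k, -, rfl⟩ := hs.exists_pow_eq'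
    obtain ⟨a, ha, rfl⟩ := List.mem_iff_getElem.1 hx
    rw [h.pow_getElem hnd]
    exact List.getElem_mem _
  · intro hy
    obtain ⟨a, ha, rfl⟩ := List.mem_iff_getElem.1 hx
    obtain ⟨b, hb, rfl⟩ := List.mem_iff_getElem.1 hy
    refine ⟨(l.length - a + b : ℕ), ?_⟩
    rw [zpow_natCast, h.pow_getElem hnd]
    congr 1
    rw [show a + (l.length - a + b) = b + l.length by omega, Nat.add_mod_right, Nat.mod_eq_of_lt hb]

theorem Follows.cycleOf (h : Follows l π) (hnd : l.Nodup) {x : Fin n} (hx : x ∈ l) :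
    π.cycleOf x = l.formPerm := by
  ext y
  by_cases hy : y ∈ l
  · rw [((h.sameCycle hnd hx).2 hy).cycleOf_apply, h y hy]
  · rw [Equiv.Perm.cycleOf_apply_of_not_sameCycle (by rwa [h.sameCycle hnd hx]),
      List.formPerm_apply_of_notMem hy]

theorem Follows.isLeast {a b : List (Fin n)} {i j : Fin n} (h : Follows (a ++ j :: b) π)
    (hnd : (a ++ j :: b).Nodup) (hi : (a ++ j :: b).head? = some i) :
    IsLeast {d : ℕ | (π ^ d) i = j} a.length := by
  have h0 : (a ++ j :: b)[0]'(by simp) = i := by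
    rw [List.head?_eq_getElem?, List.getElem?_eq_getElem (by simp)] at hi
    exact Option.some_injective _ hi
  have hj : (a ++ j :: b)[a.length]'(by simp) = j := by simp
  have hp : ∀ d, (π ^ d) i = (a ++ j :: b)[d % (a ++ j :: b).length]'(Nat.mod_lt _ (by simp)) := by
    intro d
    have := h.pow_getElem hnd d 0 (by simp)
    rw [h0] at this
    rw [this]
    simp
  constructor
  · show (π ^ a.length) i = j
    rw [hp, ← hj]
    congr 1
    · rw [hj]
    · rw [hj]; exact Nat.mod_eq_of_lt (by simp)
  · intro d hd
    have hd' := (hp d).symm.trans (hd.trans hj.symm)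
    rw [hnd.getElem_inj_iff] at hd'
    exact hd' ▸ Nat.mod_le _ _

theorem formPerm_append_cons (i j : Fin n) (a b : List (Fin n)) :
    (i :: a ++ j :: b).formPerm = (i :: a ++ [j]).formPerm * (j :: b).formPerm := by
  induction a generalizing i with
  | nil => simp
  | cons c a ih =>
    have := ih c
    simp only [List.cons_append, List.formPerm_cons_cons] at this ⊢
    rw [this, mul_assoc]

/-- Joining and splitting cycles by a transposition. -/
theorem formPerm_append {i j : Fin n} {a b : List (Fin n)} (hnd : (i :: a ++ j :: b).Nodup) :
    (i :: a ++ j :: b).formPerm =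
      Equiv.swap i j * ((i :: a).formPerm * (j :: b).formPerm) := by
  have h1 : (i :: a ++ [j]).Nodup := hnd.sublist
    (List.Sublist.append_left (List.singleton_sublist.2 (by simp)) _)
  rw [formPerm_append_cons, List.formPerm_eq_of_isRotated h1 List.isRotated_append,
    List.singleton_append, List.formPerm_cons_cons, Equiv.swap_comm, mul_assoc]

theorem Follows.merge {i j : Fin n} {a b : List (Fin n)} (ha : Follows (i :: a) π)
    (hb : Follows (j :: b) π) (hnd : (i :: a ++ j :: b).Nodup) :
    Follows (i :: a ++ j :: b) (Equiv.swap i j * π) := by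
  intro x hx
  have hd := List.disjoint_of_nodup_append hnd
  rw [formPerm_append hnd, Equiv.Perm.mul_apply, Equiv.Perm.mul_apply, Equiv.Perm.mul_apply]
  rcases List.mem_append.1 hx with hx | hx
  · rw [List.formPerm_apply_of_notMem (l := j :: b) (fun h => hd hx h), ha x hx]
  · rw [← hb x hx, List.formPerm_apply_of_notMem (l := i :: a) (fun h => hd h (hb.apply_mem hx))]

theorem Follows.divide {i j : Fin n} {a b : List (Fin n)} (h : Follows (i :: a ++ j :: b) π)
    (hnd : (i :: a ++ j :: b).Nodup) :
    Follows (i :: a) (Equiv.swap i j * π) ∧ Follows (j :: b) (Equiv.swap i j * π) := by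
  have hd := List.disjoint_of_nodup_append hnd
  have key : ∀ x ∈ i :: a ++ j :: b, (Equiv.swap i j * π) x =
      (i :: a).formPerm ((j :: b).formPerm x) := by
    intro x hx
    rw [Equiv.Perm.mul_apply, h x hx, formPerm_append hnd, Equiv.Perm.mul_apply,
      Equiv.swap_apply_self, Equiv.Perm.mul_apply]
  constructor
  · intro x hx
    rw [key x (List.mem_append_left _ hx),
      List.formPerm_apply_of_notMem (l := j :: b) (fun h => hd hx h)]
  · intro x hx
    rw [key x (List.mem_append_right _ hx), List.formPerm_apply_of_notMem (l := i :: a)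
      fun h => hd h (List.formPerm_apply_mem_of_mem hx)]

theorem Follows.swap_mul {i j : Fin n} (h : Follows l π) (hi : i ∉ l) (hj : j ∉ l) :
    Follows l (Equiv.swap i j * π) := by
  intro x hx
  have hm := h.apply_mem hx
  rw [Equiv.Perm.mul_apply, Equiv.swap_apply_of_ne_of_ne (ne_of_mem_of_not_mem hm hi)
    (ne_of_mem_of_not_mem hm hj), h x hx]

theorem Follows.toList {i : Fin n} {b : List (Fin n)} (h : Follows (i :: b) π)
    (hnd : (i :: b).Nodup) (hb : b ≠ []) : π.toList i = i :: b := by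
  have hc := h.cycleOf hnd (List.mem_cons_self)
  have hlen : (π.toList i).length = (i :: b).length := by
    rw [Equiv.Perm.length_toList, hc, List.support_formPerm_of_nodup _ hnd
      (by rintro x ⟨⟩; exact hb rfl), List.toFinset_card_of_nodup hnd]
  refine List.ext_getElem hlen fun k h1 h2 => ?_
  rw [Equiv.Perm.getElem_toList]
  have := h.pow_getElem hnd k 0 (by simp)
  simp only [List.getElem_cons_zero, Nat.zero_add] at this
  rw [this]
  congr 1
  exact Nat.mod_eq_of_lt h2

theorem Follows.flip {a b : List (Fin n)} {i j : Fin n} (h : Follows (a ++ j :: b) π)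
    (hnd : (a ++ j :: b).Nodup) (hi : (a ++ j :: b).head? = some i) :
    Follows (j :: a.reverse ++ b) (flipPerm π i j) ∧
      ∀ x, x ∉ a ++ j :: b → flipPerm π i j x = π x := by
  have him : i ∈ a ++ j :: b := List.mem_of_head? hi
  have hd : sInf {d : ℕ | (π ^ d) i = j} = a.length :=
    (h.isLeast hnd hi).csInf_eq
  have hc := h.cycleOf hnd him
  have hlist : ((π.toList i).take (a.length + 1)).reverse ++ (π.toList i).drop (a.length + 1) =
      j :: a.reverse ++ b ∨ a = [] ∧ b = [] ∧ π.toList i = [] := by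
    -- For a fixed point, `Equiv.Perm.toList` is the empty list.
    by_cases hab : a = [] ∧ b = []
    · obtain ⟨rfl, rfl⟩ := hab
      refine .inr ⟨rfl, rfl, ?_⟩
      rw [Equiv.Perm.toList_eq_nil_iff, Equiv.Perm.notMem_support]
      simp only [List.nil_append, List.head?_cons, Option.some.injEq] at hi
      subst hi
      simpa using h j (by simp)
    · left
      obtain ⟨c, hcons⟩ : ∃ c, a ++ j :: b = i :: c := by
        rcases hl : a ++ j :: b with _ | ⟨x, c⟩
        · simp at hl
        · rw [hl] at hi
          simp only [List.head?_cons, Option.some.injEq] at hi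
          exact ⟨c, by rw [hi]⟩
      have : π.toList i = a ++ j :: b := by
        rw [hcons] at h hnd ⊢
        refine h.toList hnd ?_
        rintro rfl
        rcases a with _ | ⟨x, a⟩
        · simp_all
        · simp at hcons
      rw [this]
      have h1 : (a ++ j :: b).take (a.length + 1) = a ++ [j] := by
        rw [List.take_append]; simp
      have h2 : (a ++ j :: b).drop (a.length + 1) = b := by
        rw [List.drop_append]; simp
      rw [h1, h2]; simp
  have hperm : (((π.toList i).take (a.length + 1)).reverse ++
      (π.toList i).drop (a.length + 1)).formPerm = (j :: a.reverse ++ b).formPerm := by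
    rcases hlist with h' | ⟨rfl, rfl, h'⟩
    · rw [h']
    · rw [h']; simp
  have hmem : ∀ x, x ∈ j :: a.reverse ++ b ↔ x ∈ a ++ j :: b := by
    intro x; simp; tauto
  have key : ∀ x, flipPerm π i j x = (j :: a.reverse ++ b).formPerm ((π.cycleOf i)⁻¹ (π x)) := by
    intro x
    simp only [flipPerm, hd, hperm, Equiv.Perm.mul_apply]
  constructor
  · intro x hx
    rw [key, h x ((hmem x).1 hx), hc]; simp
  · intro x hx
    have hx' : π x ∉ a ++ j :: b := by
      rw [← h.sameCycle hnd him] at hx ⊢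
      rwa [Equiv.Perm.sameCycle_apply_right]
    have h2 : (π.cycleOf i)⁻¹ (π x) = π x := by
      rw [Equiv.Perm.inv_eq_iff_eq, hc, List.formPerm_apply_of_notMem hx']
    rw [key, h2, List.formPerm_apply_of_notMem (by rwa [hmem])]

/-- The nonempty lists of a partition into cycles are as many as the cycles. -/
theorem numCycles_eq {Ls : List (List (Fin n))} (hnd : Ls.flatten.Nodup)
    (hmem : ∀ x, x ∈ Ls.flatten) (hf : ∀ l ∈ Ls, Follows l π) :
    numCycles π = Ls.countP (· ≠ []) := by
  have hnd' := List.nodup_flatten.1 hnd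
  have hm : ∀ x, ∃ a : Fin (Ls.filter (· ≠ [])).length, x ∈ (Ls.filter (· ≠ []))[a] := by
    intro x
    obtain ⟨l, hl, hx⟩ := List.mem_flatten.1 (hmem x)
    have : l ∈ Ls.filter (· ≠ []) := by
      rw [List.mem_filter]
      exact ⟨hl, by simpa using List.ne_nil_of_mem hx⟩
    obtain ⟨a, ha, rfl⟩ := List.mem_iff_getElem.1 this
    exact ⟨⟨a, ha⟩, hx⟩
  choose f hfm using hm
  have hmemF : ∀ a : Fin (Ls.filter (· ≠ [])).length, (Ls.filter (· ≠ []))[a] ∈ Ls := fun a =>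
    List.mem_of_mem_filter (List.getElem_mem a.2)
  have huniq : ∀ x, ∀ a : Fin (Ls.filter (· ≠ [])).length, x ∈ (Ls.filter (· ≠ []))[a] → f x = a := by
    intro x a hx
    by_contra hne
    have hp := hnd'.2.sublist (List.filter_sublist (p := (· ≠ [])))
    rcases lt_or_gt_of_ne hne with h | h
    · exact (List.pairwise_iff_getElem.1 hp _ _ _ _ h) (hfm x) hx
    · exact (List.pairwise_iff_getElem.1 hp _ _ _ _ h) hx (hfm x)
  have hsurj : Function.Surjective f := by
    intro a
    have h1 : (Ls.filter (· ≠ []))[a] ≠ [] := by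
      have := List.getElem_mem (l := Ls.filter (· ≠ [])) a.2
      rw [List.mem_filter] at this
      simpa using this.2
    obtain ⟨x, hx⟩ := List.exists_mem_of_ne_nil _ h1
    exact ⟨x, huniq x a hx⟩
  have hker : Setoid.ker f = Equiv.Perm.SameCycle.setoid π := by
    ext x y
    rw [Setoid.ker_def]
    show f x = f y ↔ π.SameCycle x y
    rw [(hf _ (hmemF (f x))).sameCycle (hnd'.1 _ (hmemF _)) (hfm x)]
    constructor
    · intro h; rw [h]; exact hfm y
    · intro h; exact (huniq y _ h).symm
  rw [numCycles, ← hker, Nat.card_congr (Setoid.quotientKerEquivOfSurjective f hsurj),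
    Nat.card_fin, List.countP_eq_length_filter]

end

/-! ### Walks, cycle tests and transpositions -/

section
variable {n w : ℕ} {π : Equiv.Perm (Fin n)} {s : State} {t : ℕ} {Q : State → ℕ → Prop}

/-- The number of nonempty trees. -/
def numTrees (Ts : List (BinaryTree (Fin n))) : ℕ := (Ts.map inorder).countP (· ≠ [])

/-- The memory holds the trees `Ts`, which are a forest of splay trees of `π`, and the number of
cycles. -/
structure IsForest (A : Memory) (π : Equiv.Perm (Fin n)) (Ts : List (BinaryTree (Fin n))) :
    Prop where
  holds : Holds A Ts
  mem : ∀ x, x ∈ Ts.flatMap inorder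
  follows : ∀ T ∈ Ts, Follows (inorder T) π
  counter : A 5 0 = numTrees Ts

theorem numTrees_perm {Ts Ts' : List (BinaryTree (Fin n))} (h : Ts.Perm Ts') :
    numTrees Ts = numTrees Ts' := (h.map inorder).countP_eq _

theorem IsForest.perm {A : Memory} {Ts Ts' : List (BinaryTree (Fin n))} (h : IsForest A π Ts)
    (hp : Ts.Perm Ts') : IsForest A π Ts' where
  holds := h.holds.perm hp
  mem x := (hp.flatMap_right inorder).mem_iff.1 (h.mem x)
  follows T hT := h.follows T (hp.mem_iff.2 hT)
  counter := by rw [h.counter, numTrees_perm hp]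

theorem IsForest.numCycles {A : Memory} {Ts : List (BinaryTree (Fin n))} (h : IsForest A π Ts) :
    A 5 0 = numCycles π := by
  have hfl : (Ts.map inorder).flatten = Ts.flatMap inorder := rfl
  rw [h.counter, numTrees, numCycles_eq (Ls := Ts.map inorder) (hfl ▸ h.holds.nodup)
    (fun x => hfl ▸ h.mem x)]
  intro l hl
  obtain ⟨T, hT, rfl⟩ := List.mem_map.1 hl
  exact h.follows T hT

theorem Holds.nodup_of_mem {A : Memory} {T : BinaryTree (Fin n)} {Ts : List (BinaryTree (Fin n))}
    (h : Holds A Ts) (hT : T ∈ Ts) : (inorder T).Nodup := by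
  have h := h.nodup
  rw [List.nodup_flatMap] at h
  exact h.1 T hT

theorem IsForest.same_iff {A : Memory} {Ts : List (BinaryTree (Fin n))} (h : IsForest A π Ts)
    {T : BinaryTree (Fin n)} (hT : T ∈ Ts) {x y : Fin n} (hx : x ∈ inorder T) :
    π.SameCycle x y ↔ y ∈ inorder T :=
  (h.follows T hT).sameCycle (h.holds.nodup_of_mem hT) hx

theorem IsForest.exists_perm {A : Memory} {Ts : List (BinaryTree (Fin n))} (h : IsForest A π Ts)
    (x : Fin n) : ∃ T Us, x ∈ inorder T ∧ Ts.Perm (T :: Us) := by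
  obtain ⟨T, hT, hx⟩ := List.mem_flatMap.1 (h.mem x)
  exact ⟨T, Ts.erase T, hx, List.perm_cons_erase hT⟩

theorem IsForest.isFST {A : Memory} {Ts : List (BinaryTree (Fin n))} {F : Forest n}
    (h : IsForest A π Ts) (hF : Part F Ts) : IsFST A F π := by
  have hT : ∀ x, F x ∈ Ts ∧ x ∈ inorder (F x) := fun x => by
    obtain ⟨T, hT, hx⟩ := List.mem_flatMap.1 (h.mem x)
    rw [hF.eq T hT x hx]
    exact ⟨hT, hx⟩
  refine ⟨⟨fun x => h.holds.nodup_of_mem (hT x).1, fun x => (hT x).2,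
    fun x y hy => hF.eq _ (hT x).1 y hy, fun x => ?_⟩, fun x => h.holds.rep _ (hT x).1, h.numCycles⟩
  exact ((h.follows _ (hT x).1).cycleOf (h.holds.nodup_of_mem (hT x).1) (hT x).2).symm

theorem IsForest.trans {k : ℕ} {D : ℝ} {A A' : Memory} {t t' : ℕ} {T T' : BinaryTree (Fin n)}
    {Ts : List (BinaryTree (Fin n))} (h : IsForest A π (T :: Ts))
    (h' : Transition k D A t (T :: Ts) A' t' (T' :: Ts)) (hr : inorder T ~r inorder T') :
    IsForest A' π (T' :: Ts) where
  holds := h'.holds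
  mem x := by
    have := h.mem x
    simp only [List.flatMap_cons, List.mem_append] at this ⊢
    rwa [← hr.mem_iff]
  follows U hU := by
    rcases List.mem_cons.1 hU with rfl | hU
    · exact (h.follows T (by simp)).rotate h.holds.nodup_head hr
    · exact h.follows U (List.mem_cons_of_mem _ hU)
  counter := by
    have : (inorder T ≠ []) ↔ (inorder T' ≠ []) := by
      rw [ne_eq, ne_eq, ← List.length_eq_zero_iff, ← List.length_eq_zero_iff, hr.perm.length_eq]
    rw [h'.counter, h.counter, numTrees, numTrees, List.map_cons, List.map_cons, List.countP_cons,
      List.countP_cons]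
    simp only [this]

theorem wp_splayTo_forest (hw : n < 2 ^ w) {x : Fin n} {Ts : List (BinaryTree (Fin n))}
    (he : Env n s) (h10 : s.reg 10 = x) (hs : IsForest s.mem π Ts)
    (k : ∀ s' t' T l r Us, (∀ i, i < 6 ∨ 21 < i → s'.reg i = s.reg i) → s'.reg 10 = (x : ℕ) →
      s'.reg 11 = rootVal l → x ∈ inorder T → inorder l ++ x :: inorder r = inorder T →
      Ts.Perm (T :: Us) → IsForest s'.mem π (.node x l r :: Us) →
      Transition 1 700 s.mem t Ts s'.mem t' (.node x l r :: Us) → Q s' t') :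
    Wp w (fstLayout n) splayToCmd s t Q := by
  obtain ⟨T, Us, hx, hp⟩ := hs.exists_perm x
  have hs' := hs.perm hp
  refine wp_splayTo hw he h10 hx hs'.holds fun s1 t1 l r q1 x1 l1 e1 h1 => ?_
  exact k s1 t1 T l r Us q1 x1 l1 hx e1 hp (hs'.trans h1 (by rw [← e1]; exact .refl _))
    (h1.perm_left hp)

theorem wp_rotate_forest (hw : n < 2 ^ w) {x : Fin n} {Ts : List (BinaryTree (Fin n))}
    (he : Env n s) (h10 : s.reg 10 = x) (hs : IsForest s.mem π Ts)
    (k : ∀ s' t' T T' b Us, (∀ i, i < 6 ∨ 31 < i → s'.reg i = s.reg i) →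
      s'.reg 30 = rootVal T' → x ∈ inorder T → inorder T ~r inorder T' → inorder T' = x :: b →
      Ts.Perm (T :: Us) → IsForest s'.mem π (T' :: Us) →
      Transition 7 1702 s.mem t Ts s'.mem t' (T' :: Us) → Q s' t') :
    Wp w (fstLayout n) rotateCmd s t Q := by
  obtain ⟨T, Us, hx, hp⟩ := hs.exists_perm x
  have hs' := hs.perm hp
  obtain ⟨a, b, hab⟩ := List.append_of_mem hx
  refine wp_rotate hw he h10 hab hs'.holds fun s1 t1 T' q1 x1 e1 h1 => ?_
  have hr : inorder T ~r inorder T' := by rw [hab, e1]; exact List.isRotated_append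
  exact k s1 t1 T T' (b ++ a) Us q1 x1 hx hr e1 hp (hs'.trans h1 hr) (h1.perm_left hp)

/-- Splay the node with the rank in register 23 in the tree with the root in register 30. -/
def seekCmd : Cmd :=
  .seq (mov 22 30) <| .seq findCmd <| .seq (mov 10 22) splayToCmd

/-- Walk along the cycle of the element in register 32, forwards or (if `inv` holds) backwards; the
number of steps is in register 33. The result in register 10 becomes a root. -/
def walkCmd (inv : Bool) : Cmd :=
  .seq (mov 10 32) <| .seq rotateCmd <| .seq (.load 34 2 30) <| .seq (.bin .mod 23 33 34) <|
  .seq (if inv then .branch (.lt 4 23) (.bin .sub 23 34 23) .skip else .skip) seekCmd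

/-- The goal of a walk of `k` steps from `x` on, along the cycle or (if `inv` holds) backwards. -/
def walk (π : Equiv.Perm (Fin n)) (inv : Bool) (k : ℕ) (x : Fin n) : Fin n :=
  if inv then (π⁻¹ ^ k) x else (π ^ k) x

/-- The rank of the goal of a walk of `k` steps from the first of `c` elements on. -/
def walkRank (inv : Bool) (k c : ℕ) : ℕ :=
  if inv then (if 0 < k % c then c - k % c else k % c) else k % c

theorem walkRank_lt (inv : Bool) (k : ℕ) {c : ℕ} (hc : 0 < c) : walkRank inv k c < c := by
  have := Nat.mod_lt k hc
  rw [walkRank]; split_ifs <;> omega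

theorem Follows.walk {b : List (Fin n)} {x : Fin n} (h : Follows (x :: b) π)
    (hnd : (x :: b).Nodup) (inv : Bool) (k : ℕ) :
    walk π inv k x = (x :: b)[walkRank inv k (x :: b).length]'(walkRank_lt _ _ (by simp)) := by
  cases inv
  · have := h.pow_getElem hnd k 0 (by simp)
    simp only [List.getElem_cons_zero, Nat.zero_add] at this
    simp only [FST.walk, walkRank, Bool.false_eq_true, if_false, this]
  · simp only [FST.walk, if_true]
    have hlt := Nat.mod_lt k (y := (x :: b).length) (by simp)
    rw [inv_pow, Equiv.Perm.inv_eq_iff_eq, h.pow_getElem hnd]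
    have h0 : (walkRank true k (x :: b).length + k) % (x :: b).length = 0 := by
      simp only [walkRank, if_true]
      split_ifs with h
      · rw [← Nat.add_mod_mod, Nat.sub_add_cancel hlt.le, Nat.mod_self]
      · have : k % (x :: b).length = 0 := by omega
        rw [this, Nat.zero_add, this]
    simp only [h0, List.getElem_cons_zero]

theorem wp_walk (hw : n < 2 ^ w) {inv : Bool} {x : Fin n} {m : ℕ} {Ts : List (BinaryTree (Fin n))}
    (he : Env n s) (h32 : s.reg 32 = x) (h33 : s.reg 33 = m) (hs : IsForest s.mem π Ts)
    (k : ∀ s' t' Ts', (∀ i, i < 6 ∨ 34 < i → s'.reg i = s.reg i) →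
      s'.reg 10 = (walk π inv m x : ℕ) → IsForest s'.mem π Ts' →
      Transition 8 2500 s.mem t Ts s'.mem t' Ts' → Q s' t') :
    Wp w (fstLayout n) (walkCmd inv) s t Q := by
  simp only [walkCmd, mov, ↓wp_seq, ↓wp_bin, BinOp.eval, he.r4, h32, Nat.sub_zero]
  refine wp_rotate_forest hw (x := x) (Ts := Ts) (he.congr fun i hi => ?_) (by simp) hs
    fun s1 t1 T T' b Us q1 x1 hx hr e1 hp f1 h1 => ?_
  · dsimp only; rw [Function.update_apply, if_neg (by omega)]
  have q1' : ∀ i, i < 6 ∨ 31 < i → s1.reg i = s.reg i := fun i hi => by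
    rw [q1 i hi]; dsimp only; rw [Function.update_apply, if_neg (by omega)]
  have hne : T' ≠ .nil := by rintro rfl; simp [inorder] at e1
  have hrep := f1.holds.rep T' (by simp)
  have hnd := f1.holds.nodup_head
  have hfol := f1.follows T' (by simp)
  have hsize := hrep.core.size hne
  rw [← length_inorder, e1] at hsize
  have hlt : rootVal T' < n := by
    rcases T' with _ | ⟨y, _, _⟩
    · exact absurd rfl hne
    · exact y.isLt
  have hcpos : 0 < (x :: b).length := by simp
  generalize hc : (x :: b).length = c at hsize hcpos
  have r4 : s1.reg 4 = 0 := by rw [q1' 4 (by omega), he.r4]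
  have r33 : s1.reg 33 = m := by rw [q1' 33 (by omega), h33]
  simp only [↓wp_load, ↓wp_seq, ↓wp_bin, BinOp.eval, x1, hlt, fstLayout, Nat.reduceLT, if_true, true_and,
    hsize, Function.update_apply, r33, Nat.reduceEqDiff, if_false]
  have key : ∀ (s2 : State) (t2 : ℕ), (∀ i, i ≠ 23 → i ≠ 34 → s2.reg i = s1.reg i) →
      s2.mem = s1.mem → s2.reg 23 = walkRank inv m c → t2 ≤ t1 + 6 →
      Wp w (fstLayout n) seekCmd s2 t2 Q := by
    intro s2 t2 q2 m2 x2 ht2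
    have r4' : s2.reg 4 = 0 := by rw [q2 4 (by omega) (by omega), r4]
    have hq := walkRank_lt inv m hcpos
    simp only [seekCmd, mov, ↓wp_seq, ↓wp_bin, BinOp.eval, r4', Nat.sub_zero, q2 30 (by omega) (by omega), x1]
    have hq' : walkRank inv m c < (inorder T').length := by rwa [e1, hc]
    refine wp_rank (T := T') (q := walkRank inv m c) ?_ (by simp) (by simp [x2])
      (by simpa only [m2] using hrep.core) hnd hq'
      fun s3 t3 q3 m3 x3 ht3 => ?_
    · refine he.congr fun i hi => ?_
      dsimp only
      rw [Function.update_apply, if_neg (by omega), q2 i (by omega) (by omega), q1' i (by omega)]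
    have hz : (inorder T')[walkRank inv m c] = walk π inv m x := by
      rw [e1] at hfol hnd
      rw [hfol.walk hnd]
      simp only [e1, hc]
    set z := (inorder T')[walkRank inv m c] with hzdef
    have hzm : z ∈ inorder T' := List.getElem_mem _
    have q3' : ∀ i, i < 6 ∨ 34 < i → s3.reg i = s.reg i := fun i hi => by
      rw [q3 i (by omega) (by omega)]
      dsimp only
      rw [Function.update_apply, if_neg (by omega), q2 i (by omega) (by omega), q1' i (by omega)]
    have r4'' : s3.reg 4 = 0 := by rw [q3' 4 (by omega), he.r4]
    have m3' : s3.mem = s1.mem := by rw [m3, m2]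
    simp only [↓wp_seq, ↓wp_bin, BinOp.eval, r4'', Nat.sub_zero, x3]
    rw [splayToCmd, wp_seq]
    refine wp_pieces hw (x := z) (T := T') (he.congr fun i hi => ?_) (by simp)
      (by simpa only [m3'] using hrep) hnd hzm
      fun s4 t4 l r q4 x4 l4 r4 cl cr e4 a4 ht4 => ?_
    · dsimp only
      rw [Function.update_apply, if_neg (by omega), q3' i (by omega)]
    have hin : inorder T' = inorder (.node z l r) := by rw [← e4, inorder_splay hnd]
    have q4' : ∀ i, i < 6 ∨ 34 < i → s4.reg i = s.reg i := fun i hi => by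
      rw [q4 i (by omega)]
      dsimp only
      rw [Function.update_apply, if_neg (by omega), q3' i hi]
    refine wp_node (he.congr fun i hi => q4' i (by omega)) hw (by omega) (by omega) (by omega)
      (by omega) (by omega) (by omega) x4 l4 r4 cl cr (hin ▸ hnd) fun s5 t5 q5 h5 a5 ht5 => ?_
    have ht5' : Transition 1 740 s1.mem t1 (T' :: Us) s5.mem t5 (.node z l r :: Us) := by
      dsimp only at a4
      rw [m3'] at a4
      have ha : Agree (inorder T') s1.mem s5.mem :=
        a4.trans a5 (List.Subset.refl _) (by rw [hin]; exact List.Subset.refl _)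
      refine ⟨f1.holds.replace (Old := [T']) (New := [.node z l r]) (by simpa using ha)
        (by simp [hin]) (by simpa using h5), e4 ▸ reach_splay hzm, ha.1, ?_⟩
      have hp := pot_splay hnd hzm
      rw [e4] at hp
      have h1 := one_le_cost n
      have ht : (t5 : ℝ) ≤ t1 + 151 * depth z T' + 140 := by
        exact_mod_cast (by omega : t5 ≤ t1 + 151 * depth z T' + 140)
      have hd : (0 : ℝ) ≤ depth z T' := Nat.cast_nonneg _
      simp only [forestPot_cons]
      linarith
    refine k s5 t5 (.node z l r :: Us) (fun i hi => ?_) ?_ ?_ ?_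
    · rw [q5 i (by omega) (by omega), q4' i hi]
    · rw [q5 10 (by omega) (by omega), x4, hz]
    · exact f1.trans ht5' (by rw [hin])
    · have := (hs.holds.wait (t := t) (c := 1) le_rfl).trans (h1.trans ht5')
      exact this.mono (by omega) (by norm_num)
  rcases inv
  · simp only [Bool.false_eq_true, if_false, ↓wp_skip]
    refine key _ _ ?_ rfl ?_ (by omega)
    · intro i h1 h2; simp [Function.update_apply, h1, h2]
    · simp [walkRank]
  · simp only [if_true, ↓wp_branch, ↓wp_skip, ↓wp_bin, Test.eval, BinOp.eval, Function.update_apply,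
      Nat.reduceEqDiff, if_false, r4, decide_eq_true_eq]
    split_ifs with hpos
    · refine key _ _ ?_ rfl ?_ (by omega)
      · intro i h1 h2; simp [Function.update_apply, h1, h2]
      · simp [walkRank, hpos]
    · refine key _ _ ?_ rfl ?_ (by omega)
      · intro i h1 h2; simp [Function.update_apply, h1, h2]
      · simp [walkRank, hpos]

/-- Test whether the elements in the registers 35 and 36 are in the same cycle: if both are splayed
and the former is still a root, then they are not, unless they are equal. -/
def sameCmd : Cmd :=
  .seq (mov 10 35) <| .seq splayToCmd <| .seq (mov 10 36) <| .seq splayToCmd <|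
  .branch (.eq 35 36) (mov 37 5)
    (.seq (.load 6 1 35) (.branch (.lt 6 0) (mov 37 5) (mov 37 4)))

open Classical in
theorem wp_same (hw : n < 2 ^ w) {i j : Fin n} {Ts : List (BinaryTree (Fin n))}
    (he : Env n s) (h35 : s.reg 35 = i) (h36 : s.reg 36 = j) (hs : IsForest s.mem π Ts)
    (k : ∀ s' t' Ts', (∀ a, a < 6 ∨ 21 < a → a ≠ 37 → s'.reg a = s.reg a) →
      s'.reg 37 = (if π.SameCycle i j then 1 else 0) → IsForest s'.mem π Ts' →
      Transition 2 1410 s.mem t Ts s'.mem t' Ts' → Q s' t') :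
    Wp w (fstLayout n) sameCmd s t Q := by
  simp only [sameCmd, mov, ↓wp_seq, ↓wp_bin, BinOp.eval, he.r4, h35, Nat.sub_zero]
  refine wp_splayTo_forest hw (x := i) (Ts := Ts) (he.congr fun a ha => ?_) (by simp) hs
    fun s1 t1 T l r Us q1 x1 l1 hx e1 hp f1 h1 => ?_
  · dsimp only; rw [Function.update_apply, if_neg (by omega)]
  have q1' : ∀ i, i < 6 ∨ 21 < i → s1.reg i = s.reg i := fun i hi => by
    rw [q1 i hi]; dsimp only; rw [Function.update_apply, if_neg (by omega)]
  have r4 : s1.reg 4 = 0 := by rw [q1' 4 (by omega), he.r4]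
  simp only [mov, ↓wp_seq, ↓wp_bin, BinOp.eval, r4, q1' 36 (by omega), h36, Nat.sub_zero]
  refine wp_splayTo_forest hw (x := j) (Ts := .node i l r :: Us) (he.congr fun a ha => ?_) (by simp) f1
    fun s2 t2 T' l' r' Us' q2 x2 l2 hx' e2 hp' f2 h2 => ?_
  · dsimp only; rw [Function.update_apply, if_neg (by omega), q1' a (by omega)]
  have q2' : ∀ i, i < 6 ∨ 21 < i → s2.reg i = s.reg i := fun i hi => by
    rw [q2 i hi]; dsimp only; rw [Function.update_apply, if_neg (by omega), q1' i hi]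
  have r4 : s2.reg 4 = 0 := by rw [q2' 4 (by omega), he.r4]
  have r5 : s2.reg 5 = 1 := by rw [q2' 5 (by omega), he.r5]
  have r0 : s2.reg 0 = n := by rw [q2' 0 (by omega), he.r0]
  simp only [↓wp_branch, ↓wp_seq, ↓wp_load, ↓wp_bin, Test.eval, BinOp.eval, r4, r5, r0, q2' 35 (by omega),
    h35, q2' 36 (by omega), h36, Nat.sub_zero, fstLayout, Fin.is_lt, Nat.reduceLT, if_true, true_and,
    decide_eq_true_eq, Function.update_apply, Nat.reduceEqDiff, if_false, OfNat.zero_ne_ofNat]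
  have hend : ∀ (s3 : State) (t3 : ℕ) (v : ℕ), v = (if π.SameCycle i j then 1 else 0) →
      (∀ a, a ≠ 6 → s3.reg a = Function.update s2.reg 37 v a) → s3.mem = s2.mem → t3 ≤ t2 + 4 →
      Q s3 t3 := by
    intro s3 t3 v hv q3 m3 ht3
    refine k s3 t3 _ (fun a ha ha' => ?_) ?_ (m3 ▸ f2) ?_
    · rw [q3 a (by omega), Function.update_apply, if_neg ha', q2' a ha]
    · rw [q3 37 (by omega), Function.update_apply, if_pos rfl, hv]
    · rw [m3]
      have := ((hs.holds.wait (t := t) (c := 1) le_rfl).trans h1).trans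
        (((f1.holds.wait (t := t1) (c := 1) le_rfl).trans h2).trans
          (f2.holds.wait (t := t2) (c := 4) ht3))
      exact this.mono (by omega) (by norm_num)
  have hiff := f1.same_iff (T := .node i l r) (by simp) (x := i) (y := j) (by simp [inorder])
  by_cases hij : i = j
  · rw [if_pos (by rw [hij])]
    refine hend _ _ 1 (by rw [if_pos (by rw [hij])]) (fun a ha => rfl) rfl (by omega)
  · rw [if_neg (by rwa [Fin.val_inj])]
    by_cases hsame : π.SameCycle i j
    · have him : i ∈ inorder (.node j l' r') :=
        (f2.same_iff (T := .node j l' r') (by simp) (x := j) (by simp [inorder])).1 hsame.symm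
      have hlt := (f2.holds.rep (.node j l' r') (by simp)).core.link_lt him
        (by rwa [rootVal_node, Ne, Fin.val_inj])
      rw [if_pos hlt]
      refine hend _ _ 1 (by rw [if_pos hsame]) (fun a ha => ?_) rfl (by omega)
      simp [Function.update_apply, ha]
    · have hne : BinaryTree.node i l r ≠ T' := by
        rintro rfl
        exact hsame (hiff.2 hx')
      have hmem : BinaryTree.node i l r ∈ Us' := by
        have := hp'.mem_iff.1 (List.mem_cons_self (a := BinaryTree.node i l r) (l := Us))
        exact (List.mem_cons.1 this).resolve_left hne
      have hlink := (f2.holds.rep _ (List.mem_cons_of_mem _ hmem)).link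
      rw [if_neg (by omega)]
      refine hend _ _ 0 (by rw [if_neg hsame]) (fun a ha => ?_) rfl (by omega)
      simp [Function.update_apply, ha]

end

/-! ### Transpositions and flips -/

section
variable {n w : ℕ} {π : Equiv.Perm (Fin n)} {s : State} {t : ℕ} {Q : State → ℕ → Prop}

theorem Rep.setCounter {A : Memory} {T : BinaryTree (Fin n)} {v : ℕ} (h : Rep A T) :
    Rep (setCell A 5 0 v) T := by
  obtain ⟨S, hS, h⟩ := h
  exact ⟨S, hS, h.congr_matrix fun c hc x _ => setCell_ne (by omega)⟩

theorem Holds.setCounter {A : Memory} {Ts : List (BinaryTree (Fin n))} {v : ℕ} (h : Holds A Ts) :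
    Holds (setCell A 5 0 v) Ts := ⟨h.nodup, fun T hT => (h.rep T hT).setCounter⟩

theorem numTrees_cons_of_mem {T : BinaryTree (Fin n)} {x : Fin n} (h : x ∈ inorder T)
    (Ts : List (BinaryTree (Fin n))) : numTrees (T :: Ts) = numTrees Ts + 1 := by
  rw [numTrees, List.map_cons, List.countP_cons, if_pos (by simpa using List.ne_nil_of_mem h)]
  rfl

theorem numTrees_le_length (Ts : List (BinaryTree (Fin n))) :
    numTrees Ts ≤ (Ts.flatMap inorder).length := by
  induction Ts with
  | nil => simp [numTrees]
  | cons T Ts ih =>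
    rw [numTrees, List.map_cons, List.countP_cons, List.flatMap_cons, List.length_append]
    rw [numTrees] at ih
    split_ifs with hT
    · have : (inorder T).length ≠ 0 := by simpa using hT
      omega
    · omega

theorem numTrees_le {A : Memory} {Ts : List (BinaryTree (Fin n))} (h : Holds A Ts) :
    numTrees Ts ≤ n :=
  (numTrees_le_length Ts).trans (by simpa using h.nodup.length_le_card)

/-- The transposition of the elements in the registers 35 and 36 is applied after the permutation:
if they are in the same cycle, this is split before them, otherwise their cycles are joined. -/
def transposeCmd : Cmd :=
  .branch (.eq 35 36) .skip <| .seq sameCmd <| .seq (mov 10 35) <| .seq rotateCmd <|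
  .branch (.eq 37 5)
    (.seq (mov 10 36) <| .seq cutCmd <|
      .seq (.load 6 5 4) <| .seq (.bin .add 6 6 5) (.store 5 4 6))
    (.seq (mov 38 30) <| .seq (mov 10 36) <| .seq rotateCmd <| .seq (mov 31 30) <|
      .seq (mov 30 38) <| .seq concatCmd <|
      .seq (.load 6 5 4) <| .seq (.bin .sub 6 6 5) (.store 5 4 6))

theorem wp_transpose (hw : n < 2 ^ w) {i j : Fin n} {Ts : List (BinaryTree (Fin n))}
    (he : Env n s) (h35 : s.reg 35 = i) (h36 : s.reg 36 = j) (hs : IsForest s.mem π Ts)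
    (k : ∀ (s' : State) (t' : ℕ) Ts', IsForest s'.mem (Equiv.swap i j * π) Ts' → Reach 18 Ts Ts' →
      (t' : ℝ) + 200 * forestPot Ts' ≤ t + 200 * forestPot Ts + 6000 * cost n → Q s' t') :
    Wp w (fstLayout n) transposeCmd s t Q := by
  rw [transposeCmd, wp_branch]
  by_cases hij : i = j
  · rw [if_pos (by simp [Test.eval, h35, h36, hij]), wp_skip]
    have := hs.holds.wait (t := t) (t' := t + 1 + 1) (c := 2) (by omega)
    refine k _ _ Ts (by
      subst hij
      rw [Equiv.swap_self, ← Equiv.Perm.one_def, one_mul]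
      exact hs) (this.reach.mono (by omega)) ?_
    exact (this.mono (k' := 0) le_rfl (by norm_num : ((2 : ℕ) : ℝ) ≤ 6000)).time
  rw [if_neg (by simp [Test.eval, h35, h36, Fin.val_inj, hij]), wp_seq]
  refine wp_same hw he h35 h36 hs fun s1 t1 Ts1 q1 x1 f1 h1 => ?_
  have r4 : s1.reg 4 = 0 := by rw [q1 4 (by omega) (by omega), he.r4]
  simp only [mov, ↓wp_seq, ↓wp_bin, BinOp.eval, r4, q1 35 (by omega) (by omega), h35, Nat.sub_zero]
  refine wp_rotate_forest hw (x := i) (Ts := Ts1) (he.congr fun a ha => ?_) (by simp) f1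
    fun s2 t2 T T' b Us q2 x2 hx hr e2 hp f2 h2 => ?_
  · dsimp only; rw [Function.update_apply, if_neg (by omega), q1 a (by omega) (by omega)]
  dsimp only at h2
  have q2' : ∀ a, a < 6 ∨ 31 < a → a ≠ 37 → s2.reg a = s.reg a := fun a ha ha' => by
    rw [q2 a ha]; dsimp only
    rw [Function.update_apply, if_neg (by omega), q1 a (by omega) (by omega)]
  have x2' : s2.reg 37 = s1.reg 37 := by
    rw [q2 37 (by omega)]; dsimp only; rw [Function.update_apply, if_neg (by omega)]
  have r0 : s2.reg 0 = n := by rw [q2' 0 (by omega) (by omega), he.r0]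
  have r4 : s2.reg 4 = 0 := by rw [q2' 4 (by omega) (by omega), he.r4]
  have r5 : s2.reg 5 = 1 := by rw [q2' 5 (by omega) (by omega), he.r5]
  have h12 := ((hs.holds.wait (t := t) (c := 1) le_rfl).trans (h1.trans (f1.holds.wait (t := t1) (c := 1 + 1) (by omega)))).trans
    h2
  have hnd := f2.holds.nodup_head
  have hsame := f2.same_iff (T := T') (by simp) (x := i) (y := j) (by simp [e2])
  simp only [↓wp_branch, Test.eval, x2', x1, r5]
  by_cases hc : π.SameCycle i j
  · rw [if_pos (by simp [hc])]
    have hj := hsame.1 hc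
    simp only [mov, ↓wp_seq, ↓wp_bin, BinOp.eval, r4, q2' 36 (by omega) (by omega), h36, Nat.sub_zero]
    refine wp_cut hw (x := j) (he.congr fun a ha => ?_) (by simp) hj f2.holds
      fun s3 t3 l r q3 x3 l3 e3 h3 => ?_
    · dsimp only; rw [Function.update_apply, if_neg (by omega), q2' a (by omega) (by omega)]
    dsimp only at h3
    have q3' : ∀ a, a < 6 ∨ 31 < a → a ≠ 37 → s3.reg a = s.reg a := fun a ha ha' => by
      rw [q3 a (by omega)]; dsimp only
      rw [Function.update_apply, if_neg (by omega), q2' a (by omega) (by omega)]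
    obtain ⟨a, ha⟩ : ∃ a, inorder l = i :: a := by
      rw [e2] at e3
      rcases hl : inorder l with _ | ⟨y, a⟩
      · rw [hl] at e3
        simp only [List.nil_append, List.cons.injEq] at e3
        exact absurd e3.1.symm hij
      · rw [hl] at e3
        simp only [List.cons_append, List.cons.injEq] at e3
        exact ⟨a, by rw [e3.1]⟩
    have hcnt := h3.counter
    rw [f2.counter, numTrees_cons_of_mem (x := i) (by simp [e2])] at hcnt
    have hnew : numTrees (.node j .nil r :: l :: Us) = numTrees Us + 1 + 1 := by
      rw [numTrees_cons_of_mem (x := j) (by simp [inorder]),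
        numTrees_cons_of_mem (x := i) (by simp [ha])]
    have hle := numTrees_le h3.holds
    rw [hnew] at hle
    have hfol := f2.follows T' (by simp)
    rw [← e3, ha] at hfol hnd
    have hd := hfol.divide hnd
    simp only [↓wp_load, ↓wp_seq, ↓wp_bin, ↓wp_store, BinOp.eval, fstLayout, q3' 4 (by omega) (by omega),
      he.r4, q3' 5 (by omega) (by omega), he.r5, Function.update_apply, if_true, if_false,
      Nat.reduceEqDiff, Nat.reduceLT, Nat.zero_lt_one, true_and, hcnt, or_true,
      Nat.mod_eq_of_lt (lt_of_le_of_lt hle hw)]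
    refine ⟨lt_two_pow_clog hle, k _ _ (.node j .nil r :: l :: Us) ?_ ?_ ?_⟩
    · refine ⟨h3.holds.setCounter, fun y => ?_, ?_, by simp [setCell_apply, hnew]⟩
      · have := f2.mem y
        simp only [List.flatMap_cons, List.mem_append, ← e3, inorder, List.mem_cons] at this ⊢
        simp only [List.not_mem_nil, false_or]
        tauto
      · intro U hU
        simp only [List.mem_cons] at hU
        rcases hU with rfl | rfl | hU
        · simpa [inorder] using hd.2
        · rw [ha]; exact hd.1
        · have hdisj : ∀ y ∈ inorder U, y ∉ inorder T' := fun y hy hy' => by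
            have := f2.holds.nodup
            rw [List.flatMap_cons, List.nodup_append] at this
            exact this.2.2 y hy' y (List.mem_flatMap.2 ⟨U, hU, hy⟩) rfl
          exact (f2.follows U (List.mem_cons_of_mem _ hU)).swap_mul
            (fun h => hdisj i h (by simp [e2])) (fun h => hdisj j h hj)
    · exact (h12.reach.trans h3.reach).mono (by omega)
    · have := ((h12.trans (f2.holds.wait (t := t2) (t' := t2 + 1 + 1) (c := 2) (by omega))).trans h3).trans
        (h3.holds.wait (t := t3) (t' := t3 + 1 + 1 + 1) (c := 3) (by omega))
      exact (this.mono (D' := 6000) le_rfl (by norm_num)).time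
  · rw [if_neg (by simp [hc])]
    have hj : j ∉ inorder T' := fun h => hc (hsame.2 h)
    simp only [mov, ↓wp_seq, ↓wp_bin, BinOp.eval, Function.update_apply, r4, q2' 36 (by omega) (by omega),
      h36, Nat.sub_zero, Nat.reduceEqDiff, if_false, x2]
    refine wp_rotate_forest hw (x := j) (Ts := T' :: Us) (he.congr fun a ha => ?_) (by simp) f2
      fun s3 t3 U U' c Us' q3 x3 hx3 hr3 e3 hp3 f3 h3 => ?_
    · dsimp only
      rw [Function.update_apply, if_neg (by omega), Function.update_apply, if_neg (by omega),
        q2' a (by omega) (by omega)]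
    dsimp only at h3
    have q3' : ∀ a, a < 6 → s3.reg a = s.reg a := fun a ha => by
      rw [q3 a (by omega)]; dsimp only
      rw [Function.update_apply, if_neg (by omega), Function.update_apply, if_neg (by omega),
        q2' a (by omega) (by omega)]
    have x3' : s3.reg 38 = rootVal T' := by
      rw [q3 38 (by omega)]; dsimp only
      rw [Function.update_apply, if_neg (by omega), Function.update_apply, if_pos rfl]
    have hne : T' ≠ U := by rintro rfl; exact hj hx3
    have hmem : T' ∈ Us' := by
      have := hp3.mem_iff.1 (List.mem_cons_self (a := T') (l := Us))
      exact (List.mem_cons.1 this).resolve_left hne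
    have hperm : (U' :: Us').Perm (T' :: U' :: Us'.erase T') :=
      ((List.perm_cons_erase hmem).cons U').trans (.swap _ _ _)
    have f3' := f3.perm hperm
    have h3' := h3.perm hperm
    have r4 : s3.reg 4 = 0 := by rw [q3' 4 (by omega), he.r4]
    simp only [↓wp_seq, ↓wp_bin, BinOp.eval, Function.update_apply, r4, Nat.sub_zero, Nat.reduceEqDiff,
      if_false, x3, x3']
    refine wp_concat hw (T := T') (U := U') (Ts := Us'.erase T') (he.congr fun a ha => ?_) (by simp)
      (by simp) (by rintro rfl; simp [inorder] at e2) f3'.holds fun s4 t4 V q4 x4 e4 h4 => ?_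
    · dsimp only
      rw [Function.update_apply, if_neg (by omega), Function.update_apply, if_neg (by omega),
        q3' a (by omega)]
    dsimp only at h4
    have q4' : ∀ a, a < 6 → s4.reg a = s.reg a := fun a ha => by
      rw [q4 a (by omega)]; dsimp only
      rw [Function.update_apply, if_neg (by omega), Function.update_apply, if_neg (by omega), q3' a ha]
    have hcnt := h4.counter
    rw [f3'.counter, numTrees_cons_of_mem (x := i) (by simp [e2]),
      numTrees_cons_of_mem (x := j) (by simp [e3])] at hcnt
    have hnew : numTrees (V :: Us'.erase T') = numTrees (Us'.erase T') + 1 :=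
      numTrees_cons_of_mem (x := i) (by simp [e4, e2]) _
    have hle := numTrees_le h4.holds
    rw [hnew] at hle
    have hnd' := f3'.holds.nodup_two
    have hm := (f3'.follows T' (by simp))
    have hm' := (f3'.follows U' (by simp))
    rw [e2] at hm
    rw [e3] at hm'
    rw [e2, e3] at hnd' e4
    have hmerge := hm.merge hm' hnd'
    simp only [↓wp_load, ↓wp_seq, ↓wp_bin, ↓wp_store, BinOp.eval, fstLayout, q4' 4 (by omega),
      he.r4, q4' 5 (by omega), he.r5, Function.update_apply, if_true, if_false,
      Nat.reduceEqDiff, Nat.reduceLT, Nat.zero_lt_one, true_and, hcnt, or_true,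
      Nat.add_sub_cancel]
    refine ⟨lt_two_pow_clog hle, k _ _ (V :: Us'.erase T') ?_ ?_ ?_⟩
    · refine ⟨h4.holds.setCounter, fun y => ?_, ?_, by simp [setCell_apply, hnew]⟩
      · have := f3'.mem y
        simp only [List.flatMap_cons, List.mem_append, e4, e2, e3] at this ⊢
        tauto
      · intro W hW
        simp only [List.mem_cons] at hW
        rcases hW with rfl | hW
        · rw [e4]; exact hmerge
        · have hdisj : ∀ y ∈ inorder W, y ∉ inorder T' ++ inorder U' := fun y hy hy' => by
            have := f3'.holds.nodup
            rw [List.flatMap_cons, List.flatMap_cons, ← List.append_assoc, List.nodup_append] at this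
            exact this.2.2 y hy' y (List.mem_flatMap.2 ⟨W, hW, hy⟩) rfl
          exact (f3'.follows W (by simp [hW])).swap_mul
            (fun h => hdisj i h (by simp [e2])) (fun h => hdisj j h (by simp [e3]))
    · exact ((h12.reach.trans h3'.reach).trans h4.reach).mono (by omega)
    · have := (((h12.trans (f2.holds.wait (t := t2) (t' := t2 + 1 + 1 + 1) (c := 3) (by omega))).trans
        h3').trans (f3'.holds.wait (t := t3) (t' := t3 + 1 + 1) (c := 2) (by omega))).trans
        (h4.trans (h4.holds.wait (t := t4) (t' := t4 + 1 + 1 + 1) (c := 3) (by omega)))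
      exact (this.mono (D' := 6000) le_rfl (by norm_num)).time

/-- The flip of the elements in the registers 1 and 2. If the traversal is rotated such that it
begins with the former, then its part before the latter is to be reversed and to be put behind the
latter. This is done by cutting the reversed tree and by reversing the remaining part back. -/
def flipCmd : Cmd :=
  .seq (mov 10 1) <| .seq rotateCmd <| .seq (reverseCmd 30) <| .seq (mov 10 2) <| .seq cutCmd <|
  .seq (reverseCmd 11) <| .seq (mov 30 10) <| .seq (mov 31 11) concatCmd

theorem wp_flip (hw : n < 2 ^ w) {i j : Fin n} {Ts : List (BinaryTree (Fin n))}
    (he : Env n s) (h1' : s.reg 1 = i) (h2' : s.reg 2 = j) (hs : IsForest s.mem π Ts)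
    (hij : π.SameCycle i j)
    (k : ∀ (s' : State) (t' : ℕ) Ts', IsForest s'.mem (flipPerm π i j) Ts' → Reach 16 Ts Ts' →
      (t' : ℝ) + 200 * forestPot Ts' ≤ t + 200 * forestPot Ts + 6000 * cost n → Q s' t') :
    Wp w (fstLayout n) flipCmd s t Q := by
  simp only [flipCmd, mov, ↓wp_seq, ↓wp_bin, BinOp.eval, he.r4, h1', Nat.sub_zero]
  refine wp_rotate_forest hw (x := i) (Ts := Ts) (he.congr fun a ha => ?_) (by simp) hs
    fun s1 t1 T T' b Us q1 x1 hx hr e1 hp f1 h1 => ?_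
  · dsimp only; rw [Function.update_apply, if_neg (by omega)]
  dsimp only at h1
  have q1' : ∀ a, a < 6 → s1.reg a = s.reg a := fun a ha => by
    rw [q1 a (by omega)]; dsimp only; rw [Function.update_apply, if_neg (by omega)]
  have hnd := f1.holds.nodup_head
  have hj := (f1.same_iff (T := T') (by simp) (x := i) (y := j) (by simp [e1])).1 hij
  refine wp_reverse (he.congr q1') (by omega) x1 f1.holds fun s2 t2 q2 h2 => ?_
  have q2' : ∀ a, a < 6 → s2.reg a = s.reg a := fun a ha => by
    rw [q2 a (by omega), q1' a ha]
  have r4 : s2.reg 4 = 0 := by rw [q2' 4 (by omega), he.r4]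
  simp only [↓wp_seq, ↓wp_bin, BinOp.eval, r4, q2' 2 (by omega), h2', Nat.sub_zero]
  refine wp_cut hw (x := j) (he.congr fun a ha => ?_) (by simp)
    (by rw [inorder_mirror]; simpa using hj) h2.holds
    fun s3 t3 l r q3 x3 l3 e3 h3 => ?_
  · dsimp only; rw [Function.update_apply, if_neg (by omega), q2' a (by omega)]
  dsimp only at h3
  have q3' : ∀ a, a < 6 → s3.reg a = s.reg a := fun a ha => by
    rw [q3 a (by omega)]; dsimp only
    rw [Function.update_apply, if_neg (by omega), q2' a (by omega)]
  have hsw : (BinaryTree.node j .nil r :: l :: Us).Perm (l :: .node j .nil r :: Us) := .swap _ _ _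
  refine wp_reverse (T := l) (Ts := .node j .nil r :: Us) (he.congr q3') (by omega) l3
    (h3.holds.perm hsw) fun s4 t4 q4 h4 => ?_
  have h4' : Transition 1 7 s3.mem t3 (.node j .nil r :: l :: Us) s4.mem t4
    (.node j .nil r :: mirror l :: Us) := (h4.perm_left hsw).perm (.swap _ _ _)
  have q4' : ∀ a, a < 6 → s4.reg a = s.reg a := fun a ha => by
    rw [q4 a (by omega), q3' a ha]
  have r4 : s4.reg 4 = 0 := by rw [q4' 4 (by omega), he.r4]
  have hroot : rootVal (mirror l) = rootVal l := by rcases l with _ | ⟨_, _, _⟩ <;> rfl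
  simp only [↓wp_seq, ↓wp_bin, BinOp.eval, Function.update_apply, Nat.reduceEqDiff, if_false, r4,
    q4 10 (by omega), q4 11 (by omega), x3, l3, Nat.sub_zero]
  refine wp_concat hw (T := .node j .nil r) (U := mirror l) (Ts := Us) (he.congr fun a ha => ?_)
    (by simp) (by simp [hroot]) (by simp) h4'.holds fun s5 t5 V q5 x5 e5 h5 => ?_
  · dsimp only
    rw [Function.update_apply, if_neg (by omega), Function.update_apply, if_neg (by omega),
      q4' a (by omega)]
  dsimp only at h5
  have eT : inorder T' = (inorder r).reverse ++ j :: (inorder l).reverse := by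
    rw [inorder_mirror] at e3
    rw [← List.reverse_reverse (inorder T'), ← e3]; simp
  have eV : inorder V = j :: (inorder r).reverse.reverse ++ (inorder l).reverse := by
    rw [e5, inorder_mirror]; simp [inorder]
  have hfol := f1.follows T' (by simp)
  have hhead : (inorder T').head? = some i := by rw [e1]; rfl
  rw [eT] at hfol hhead
  have hfl := hfol.flip (eT ▸ hnd) hhead
  rw [← eV, ← eT] at hfl
  have hall := ((((hs.holds.wait (t := t) (c := 1) le_rfl).trans h1).trans h2).trans
    (h2.holds.wait (t := t2) (t' := t2 + 1) (c := 1) (by omega))).trans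
    (((h3.trans h4').trans (h4'.holds.wait (t := t4) (t' := t4 + 1 + 1) (c := 2) (by omega))).trans h5)
  have hmemV : ∀ y, y ∈ inorder V ↔ y ∈ inorder T' := by
    intro y; rw [eV, eT]; simp; tauto
  refine k s5 t5 (V :: Us) ⟨h5.holds, fun y => ?_, ?_, ?_⟩ (hall.reach.mono (by omega))
    (hall.mono (D' := 6000) le_rfl (by norm_num)).time
  · have := f1.mem y
    simp only [List.flatMap_cons, List.mem_append, hmemV] at this ⊢
    exact this
  · intro W hW
    simp only [List.mem_cons] at hW
    rcases hW with rfl | hW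
    · exact hfl.1
    · intro y hy
      rw [hfl.2 y fun h => ?_]
      · exact f1.follows W (List.mem_cons_of_mem _ hW) y hy
      · have := f1.holds.nodup
        rw [List.flatMap_cons, List.nodup_append] at this
        exact this.2.2 y h y (List.mem_flatMap.2 ⟨W, hW, hy⟩) rfl
  · rw [h5.counter, h4'.counter, h3.counter, h2.counter, f1.counter,
      numTrees_cons_of_mem (x := i) (by simp [e1]),
      numTrees_cons_of_mem (x := i) ((hmemV i).2 (by simp [e1]))]

end

/-! ### The programs of the operations -/

section
variable {n w : ℕ} {π : Equiv.Perm (Fin n)} {s : State} {t : ℕ} {Q : State → ℕ → Prop}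

/-- A walk from the element in register `x`, with the number of steps in register `k`; the goal is
the answer. -/
def walkOpCmd (inv : Bool) (x k : ℕ) : Cmd :=
  .seq (mov 32 x) <| .seq (mov 33 k) <| .seq (walkCmd inv) (mov 0 10)

/-- The size of the cycle of the element in register 1. -/
def cycleSizeCmd : Cmd := .seq (mov 10 1) <| .seq splayToCmd (.load 0 2 10)

/-- Whether the elements in the registers 1 and 2 are in the same cycle. -/
def sameCycleCmd : Cmd := .seq (mov 35 1) <| .seq (mov 36 2) <| .seq sameCmd (mov 0 37)

/-- The distance from `i` to `j`, which are in the registers 1 and 2: if they are in the same cycle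
and this is written from `i` on, the distance to `j` is the number of the elements before
`j`, which is the size of the left subtree as soon as `j` is splayed. -/
def distanceCmd : Cmd :=
  .seq (mov 35 1) <| .seq (mov 36 2) <| .seq sameCmd <|
  .branch (.eq 37 5)
    (.seq (mov 10 1) <| .seq rotateCmd <| .seq (mov 10 2) <| .seq splayToCmd <|
      .seq (mov 38 4) <| .seq (.branch (.lt 11 0) (.load 38 2 11) .skip) <|
      .seq (mov 1 4) (mov 0 38))
    (mov 1 5)

/-- Exchange the values in the registers 1 and 2. -/
def transposeValuesCmd : Cmd := .seq (mov 35 1) <| .seq (mov 36 2) transposeCmd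

/-- Exchange the values at the positions in the registers 1 and 2. -/
def transposePositionsCmd : Cmd :=
  .seq (mov 32 1) <| .seq (mov 33 5) <| .seq (walkCmd false) <| .seq (mov 35 10) <|
  .seq (mov 32 2) <| .seq (mov 33 5) <| .seq (walkCmd false) <| .seq (mov 36 10) transposeCmd

/-- The program of an operation. -/
def opCmd (o : OpName) : Cmd :=
  .seq (.const 5 1) <| match o with
  | .image => walkOpCmd false 1 5
  | .preimage => walkOpCmd true 2 5
  | .power => walkOpCmd false 1 3
  | .inversePower => walkOpCmd true 2 3
  | .cycleCount => .load 0 5 4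
  | .cycleSize => cycleSizeCmd
  | .sameCycle => sameCycleCmd
  | .distance => distanceCmd
  | .transposeValues => transposeValuesCmd
  | .transposePositions => transposePositionsCmd
  | .flip => flipCmd

/-- What the operation `o` on the forest `Ts` has to achieve with the final state `s` and clock `t`:
the answer, the new forest, and the bounds. -/
def Done (o : Op n) (π : Equiv.Perm (Fin n)) (Ts : List (BinaryTree (Fin n))) (s : State)
    (t : ℕ) : Prop :=
  o.Correct π (s.reg 0) (s.reg 1) ∧ ∃ Ts', IsForest s.mem (o.next π) Ts' ∧ Reach 40 Ts Ts' ∧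
    (t : ℝ) + 200 * forestPot Ts' ≤ 200 * forestPot Ts + 12000 * cost n

theorem Transition.done {o : Op n} {k : ℕ} {D : ℝ} {A : Memory} {Ts Ts' : List (BinaryTree (Fin n))}
    (h : Transition k D A 1 Ts s.mem t Ts') (hf : IsForest s.mem (o.next π) Ts')
    (hc : o.Correct π (s.reg 0) (s.reg 1)) (hk : k ≤ 40) (hD : D ≤ 11999) : Done o π Ts s t := by
  refine ⟨hc, Ts', hf, h.reach.mono hk, ?_⟩
  have h1 := (h.mono hk hD).time
  have h2 := one_le_cost n
  push_cast at h1
  linarith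

theorem wp_walkOp (hw : n < 2 ^ w) {inv : Bool} {x : Fin n} {a b m : ℕ} {o : Op n}
    {Ts : List (BinaryTree (Fin n))} (he : Env n s) (ha : s.reg a = x) (hb : s.reg b = m)
    (hb' : b ≠ 32) (hs : IsForest s.mem π Ts) (hnext : o.next π = π)
    (hc : ∀ inf, o.Correct π (walk π inv m x) inf) :
    Wp w (fstLayout n) (walkOpCmd inv a b) s 1 (Done o π Ts) := by
  simp only [walkOpCmd, mov, ↓wp_seq, ↓wp_bin, BinOp.eval, Function.update_apply, he.r4, ha, hb, hb',
    Nat.sub_zero, if_false, Nat.reduceEqDiff]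
  refine wp_walk hw (inv := inv) (x := x) (m := m) (Ts := Ts) (he.congr fun i hi => ?_) (by simp)
    (by simp) hs fun s1 t1 Ts1 q1 x1 f1 h1 => ?_
  · simp only [Function.update_apply]
    rw [if_neg (by omega), if_neg (by omega)]
  have r4 : s1.reg 4 = 0 := by rw [q1 4 (by omega)]; exact he.r4
  simp only [↓wp_bin, BinOp.eval, r4, x1, Nat.sub_zero]
  refine Transition.done (Ts' := Ts1) (((hs.holds.wait (t := 1) (c := 2) le_rfl).trans h1).trans
    (f1.holds.wait (t := t1) (c := 1) le_rfl)) (by rw [hnext]; exact f1) ?_ (by omega) (by norm_num)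
  simp only [Function.update_apply, if_true]
  exact hc _

theorem Rep.left_size {A : Memory} {x : Fin n} {l r : BinaryTree (Fin n)}
    (h : Rep A (.node x l r)) (hl : l ≠ .nil) : A 2 (rootVal l) = l.numNodes := by
  have key : ∀ (S : SignedTree n) (rev : Bool) (link side : ℕ), Stored A link side S →
      unfold rev S ≠ .nil → A 2 (rootVal (unfold rev S)) = (unfold rev S).numNodes := by
    intro S rev link side hS hne
    rw [rootVal_unfold, numNodes_unfold]
    rcases S with _ | ⟨⟨b, y⟩, L, R⟩
    · exact absurd rfl hne
    · exact hS.2.2.1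
  obtain ⟨S, hS, h⟩ := h
  rcases S with _ | ⟨⟨b, y⟩, L, R⟩
  · simp [unfold] at hS
  · rw [unfold] at hS
    split_ifs at hS
    · simp only [BinaryTree.node.injEq] at hS
      obtain ⟨-, rfl, -⟩ := hS
      exact key _ _ _ _ h.2.2.2.2.2.2 hl
    · simp only [BinaryTree.node.injEq] at hS
      obtain ⟨-, rfl, -⟩ := hS
      exact key _ _ _ _ h.2.2.2.2.2.1 hl

theorem wp_cycleSize (hw : n < 2 ^ w) {o : Op n} {Ts : List (BinaryTree (Fin n))} (he : Env n s)
    (h1' : s.reg 1 = o.i) (hs : IsForest s.mem π Ts) (ho : o.name = .cycleSize) :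
    Wp w (fstLayout n) cycleSizeCmd s 1 (Done o π Ts) := by
  simp only [cycleSizeCmd, mov, ↓wp_seq, ↓wp_bin, BinOp.eval, he.r4, h1', Nat.sub_zero]
  refine wp_splayTo_forest hw (x := o.i) (Ts := Ts) (he.congr fun a ha => ?_) (by simp) hs
    fun s1 t1 T l r Us q1 x1 l1 hx e1 hp f1 h1 => ?_
  · dsimp only; rw [Function.update_apply, if_neg (by omega)]
  have hsize := (f1.holds.rep (.node o.i l r) (by simp)).core.size (by simp)
  simp only [rootVal_node] at hsize
  simp only [↓wp_load, x1, fstLayout, Fin.is_lt, Nat.reduceLT, if_true, true_and, hsize]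
  refine Transition.done (Ts' := .node o.i l r :: Us) (((hs.holds.wait (t := 1) (c := 1) le_rfl).trans
    h1).trans (f1.holds.wait (t := t1) (c := 1) le_rfl)) ?_ ?_ (by omega) (by norm_num)
  · simp only [Op.next, ho]; exact f1
  · simp only [Op.Correct, ho, Function.update_apply, if_true]
    have hset : {y | π.SameCycle o.i y} = ((inorder (.node o.i l r)).toFinset : Set (Fin n)) := by
      ext y
      show π.SameCycle o.i y ↔ _
      rw [f1.same_iff (T := .node o.i l r) (by simp) (by simp [inorder])]
      simp
    rw [hset, Set.ncard_coe_finset, List.toFinset_card_of_nodup f1.holds.nodup_head, length_inorder]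

theorem wp_sameCycle (hw : n < 2 ^ w) {o : Op n} {Ts : List (BinaryTree (Fin n))} (he : Env n s)
    (h1' : s.reg 1 = o.i) (h2' : s.reg 2 = o.j) (hs : IsForest s.mem π Ts)
    (ho : o.name = .sameCycle) :
    Wp w (fstLayout n) sameCycleCmd s 1 (Done o π Ts) := by
  simp only [sameCycleCmd, mov, ↓wp_seq, ↓wp_bin, BinOp.eval, Function.update_apply, he.r4, h1', h2',
    Nat.sub_zero, if_false, Nat.reduceEqDiff]
  refine wp_same hw (i := o.i) (j := o.j) (Ts := Ts) (he.congr fun a ha => ?_) (by simp) (by simp) hs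
    fun s1 t1 Ts1 q1 x1 f1 h1 => ?_
  · simp only [Function.update_apply]; rw [if_neg (by omega), if_neg (by omega)]
  have r4 : s1.reg 4 = 0 := by rw [q1 4 (by omega) (by omega)]; exact he.r4
  simp only [↓wp_bin, BinOp.eval, r4, x1, Nat.sub_zero]
  refine Transition.done (Ts' := Ts1) (((hs.holds.wait (t := 1) (c := 2) le_rfl).trans h1).trans
    (f1.holds.wait (t := t1) (c := 1) le_rfl)) ?_ ?_ (by omega) (by norm_num)
  · simp only [Op.next, ho]; exact f1
  · simp only [Op.Correct, ho, Function.update_apply, if_true]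
    split_ifs with h
    · exact .inl ⟨h, rfl⟩
    · exact .inr ⟨h, rfl⟩

theorem wp_distance (hw : n < 2 ^ w) {o : Op n} {Ts : List (BinaryTree (Fin n))} (he : Env n s)
    (h1' : s.reg 1 = o.i) (h2' : s.reg 2 = o.j) (hs : IsForest s.mem π Ts)
    (ho : o.name = .distance) :
    Wp w (fstLayout n) distanceCmd s 1 (Done o π Ts) := by
  simp only [distanceCmd, mov, ↓wp_seq, ↓wp_bin, BinOp.eval, Function.update_apply, he.r4, h1', h2',
    Nat.sub_zero, if_false, Nat.reduceEqDiff]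
  refine wp_same hw (i := o.i) (j := o.j) (Ts := Ts) (he.congr fun a ha => ?_) (by simp) (by simp) hs
    fun s1 t1 Ts1 q1 x1 f1 h1 => ?_
  · simp only [Function.update_apply]; rw [if_neg (by omega), if_neg (by omega)]
  have q1' : ∀ a, a < 6 → s1.reg a = s.reg a := fun a ha => by
    rw [q1 a (by omega) (by omega)]; simp only [Function.update_apply]
    rw [if_neg (by omega), if_neg (by omega)]
  have he1 : Env n s1 := he.congr q1'
  have h01 := (hs.holds.wait (t := 1) (c := 2) le_rfl).trans h1
  simp only [↓wp_branch, Test.eval, x1, he1.r5]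
  by_cases hc : π.SameCycle o.i o.j
  · rw [if_pos (by simp [hc])]
    simp only [mov, ↓wp_seq, ↓wp_bin, BinOp.eval, he1.r4, q1' 1 (by omega), h1', Nat.sub_zero]
    refine wp_rotate_forest hw (x := o.i) (Ts := Ts1) (he1.congr fun a ha => ?_) (by simp) f1
      fun s2 t2 T T' b Us q2 x2 hx hr e2 hp f2 h2 => ?_
    · dsimp only; rw [Function.update_apply, if_neg (by omega)]
    have q2' : ∀ a, a < 6 → s2.reg a = s.reg a := fun a ha => by
      rw [q2 a (by omega)]; dsimp only; rw [Function.update_apply, if_neg (by omega), q1' a ha]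
    have he2 : Env n s2 := he.congr q2'
    have hj := (f2.same_iff (T := T') (by simp) (x := o.i) (y := o.j) (by simp [e2])).1 hc
    simp only [mov, ↓wp_seq, ↓wp_bin, BinOp.eval, he2.r4, q2' 2 (by omega), h2', Nat.sub_zero]
    refine wp_splayTo hw (x := o.j) (Ts := Us) (he2.congr fun a ha => ?_) (by simp) hj f2.holds
      fun s3 t3 l r q3 x3 l3 e3 h3 => ?_
    · dsimp only; rw [Function.update_apply, if_neg (by omega)]
    have q3' : ∀ a, a < 6 → s3.reg a = s.reg a := fun a ha => by
      rw [q3 a (by omega)]; dsimp only; rw [Function.update_apply, if_neg (by omega), q2' a ha]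
    have he3 : Env n s3 := he.congr q3'
    have f3 := f2.trans h3 (by rw [← e3]; exact .refl _)
    have hfol := f2.follows T' (by simp)
    have hnd := f2.holds.nodup_head
    have hhead : (inorder T').head? = some o.i := by rw [e2]; rfl
    rw [← e3] at hfol hnd hhead
    have hleast := hfol.isLeast hnd hhead
    rw [length_inorder] at hleast
    have hend : ∀ (s4 : State) (t4 : ℕ), s4.reg 0 = l.numNodes → s4.reg 1 = 0 → s4.mem = s3.mem →
        t4 ≤ t3 + 10 → Done o π Ts s4 t4 := by
      intro s4 t4 y0 y1 m4 ht4
      have := ((h01.trans (f1.holds.wait (t := t1) (c := 2) (by omega))).trans h2).trans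
        (((f2.holds.wait (t := t2) (c := 1) le_rfl).trans h3).trans
          (f3.holds.wait (t := t3) (t' := t4) (c := 10) ht4))
      rw [← m4] at this f3
      refine this.done (o := o) ?_ ?_ (by omega) (by norm_num)
      · simp only [Op.next, ho]; exact f3
      · simp only [Op.Correct, ho, y0, y1]
        exact .inl ⟨trivial, hleast⟩
    simp only [↓wp_branch, ↓wp_seq, ↓wp_skip, ↓wp_bin, ↓wp_load, Test.eval, BinOp.eval,
      Function.update_apply, he3.r4, he3.r0, l3, Nat.reduceEqDiff, if_false, Nat.sub_zero,
      decide_eq_true_eq, fstLayout, Nat.reduceLT, if_true, if_false, OfNat.zero_ne_ofNat]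
    rcases l with _ | ⟨y, l1, l2⟩
    · rw [if_neg (by simp)]
      exact hend _ _ (by simp [Function.update_apply]) (by simp [Function.update_apply]) rfl (by omega)
    · have hsz := (f3.holds.rep (.node o.j (.node y l1 l2) r) (by simp)).left_size (by simp)
      rw [if_pos (by simp)]
      refine ⟨by simp, hend _ _ ?_ ?_ rfl (by omega)⟩
      · rw [← hsz]; simp [Function.update_apply]
      · simp [Function.update_apply]
  · rw [if_neg (by simp [hc])]
    simp only [mov, ↓wp_bin, BinOp.eval, he1.r4, he1.r5, Nat.sub_zero]
    refine Transition.done (Ts' := Ts1) (h01.trans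
      (f1.holds.wait (t := t1) (c := 2) (by omega))) ?_ ?_ (by omega) (by norm_num)
    · simp only [Op.next, ho]; exact f1
    · simp only [Op.Correct, ho, Function.update_apply, if_true]
      exact .inr ⟨trivial, fun d hd => hc ⟨d, by simpa using hd⟩⟩

theorem wp_transposeValues (hw : n < 2 ^ w) {o : Op n} {Ts : List (BinaryTree (Fin n))}
    (he : Env n s) (h1' : s.reg 1 = o.i) (h2' : s.reg 2 = o.j) (hs : IsForest s.mem π Ts)
    (ho : o.name = .transposeValues) :
    Wp w (fstLayout n) transposeValuesCmd s 1 (Done o π Ts) := by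
  simp only [transposeValuesCmd, mov, ↓wp_seq, ↓wp_bin, BinOp.eval, Function.update_apply, he.r4, h1',
    h2', Nat.sub_zero, if_false, Nat.reduceEqDiff]
  refine wp_transpose hw (i := o.i) (j := o.j) (Ts := Ts) (he.congr fun a ha => ?_) (by simp) (by simp)
    hs fun s1 t1 Ts1 f1 hr ht => ?_
  · simp only [Function.update_apply]; rw [if_neg (by omega), if_neg (by omega)]
  refine ⟨by simp [Op.Correct, ho], Ts1, by simpa only [Op.next, ho] using f1, hr.mono (by omega), ?_⟩
  have := one_le_cost n
  push_cast at ht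
  linarith

theorem wp_transposePositions (hw : n < 2 ^ w) {o : Op n} {Ts : List (BinaryTree (Fin n))}
    (he : Env n s) (h1' : s.reg 1 = o.i) (h2' : s.reg 2 = o.j) (hs : IsForest s.mem π Ts)
    (ho : o.name = .transposePositions) :
    Wp w (fstLayout n) transposePositionsCmd s 1 (Done o π Ts) := by
  simp only [transposePositionsCmd, mov, ↓wp_seq, ↓wp_bin, BinOp.eval, Function.update_apply, he.r4,
    he.r5, h1', Nat.sub_zero, if_false, Nat.reduceEqDiff, OfNat.ofNat_eq_ofNat]
  refine wp_walk hw (inv := false) (x := o.i) (m := 1) (Ts := Ts) (he.congr fun a ha => ?_) (by simp)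
    (by simp) hs fun s1 t1 Ts1 q1 x1 f1 h1 => ?_
  · simp only [Function.update_apply]; rw [if_neg (by omega), if_neg (by omega)]
  have q1' : ∀ a, a < 6 → s1.reg a = s.reg a := fun a ha => by
    rw [q1 a (by omega)]; simp only [Function.update_apply]; rw [if_neg (by omega), if_neg (by omega)]
  have he1 : Env n s1 := he.congr q1'
  have hz1 : walk π false 1 o.i = π o.i := by simp [walk]
  rw [hz1] at x1
  simp only [↓wp_seq, ↓wp_bin, BinOp.eval, Function.update_apply, he1.r4, he1.r5, q1' 2 (by omega), h2',
    x1, Nat.sub_zero, if_false, Nat.reduceEqDiff]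
  refine wp_walk hw (inv := false) (x := o.j) (m := 1) (Ts := Ts1) (he1.congr fun a ha => ?_) (by simp)
    (by simp) f1 fun s2 t2 Ts2 q2 x2 f2 h2 => ?_
  · simp only [Function.update_apply]
    rw [if_neg (by omega), if_neg (by omega), if_neg (by omega)]
  have q2' : ∀ a, a < 6 → s2.reg a = s.reg a := fun a ha => by
    rw [q2 a (by omega)]; simp only [Function.update_apply]
    rw [if_neg (by omega), if_neg (by omega), if_neg (by omega), q1' a ha]
  have x35 : s2.reg 35 = π o.i := by rw [q2 35 (by omega)]; simp [Function.update_apply]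
  have he2 : Env n s2 := he.congr q2'
  have hz2 : walk π false 1 o.j = π o.j := by simp [walk]
  rw [hz2] at x2
  simp only [↓wp_seq, ↓wp_bin, BinOp.eval, he2.r4, x2, Nat.sub_zero]
  refine wp_transpose hw (i := π o.i) (j := π o.j) (Ts := Ts2) (he2.congr fun a ha => ?_)
    (by simp [x35]) (by simp) f2 fun s3 t3 Ts3 f3 hr ht => ?_
  · dsimp only; rw [Function.update_apply, if_neg (by omega)]
  have h12 := (((hs.holds.wait (t := 1) (c := 2) le_rfl).trans h1).trans
    ((f1.holds.wait (t := t1) (c := 3) le_rfl).trans h2)).trans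
      (f2.holds.wait (t := t2) (c := 1) le_rfl)
  refine ⟨by simp [Op.Correct, ho], Ts3, by simpa only [Op.next, ho] using f3,
    (h12.reach.trans hr).mono (by omega), ?_⟩
  have h3 := (h12.mono (D' := 5010) le_rfl (by norm_num)).time
  have := one_le_cost n
  push_cast at h3 ht
  linarith

theorem wp_op (hw : n < 2 ^ w) (o : Op n) {A : Memory} {Ts : List (BinaryTree (Fin n))}
    (hs : IsForest A π Ts) (ha : o.Admissible w π) :
    Wp w (fstLayout n) (opCmd o.name) (o.callState A) 0 (Done o π Ts) := by
  have hn : 1 < 2 ^ w := lt_of_le_of_lt (by have := o.i.isLt; omega) hw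
  unfold opCmd
  rw [wp_seq, wp_const, Nat.mod_eq_of_lt hn]
  set s : State := ⟨Function.update (o.callState A).reg 5 1, (o.callState A).mem⟩ with hsdef
  have he : Env n s := ⟨by simp [hsdef, Op.callState], by simp [hsdef, Op.callState], by simp [hsdef]⟩
  have h1 : s.reg 1 = o.i := by simp [hsdef, Op.callState]
  have h2 : s.reg 2 = o.j := by simp [hsdef, Op.callState]
  have h3 : s.reg 3 = o.k := by simp [hsdef, Op.callState]
  have hs' : IsForest s.mem π Ts := hs
  clear_value s
  cases ho : o.name
  · exact wp_walkOp hw (x := o.i) (m := 1) he h1 he.r5 (by omega) hs' (by simp [Op.next, ho])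
      (by simp [Op.Correct, ho, walk])
  · exact wp_walkOp hw (x := o.j) (m := 1) he h2 he.r5 (by omega) hs' (by simp [Op.next, ho])
      (by simp [Op.Correct, ho, walk])
  · exact wp_walkOp hw (x := o.i) (m := o.k) he h1 h3 (by omega) hs' (by simp [Op.next, ho])
      (by simp [Op.Correct, ho, walk])
  · exact wp_walkOp hw (x := o.j) (m := o.k) he h2 h3 (by omega) hs' (by simp [Op.next, ho])
      (by simp [Op.Correct, ho, walk])
  · simp only [wp_load, he.r4, fstLayout]
    refine ⟨by simp, ?_⟩
    refine Transition.done (Ts' := Ts) (hs'.holds.wait (t := 1) (c := 1) le_rfl)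
      (by simpa only [Op.next, ho] using hs') ?_ (by omega) (by norm_num)
    simp [Op.Correct, ho, hs'.numCycles]
  · exact wp_cycleSize hw he h1 hs' ho
  · exact wp_sameCycle hw he h1 h2 hs' ho
  · exact wp_distance hw he h1 h2 hs' ho
  · exact wp_transposeValues hw he h1 h2 hs' ho
  · exact wp_transposePositions hw he h1 h2 hs' ho
  · refine wp_flip hw he h1 h2 hs' (ha.2 ho) fun s1 t1 Ts1 f1 hr ht => ?_
    refine ⟨by simp [Op.Correct, ho], Ts1, by simpa only [Op.next, ho] using f1, hr.mono (by omega), ?_⟩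
    have := one_le_cost n
    push_cast at ht
    linarith

/-- Sequences of operations are performed in amortized logarithmic time. -/
theorem serves (hw : n < 2 ^ w) (os : List (Op n)) : ∀ {A : Memory} {F : Forest n}
    {π : Equiv.Perm (Fin n)} {Ts : List (BinaryTree (Fin n))}, IsForest A π Ts → Part F Ts →
    AdmissibleSeq w os π → ∃ T : ℕ, Serves w 40 opCmd A F π os T ∧
      (T : ℝ) ≤ 200 * forestPot Ts + os.length * (12000 * cost n) := by
  induction os with
  | nil =>
    intro A F π Ts _ _ _
    have : 0 ≤ forestPot Ts := List.sum_nonneg fun a ha => by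
      obtain ⟨T, -, rfl⟩ := List.mem_map.1 ha
      exact pot_nonneg T
    exact ⟨0, .done A F π, by simpa using this⟩
  | cons o os ih =>
    intro A F π Ts hs hF ha
    obtain ⟨s, t, hex, hc, Ts', hs', hr, ht⟩ := wp_op hw o hs ha.1
    obtain ⟨F', k, hk, hm, hF'⟩ := hr F hF
    obtain ⟨T, hT, hle⟩ := ih hs' hF' ha.2
    refine ⟨t + T, .step hex hc hm hk (hs'.isFST hF') hT, ?_⟩
    push_cast at ht ⊢
    rw [List.length_cons]
    push_cast
    linarith

end

/-! ### Construction of balanced trees -/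

section
variable {n w : ℕ} {π : Equiv.Perm (Fin n)} {s : State} {t : ℕ} {Q : State → ℕ → Prop}

/-- Put the children of the node in register 22 on the stack: its segment of array 7 begins at the
index in register 16, the node has the index in register 21, and the segments of its children have
the sizes in the registers 20 and 23. Only the latter may be zero. -/
def pushCmd : Cmd :=
  .seq (.const 24 2) <| .seq (.bin .div 25 20 24) <| .seq (.bin .add 25 16 25) <|
  .seq (.load 26 7 25) <| .seq (.store 0 22 26) <|
  .seq (.store 8 15 16) <| .seq (.store 9 15 20) <| .seq (.store 10 15 22) <|
  .seq (.store 11 15 4) <| .seq (.bin .add 15 15 5) <|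
  .branch (.eq 23 4) .skip <|
  .seq (.bin .div 25 23 24) <| .seq (.bin .add 27 21 5) <| .seq (.bin .add 25 27 25) <|
  .seq (.load 26 7 25) <| .seq (.bin .sub 28 15 5) <| .seq (.store 10 28 26) <|
  .seq (.store 8 15 27) <| .seq (.store 9 15 23) <| .seq (.store 10 15 22) <|
  .seq (.store 11 15 5) (.bin .add 15 15 5)

/-- Take a segment of array 7 from the stack and make its middle the root of a tree. The stack has
its height in register 15; an entry consists of the beginning, the size, and the link and the side
of the root, in the arrays 8 to 11. -/
def sproutCmd : Cmd :=
  .seq (.bin .sub 15 15 5) <| .seq (.load 16 8 15) <| .seq (.load 17 9 15) <|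
  .seq (.load 18 10 15) <| .seq (.load 19 11 15) <|
  .seq (.const 20 2) <| .seq (.bin .div 20 17 20) <| .seq (.bin .add 21 16 20) <|
  .seq (.load 22 7 21) <|
  .seq (.store 2 22 17) <| .seq (.store 1 22 18) <| .seq (.store 4 22 19) <|
  .seq (.bin .sub 23 17 20) <| .seq (.bin .sub 23 23 5) <|
  .branch (.eq 20 4) (.store 0 22 0) pushCmd

theorem wp_sprout (hw : n < 2 ^ w) (he : Env n s) {p st sz link side x m r : ℕ}
    (h15 : s.reg 15 = p + 1) (hst : s.mem 8 p = st) (hsz : s.mem 9 p = sz)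
    (hlink : s.mem 10 p = link) (hside : s.mem 11 p = side) (hx : s.mem 7 (st + m) = x)
    (hm : m = sz / 2) (hr : r = sz - m - 1)
    (h7 : ∀ a < sz, s.mem 7 (st + a) < n) (hsz0 : 0 < sz) (hp : p + sz ≤ n) (hn : st + sz ≤ n)
    (hlink' : link ≤ n) (hside' : side ≤ 1)
    (k : ∀ s' t', (∀ i, i < 15 → s'.reg i = s.reg i) →
      s'.reg 15 = (if m = 0 then p else if r = 0 then p + 1 else p + 2) →
      s'.mem 0 x = (if m = 0 then n else s.mem 7 (st + m / 2)) →
      s'.mem 1 x = link → s'.mem 2 x = sz → s'.mem 4 x = side →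
      (m ≠ 0 → s'.mem 8 p = st ∧ s'.mem 9 p = m ∧
        s'.mem 10 p = (if r = 0 then x else s.mem 7 (st + m + 1 + r / 2)) ∧ s'.mem 11 p = 0) →
      (r ≠ 0 → s'.mem 8 (p + 1) = st + m + 1 ∧ s'.mem 9 (p + 1) = r ∧
        s'.mem 10 (p + 1) = x ∧ s'.mem 11 (p + 1) = 1) →
      (∀ c v, ¬ (c < 5 ∧ c ≠ 3 ∧ v = x) → ¬ (8 ≤ c ∧ c ≤ 11 ∧ p ≤ v) → s'.mem c v = s.mem c v) →
      t' ≤ t + 40 → Q s' t') :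
    Wp w (buildLayout n w) sproutCmd s t Q := by
  have hxn : x < n := hx ▸ h7 m (by omega)
  have hpn : p < n := by omega
  -- If words have one bit, then the constant 2 is 0, but then `sz = 1`, and `1 / 0 = 0` is right.
  have hdiv : sz / (2 % 2 ^ w) = m := by
    rcases Nat.lt_or_ge 1 w with h | h
    · rw [hm, Nat.mod_eq_of_lt (by calc 2 < 2 ^ 2 := by norm_num
                                        _ ≤ 2 ^ w := Nat.pow_le_pow_right (by omega) h)]
    · have h1 : n ≤ 1 := by
        have : 2 ^ w ≤ 2 ^ 1 := Nat.pow_le_pow_right (by omega) h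
        omega
      have h2 : sz = 1 := by omega
      have : w = 1 := by
        rcases Nat.eq_zero_or_pos w with rfl | h'
        · simp at hw; omega
        · omega
      subst this
      simp [hm, h2]
  have hsm : (st + m) % 2 ^ w = st + m := Nat.mod_eq_of_lt (by omega)
  have hlen : st + m < n := by omega
  have hb2 := lt_two_pow_clog (n := n) (m := sz) (by omega)
  have hb1 := lt_two_pow_clog (n := n) hlink'
  simp only [sproutCmd, ↓wp_seq, ↓wp_bin, ↓wp_load, ↓wp_const, ↓wp_store, ↓wp_branch, Test.eval, BinOp.eval,
    Function.update_apply, h15, he.r5, he.r4, he.r0, Nat.add_sub_cancel, hst, hsz, hlink, hside, hdiv, hsm, hx,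
    buildLayout, fstLayout, Nat.reduceLT, Nat.reduceEqDiff, if_true, if_false, true_and, hlen, hpn, hxn,
    hb1, hb2, true_or, or_true, false_or, or_false, Nat.lt_irrefl, ← hr, decide_eq_true_eq, setCell_apply,
    OfNat.ofNat_ne_zero, OfNat.zero_ne_ofNat, false_and, and_false, Nat.pow_one,
    Nat.lt_succ_of_le hside', lt_two_pow_clog (le_refl n)]
  split_ifs with h0
  · refine k _ _ (fun i hi => ?_) (by simp [Function.update_apply, h0]) (by simp [setCell_apply, h0])
      (by simp [setCell_apply]) (by simp [setCell_apply]) (by simp [setCell_apply])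
      (fun h => absurd h0 h) (fun h => by omega) (fun c v h1 h2 => ?_) (by omega)
    · simp only [Function.update_apply]
      repeat rw [if_neg (by omega)]
    · simp only [setCell_apply]
      repeat rw [if_neg (by omega)]
  have h2w : 2 % 2 ^ w = 2 := Nat.mod_eq_of_lt (by omega)
  have hsm2 : (st + m / 2) % 2 ^ w = st + m / 2 := Nat.mod_eq_of_lt (by omega)
  have hl2 : st + m / 2 < n := by omega
  have hyn : s.mem 7 (st + m / 2) < n := h7 (m / 2) (by omega)
  have hp1 : (p + 1) % 2 ^ w = p + 1 := Nat.mod_eq_of_lt (by omega)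
  have hstw : st < 2 ^ w := by omega
  have hmw : m < 2 ^ w := by omega
  have hxw : x < 2 ^ w := by omega
  have h0w : 0 < 2 ^ w := by omega
  have hyb := lt_two_pow_clog (n := n) hyn.le
  simp only [pushCmd, ↓wp_seq, ↓wp_bin, ↓wp_load, ↓wp_const, ↓wp_store, ↓wp_branch, ↓wp_skip, Test.eval,
    BinOp.eval, Function.update_apply, h2w, he.r5, he.r4, he.r0, hsm2, hl2, Nat.reduceLT,
    Nat.reduceEqDiff, if_true, if_false, true_and, hpn, hxn, hyb, hp1, hstw, hmw, hxw, h0w,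
    true_or, or_true, false_or, or_false, Nat.lt_irrefl, decide_eq_true_eq, setCell_apply,
    OfNat.ofNat_ne_zero, OfNat.zero_ne_ofNat, OfNat.ofNat_ne_one, false_and, and_false]
  split_ifs with hr0
  · refine k _ _ (fun i hi => ?_) (by simp [Function.update_apply, h0, hr0])
      (by simp [setCell_apply, h0]) (by simp [setCell_apply]) (by simp [setCell_apply])
      (by simp [setCell_apply]) (fun _ => by simp [setCell_apply, hr0]) (fun h => absurd hr0 h)
      (fun c v h1 h2 => ?_) (by omega)
    · simp only [Function.update_apply]
      repeat rw [if_neg (by omega)]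
    · simp only [setCell_apply]
      repeat rw [if_neg (by omega)]
  have hsm1 : (st + m + 1) % 2 ^ w = st + m + 1 := Nat.mod_eq_of_lt (by omega)
  have hsr : (st + m + 1 + r / 2) % 2 ^ w = st + m + 1 + r / 2 := Nat.mod_eq_of_lt (by omega)
  have hl3 : st + m + 1 + r / 2 < n := by omega
  have hzn : s.mem 7 (st + m + 1 + r / 2) < n := by
    have := h7 (m + 1 + r / 2) (by omega)
    rwa [show st + (m + 1 + r / 2) = st + m + 1 + r / 2 by omega] at this
  have hzw : s.mem 7 (st + m + 1 + r / 2) < 2 ^ w := by omega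
  have hp2 : (p + 1 + 1) % 2 ^ w = p + 2 := Nat.mod_eq_of_lt (by omega)
  have hpn1 : p + 1 < n := by omega
  have hsw : st + m + 1 < 2 ^ w := by omega
  have hrw : r < 2 ^ w := by omega
  have h1w : 1 < 2 ^ w := by omega
  simp only [hsm1, hsr, hl3, hp2, hpn1, hpn, hxn, hsw, hrw, hzw, h1w, hxw, if_true, if_false, true_and,
    Nat.add_sub_cancel, hr0]
  refine k _ _ (fun i hi => ?_) (by simp [Function.update_apply, h0, hr0])
      (by simp [setCell_apply, h0]) (by simp [setCell_apply]) (by simp [setCell_apply])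
      (by simp [setCell_apply]) (fun _ => by simp [setCell_apply, hr0])
      (fun h => by simp [setCell_apply]) (fun c v h1 h2 => ?_) (by omega)
  · simp only [Function.update_apply]
    repeat rw [if_neg (by omega)]
  · simp only [setCell_apply]
    repeat rw [if_neg (by omega)]

end

section
variable {n w : ℕ} {π : Equiv.Perm (Fin n)} {s : State} {t : ℕ} {Q : State → ℕ → Prop}

/-- Halving makes the potential of a balanced tree linear in its size. -/
theorem logb_halves {m r c : ℕ} (hm : m = c / 2) (hr : r = c - m - 1) (hc : 0 < c) :
    Real.logb 2 c + Real.logb 2 (c + 1 : ℕ) ≤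
      2 + Real.logb 2 (m + 1 : ℕ) + Real.logb 2 (r + 1 : ℕ) := by
  have h4 : Real.logb 2 4 = 2 := by
    rw [show (4 : ℝ) = 2 ^ (2 : ℕ) by norm_num, Real.logb_pow]; simp
  have hle : c * (c + 1) ≤ 4 * (m + 1) * (r + 1) := by
    rcases Nat.even_or_odd' c with ⟨d, rfl | rfl⟩
    · obtain ⟨e, rfl⟩ : ∃ e, d = e + 1 := ⟨d - 1, by omega⟩
      obtain rfl : m = e + 1 := by omega
      obtain rfl : r = e := by omega
      nlinarith
    · obtain rfl : m = d := by omega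
      obtain rfl : r = m := by omega
      nlinarith
  have hc' : (0 : ℝ) < c := by exact_mod_cast hc
  have hle' : (c : ℝ) * (c + 1 : ℕ) ≤ 4 * (m + 1 : ℕ) * (r + 1 : ℕ) := by exact_mod_cast hle
  have h1 : Real.logb 2 ((c : ℝ) * (c + 1 : ℕ)) ≤ Real.logb 2 (4 * (m + 1 : ℕ) * (r + 1 : ℕ)) :=
    Real.logb_le_logb_of_le (by norm_num) (by positivity) hle'
  rw [Real.logb_mul hc'.ne' (by positivity), Real.logb_mul (by positivity) (by positivity),
    Real.logb_mul (by norm_num) (by positivity), h4] at h1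
  exact h1

/-- Make balanced trees of the segments on the stack. -/
def growCmd : Cmd := .loop (.lt 4 15) sproutCmd

/-- The segment on top of the stack is turned into a tree, and the stack below it is not touched.
Each entry of the stack has a nonempty segment, and they are disjoint, so that there is room. -/
theorem wp_grow (hw : n < 2 ^ w) : ∀ (c : ℕ) {s : State} {t p st link side : ℕ} {seg : List (Fin n)},
    Env n s → s.reg 15 = p + 1 → s.mem 8 p = st → s.mem 9 p = c → s.mem 10 p = link →
    s.mem 11 p = side → seg.length = c →
    (∀ a (h : a < seg.length), s.mem 7 (st + a) = seg[a]) → seg.Nodup →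
    (∀ x ∈ seg, s.mem 3 x = 0) → p + c ≤ n → st + c ≤ n → link ≤ n → side ≤ 1 → 0 < c →
    (∀ s' t' (T : SignedTree n), (∀ i, i < 15 → s'.reg i = s.reg i) → s'.reg 15 = p →
      inorder (unfold false T) = seg → rootOr n T = s.mem 7 (st + c / 2) →
      Stored s'.mem link side T →
      pot (unfold false T) + Real.logb 2 (c + 1 : ℕ) ≤ 2 * c →
      (∀ k v, ¬ (k < 5 ∧ k ≠ 3 ∧ ∃ y ∈ seg, v = (y : ℕ)) → ¬ (8 ≤ k ∧ k ≤ 11 ∧ p ≤ v) →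
        s'.mem k v = s.mem k v) → t' ≤ t + 41 * c → Wp w (buildLayout n w) growCmd s' t' Q) →
    Wp w (buildLayout n w) growCmd s t Q := by
  intro c
  induction c using Nat.strong_induction_on with
  | h c ih =>
  intro s t p st link side seg he h15 hst hsz hlink hside hlen h7 hnd h3 hp hn hlink' hside' hc k
  obtain ⟨m, hm⟩ : ∃ m, m = c / 2 := ⟨_, rfl⟩
  obtain ⟨r, hr⟩ : ∃ r, r = c - m - 1 := ⟨_, rfl⟩
  have hmlt : m < seg.length := by omega
  have hx := h7 m hmlt
  set x := seg[m] with hxdef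
  have hxm : x ∈ seg := List.getElem_mem _
  rw [growCmd, wp_loop, if_pos (by simp [Test.eval, h15, he.r4])]
  refine wp_sprout hw he h15 hst hsz hlink hside hx hm hr
    (fun a ha => by rw [h7 a (by omega)]; exact Fin.is_lt _) hc hp hn hlink' hside'
    fun s1 t1 q1 x1 a0 a1 a2 a4 aL aR fr ht1 => ?_
  have he1 : Env n s1 := he.congr fun i hi => q1 i (by omega)
  have a3 : s1.mem 3 x = 0 := by rw [fr 3 x (by simp) (by omega), h3 x hxm]
  have hsplit : seg = seg.take m ++ x :: seg.drop (m + 1) := by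
    rw [hxdef, ← List.drop_eq_getElem_cons hmlt, List.take_append_drop]
  have hbal := logb_halves hm hr hc
  rw [← hm] at k
  by_cases h0 : m = 0
  · have hc1 : c = 1 := by omega
    have hr0 : r = 0 := by omega
    have htake : seg.take m = [] := by simp [h0]
    have hdrop : seg.drop (m + 1) = [] := by
      rw [List.drop_eq_nil_iff]; omega
    rw [htake, hdrop] at hsplit
    refine k s1 t1 (.node (false, x) .nil .nil) q1 (by rw [x1, if_pos h0]) ?_ (by rw [hx]; rfl) ?_ ?_ ?_
      (by omega)
    · rw [hsplit]; rfl
    · exact ⟨by rw [a0, if_pos h0]; rfl, a1, by rw [a2]; simp [hc1], a3, a4, trivial, trivial⟩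
    · simp [unfold, pot, hc1]
    · intro k v h1 h2
      exact fr k v (fun h => h1 ⟨h.1, h.2.1, x, hxm, h.2.2⟩) h2
  have hndd : seg.Nodup := hnd
  rw [hsplit] at hndd
  have hLnd : (seg.take m).Nodup := hnd.sublist (List.take_sublist _ _)
  have hRnd : (seg.drop (m + 1)).Nodup := hnd.sublist (List.drop_sublist _ _)
  have hxL : x ∉ seg.take m := fun h => by
    rw [List.nodup_append] at hndd; exact hndd.2.2 x h x (by simp) rfl
  have hxR : x ∉ seg.drop (m + 1) := fun h => by
    rw [List.nodup_append, List.nodup_cons] at hndd; exact hndd.2.1.1 h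
  have hLR : ∀ y ∈ seg.take m, y ∉ seg.drop (m + 1) := fun y h h' => by
    rw [List.nodup_append] at hndd; exact hndd.2.2 y h y (by simp [h']) rfl
  have hLm : ∀ y ∈ seg.take m, y ∈ seg := fun y h => List.mem_of_mem_take h
  have hRm : ∀ y ∈ seg.drop (m + 1), y ∈ seg := fun y h => List.mem_of_mem_drop h
  have hLlen : (seg.take m).length = m := by simp; omega
  have hRlen : (seg.drop (m + 1)).length = r := by simp; omega
  rw [if_neg h0] at x1 a0
  obtain ⟨l1, l2, l3, l4⟩ := aL h0
  have hinL : ∀ a (h : a < (seg.take m).length), s1.mem 7 (st + a) = (seg.take m)[a] := fun a h => by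
    rw [fr 7 _ (by simp) (by simp), h7 a (by omega)]; simp
  have hxval : ∀ y ∈ seg, (y : ℕ) = x → y = x := fun y _ h => Fin.ext h
  by_cases hr0 : r = 0
  · rw [if_pos hr0] at x1 l3
    have hdrop : seg.drop (m + 1) = [] := List.eq_nil_of_length_eq_zero (by rw [hRlen, hr0])
    refine ih m (by omega) (seg := seg.take m) he1 x1 l1 l2 l3 l4 hLlen hinL hLnd ?_ (by omega)
      (by omega) x.isLt.le (by omega) (by omega)
      fun s2 t2 L q2 x2 iL rL cL pL f2 ht2 => ?_
    · intro y hy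
      rw [fr 3 _ (by simp) (by omega), h3 y (hLm y hy)]
    have hfx : ∀ k < 5, s2.mem k x = s1.mem k x := fun k hk =>
      f2 k x (fun h => by obtain ⟨-, -, y, hy, h⟩ := h; exact hxL (Fin.ext h ▸ hy)) (by omega)
    have hnum : L.numNodes = m := by rw [← length_inorder_unfold false, iL, hLlen]
    refine k s2 t2 (.node (false, x) L .nil) (fun i hi => by rw [q2 i hi, q1 i hi]) x2 ?_
      (by rw [hx]; rfl) ?_ ?_ ?_ (by omega)
    · rw [hsplit, hdrop]; simp [unfold, inorder, iL]
    · refine ⟨?_, by rw [hfx 1 (by omega), a1], ?_, by rw [hfx 3 (by omega), a3]; rfl,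
        by rw [hfx 4 (by omega), a4], cL, trivial⟩
      · rw [hfx 0 (by omega), a0]
        rcases L with _ | ⟨⟨b, y⟩, L1, L2⟩
        · simp at hnum; omega
        · rw [rootOr_node, ← fr 7 _ (by simp) (by simp), ← rL]; rfl
      · rw [hfx 2 (by omega), a2]
        simp [hnum]; omega
    · have hcm : c = m + 1 := by omega
      simp only [unfold, Bool.xor_false, Bool.false_eq_true, if_false, pot, BinaryTree.numNodes,
        numNodes_unfold, hnum]
      have : Real.logb 2 ((0 + 1 : ℕ) : ℝ) = 0 := by simp
      rw [hr0, this] at hbal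
      have hcm' : (c : ℝ) = m + 1 := by exact_mod_cast hcm
      have e1 : ((m + 0 + 1 : ℕ) : ℝ) = c := by push_cast; linarith
      rw [e1]
      linarith
    · intro k v h1 h2
      rw [f2 k v (fun h => h1 ⟨h.1, h.2.1, h.2.2.choose, hLm _ h.2.2.choose_spec.1,
        h.2.2.choose_spec.2⟩) h2, fr k v (fun h => h1 ⟨h.1, h.2.1, x, hxm, h.2.2⟩) h2]
  · rw [if_neg hr0] at x1 l3
    obtain ⟨r1, r2, r3, r4⟩ := aR hr0
    have hzseg : s.mem 7 (st + m + 1 + r / 2) < n := by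
      have := h7 (m + 1 + r / 2) (by omega)
      rw [show st + m + 1 + r / 2 = st + (m + 1 + r / 2) by omega, this]
      exact Fin.is_lt _
    refine ih r (by omega) (seg := seg.drop (m + 1)) he1 x1 r1 r2 r3 r4 hRlen ?_ hRnd ?_ (by omega)
      (by omega) x.isLt.le (by omega) (by omega)
      fun s2 t2 R q2 x2 iR rR cR pR f2 ht2 => ?_
    · intro a ha
      rw [fr 7 _ (by simp) (by simp), show st + m + 1 + a = st + (m + 1 + a) by omega,
        h7 (m + 1 + a) (by omega)]
      simp
    · intro y hy
      rw [fr 3 _ (by simp) (by omega), h3 y (hRm y hy)]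
    have he2 : Env n s2 := he1.congr fun i hi => q2 i (by omega)
    have hst2 : ∀ k, 8 ≤ k → k ≤ 11 → s2.mem k p = s1.mem k p := fun k h1 h2 =>
      f2 k p (by omega) (by omega)
    have h72 : ∀ v, s2.mem 7 v = s1.mem 7 v := fun v => f2 7 v (by simp) (by simp)
    refine ih m (by omega) (seg := seg.take m) he2 x2 (by rw [hst2 8 (by omega) (by omega), l1])
      (by rw [hst2 9 (by omega) (by omega), l2]) (by rw [hst2 10 (by omega) (by omega), l3])
      (by rw [hst2 11 (by omega) (by omega), l4]) hLlen
      (fun a ha => by rw [h72, hinL a ha]) hLnd ?_ (by omega)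
      (by omega) hzseg.le (by omega) (by omega)
      fun s3 t3 L q3 x3 iL rL cL pL f3 ht3 => ?_
    · intro y hy
      rw [f2 3 _ (by simp) (by omega), fr 3 _ (by simp) (by omega), h3 y (hLm y hy)]
    have hfx : ∀ k < 5, s3.mem k x = s1.mem k x := fun k hk => by
      rw [f3 k x (fun h => by obtain ⟨-, -, y, hy, h⟩ := h; exact hxL (Fin.ext h ▸ hy)) (by omega),
        f2 k x (fun h => by obtain ⟨-, -, y, hy, h⟩ := h; exact hxR (Fin.ext h ▸ hy)) (by omega)]
    have hnumL : L.numNodes = m := by rw [← length_inorder_unfold false, iL, hLlen]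
    have hnumR : R.numNodes = r := by rw [← length_inorder_unfold false, iR, hRlen]
    have hrootL : ∀ d, rootOr d L = s.mem 7 (st + m / 2) := fun d => by
      rcases L with _ | ⟨⟨b, y⟩, L1, L2⟩
      · simp at hnumL; omega
      · rw [rootOr_node, ← fr 7 _ (by simp) (by simp), ← h72, ← rL]; rfl
    have hrootR : ∀ d, rootOr d R = s.mem 7 (st + m + 1 + r / 2) := fun d => by
      rcases R with _ | ⟨⟨b, y⟩, L1, L2⟩
      · simp at hnumR; omega
      · rw [rootOr_node, ← fr 7 _ (by simp) (by simp), ← rR]; rfl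
    refine k s3 t3 (.node (false, x) L R) (fun i hi => by rw [q3 i hi, q2 i hi, q1 i hi]) x3 ?_
      (by rw [hx]; rfl) ?_ ?_ ?_ (by omega)
    · rw [hsplit]; simp [unfold, inorder, iL, iR]
    · refine ⟨?_, by rw [hfx 1 (by omega), a1], ?_, by rw [hfx 3 (by omega), a3]; rfl,
        by rw [hfx 4 (by omega), a4], by rw [hrootR]; exact cL, ?_⟩
      · rw [hfx 0 (by omega), a0, hrootL]
      · rw [hfx 2 (by omega), a2]
        simp [hnumL, hnumR]; omega
      · refine cR.congr_matrix fun k hk y hy => f3 k y (fun h => ?_) (by omega)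
        obtain ⟨-, -, z, hz, h⟩ := h
        obtain rfl : y = z := Fin.ext h
        refine hLR y hz ?_
        rw [← iR]
        exact (perm_inorder_unfold _ _).mem_iff.2 hy
    · have hcm : c = m + r + 1 := by omega
      simp only [unfold, Bool.xor_false, Bool.false_eq_true, if_false, pot, BinaryTree.numNodes,
        numNodes_unfold, hnumL, hnumR]
      have hcm' : (c : ℝ) = m + r + 1 := by exact_mod_cast hcm
      rw [← hcm]
      linarith
    · intro k v h1 h2
      rw [f3 k v (fun h => h1 ⟨h.1, h.2.1, h.2.2.choose, hLm _ h.2.2.choose_spec.1,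
        h.2.2.choose_spec.2⟩) h2, f2 k v (fun h => h1 ⟨h.1, h.2.1, h.2.2.choose,
        hRm _ h.2.2.choose_spec.1, h.2.2.choose_spec.2⟩) (by omega),
        fr k v (fun h => h1 ⟨h.1, h.2.1, x, hxm, h.2.2⟩) h2]

end

/-! ### Construction of the forest -/

section
variable {n w : ℕ} {π : Equiv.Perm (Fin n)} {s : State} {t : ℕ} {Q : State → ℕ → Prop}

/-- The cycle of `i`, written from `i` on. -/
noncomputable def orbit (π : Equiv.Perm (Fin n)) (i : Fin n) : List (Fin n) :=
  (List.range (Function.minimalPeriod π i)).map fun k => π^[k] i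

@[simp] theorem length_orbit (i : Fin n) :
    (orbit π i).length = Function.minimalPeriod π i := by simp [orbit]

@[simp] theorem getElem_orbit (i : Fin n) {a : ℕ} (h : a < (orbit π i).length) :
    (orbit π i)[a] = π^[a] i := by simp [orbit]

theorem nodup_orbit (i : Fin n) : (orbit π i).Nodup := by
  have := Function.nodup_periodicOrbit (f := π) (x := i)
  rwa [Function.periodicOrbit, Cycle.nodup_coe_iff] at this

theorem minimalPeriod_pos (i : Fin n) : 0 < Function.minimalPeriod π i :=
  Function.minimalPeriod_pos_of_mem_periodicPts (π.injective.mem_periodicPts i)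

theorem minimalPeriod_le (i : Fin n) : Function.minimalPeriod π i ≤ n := by
  have := (nodup_orbit (π := π) i).length_le_card
  simpa using this

theorem mem_orbit_self (i : Fin n) : i ∈ orbit π i :=
  List.mem_iff_getElem.2 ⟨0, by simpa using minimalPeriod_pos i, by simp⟩

theorem follows_orbit (i : Fin n) : Follows (orbit π i) π := by
  intro x hx
  obtain ⟨a, ha, rfl⟩ := List.mem_iff_getElem.1 hx
  rw [List.formPerm_apply_getElem _ (nodup_orbit i)]
  simp only [getElem_orbit, length_orbit, Function.iterate_mod_minimalPeriod_eq,
    Function.iterate_succ_apply']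

/-- Write the cycle of the element in register 10 into array 7, and its length into register 13. -/
def listCmd : Cmd :=
  .seq (mov 12 10) <| .seq (mov 13 4) <| .seq (mov 14 5) <|
  .loop (.eq 14 5) <| .seq (.store 7 13 12) <| .seq (.bin .add 13 13 5) <|
    .seq (.load 12 6 12) (.branch (.eq 12 10) (mov 14 4) .skip)

theorem wp_list (hw : n < 2 ^ w) {i : Fin n} (he : Env n s) (h10 : s.reg 10 = i)
    (h6 : ∀ x : Fin n, s.mem 6 x = π x)
    (k : ∀ s' t', (∀ r, r < 12 → s'.reg r = s.reg r) → s'.reg 13 = Function.minimalPeriod π i →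
      (∀ c, c ≠ 7 → s'.mem c = s.mem c) →
      (∀ a (h : a < (orbit π i).length), s'.mem 7 a = ((orbit π i)[a] : ℕ)) →
      t' ≤ t + 6 * Function.minimalPeriod π i + 4 → Q s' t') :
    Wp w (buildLayout n w) listCmd s t Q := by
  have hpos := minimalPeriod_pos (π := π) i
  have hle := minimalPeriod_le (π := π) i
  set c := Function.minimalPeriod π i with hc
  have key : ∀ (d : ℕ) (a : ℕ) (s1 : State) (t1 : ℕ), a + d + 1 = c →
      (∀ r, r < 12 → s1.reg r = s.reg r) → s1.reg 12 = (π^[a] i : Fin n) → s1.reg 13 = a →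
      s1.reg 14 = 1 → (∀ c, c ≠ 7 → s1.mem c = s.mem c) →
      (∀ b, b < a → s1.mem 7 b = (π^[b] i : Fin n)) → t1 ≤ t + 3 + 6 * a →
      Wp w (buildLayout n w) (.loop (.eq 14 5) <| .seq (.store 7 13 12) <|
        .seq (.bin .add 13 13 5) <| .seq (.load 12 6 12) (.branch (.eq 12 10) (mov 14 4) .skip))
        s1 t1 Q := by
    intro d
    induction d with
    | zero =>
      intro a s1 t1 had q1 x12 x13 x14 m1 y1 ht1
      have he1 : Env n s1 := he.congr fun r hr => q1 r (by omega)
      have hnext : (π (π^[a] i)) = i := by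
        rw [show π (π^[a] i) = π^[a + 1] i from (Function.iterate_succ_apply' _ _ _).symm,
          show a + 1 = c by omega, hc, Function.iterate_minimalPeriod]
      have hxw : ((π^[a] i : Fin n) : ℕ) < 2 ^ w := lt_trans (Fin.is_lt _) hw
      have han : a < n := by omega
      rw [wp_loop, if_pos (by simp [Test.eval, x14, he1.r5])]
      simp only [mov, ↓wp_seq, ↓wp_store, ↓wp_bin, ↓wp_load, ↓wp_branch, ↓wp_skip, Test.eval, BinOp.eval,
        Function.update_apply, x12, x13, he1.r4, he1.r5, q1 10 (by omega), h10, buildLayout,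
        Nat.reduceLT, Nat.reduceEqDiff, if_true, if_false, true_and, hxw, han, Fin.is_lt,
        setCell_apply, m1 6 (by omega), h6, hnext, false_and, decide_true,
        Nat.sub_zero]
      rw [wp_loop, if_neg (by simp [Test.eval, he1.r5])]
      have hmod : (a + 1) % 2 ^ w = c := by rw [Nat.mod_eq_of_lt (by omega)]; omega
      refine k _ _ ?_ ?_ ?_ ?_ (by omega)
      · intro r hr
        simp only [Function.update_apply]
        rw [if_neg (by omega), if_neg (by omega), if_neg (by omega), q1 r hr]
      · simp [Function.update_apply, hmod]
      · intro b hb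
        funext v
        simp only [setCell_apply]
        rw [if_neg (by omega), m1 b hb]
      · intro b hb
        simp only [setCell_apply, getElem_orbit]
        simp only [length_orbit] at hb
        have hb' : b < c := hb
        split_ifs with h
        · rw [h.2]
        · exact y1 b (by simp only [true_and] at h; omega)
    | succ d ih =>
      intro a s1 t1 had q1 x12 x13 x14 m1 y1 ht1
      have he1 : Env n s1 := he.congr fun r hr => q1 r (by omega)
      have hnext : ((π (π^[a] i) : Fin n) : ℕ) ≠ i := by
        rw [show π (π^[a] i) = π^[a + 1] i from (Function.iterate_succ_apply' _ _ _).symm, Ne,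
          Fin.val_inj]
        exact Function.not_isPeriodicPt_of_pos_of_lt_minimalPeriod (by omega) (by omega)
      have hxw : ((π^[a] i : Fin n) : ℕ) < 2 ^ w := lt_trans (Fin.is_lt _) hw
      have han : a < n := by omega
      have hmod : (a + 1) % 2 ^ w = a + 1 := Nat.mod_eq_of_lt (by omega)
      rw [wp_loop, if_pos (by simp [Test.eval, x14, he1.r5])]
      simp only [mov, ↓wp_seq, ↓wp_store, ↓wp_bin, ↓wp_load, ↓wp_branch, ↓wp_skip, Test.eval, BinOp.eval,
        Function.update_apply, x12, x13, he1.r4, he1.r5, q1 10 (by omega), h10, buildLayout,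
        Nat.reduceLT, Nat.reduceEqDiff, if_true, if_false, true_and, hxw, han, Fin.is_lt,
        setCell_apply, m1 6 (by omega), h6, hnext, false_and, decide_false,
        Bool.false_eq_true]
      refine ih (a + 1) _ _ (by omega) ?_ ?_ ?_ ?_ ?_ ?_ (by omega)
      · intro r hr
        simp only [Function.update_apply]
        rw [if_neg (by omega), if_neg (by omega), q1 r hr]
      · simp [Function.update_apply, ← Function.iterate_succ_apply']
      · simp [Function.update_apply, hmod]
      · simp [Function.update_apply, x14]
      · intro b hb
        funext v
        simp only [setCell_apply]
        rw [if_neg (by omega), m1 b hb]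
      · intro b hb
        simp only [setCell_apply]
        split_ifs with h
        · rw [h.2]
        · exact y1 b (by simp only [true_and] at h; omega)
  simp only [listCmd, mov, ↓wp_seq, ↓wp_bin, BinOp.eval, Function.update_apply, he.r4, he.r5, h10,
    Nat.sub_zero, Nat.reduceEqDiff, if_false]
  refine key (c - 1) 0 _ _ (by omega) ?_ ?_ ?_ ?_ (fun _ _ => rfl) (fun _ h => by omega) (by omega)
  · intro r hr
    simp only [Function.update_apply]
    rw [if_neg (by omega), if_neg (by omega), if_neg (by omega)]
  · simp
  · simp
  · simp

theorem Stored.size_ne_zero {A : Memory} {T : SignedTree n} : ∀ {link side : ℕ},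
    Stored A link side T → ∀ x ∈ elems T, A 2 x ≠ 0 := by
  induction T with
  | nil => intro _ _ _ x hx; simp at hx
  | node v l r hl hr =>
    obtain ⟨b, y⟩ := v
    intro link side h x hx
    simp only [elems_node, List.mem_cons, List.mem_append] at hx
    rcases hx with rfl | hx | hx
    · rw [h.2.2.1]; simp
    · exact hl h.2.2.2.2.2.1 x hx
    · exact hr h.2.2.2.2.2.2 x hx

/-- Build the tree of the cycle of the element in register 10. -/
def cycleCmd : Cmd :=
  .seq listCmd <| .seq (.store 8 4 4) <| .seq (.store 9 4 13) <| .seq (.store 10 4 0) <|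
  .seq (.store 11 4 4) <| .seq (mov 15 5) <| .seq growCmd <|
  .seq (.load 6 5 4) <| .seq (.bin .add 6 6 5) (.store 5 4 6)

theorem wp_cycle (hw : n < 2 ^ w) {i : Fin n} (he : Env n s) (h10 : s.reg 10 = i)
    (h6 : ∀ x : Fin n, s.mem 6 x = π x) (h3 : ∀ x : Fin n, s.mem 3 x = 0) (h5 : s.mem 5 0 < n)
    (k : ∀ s' t' T, (∀ r, r ≠ 6 → r < 12 → s'.reg r = s.reg r) → Rep s'.mem T →
      inorder T = orbit π i → pot T ≤ 2 * (orbit π i).length → s'.mem 5 0 = s.mem 5 0 + 1 →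
      (∀ x ∈ orbit π i, s'.mem 2 x ≠ 0) →
      (∀ c v, c < 7 → c ≠ 5 → ¬ (c < 5 ∧ c ≠ 3 ∧ ∃ y ∈ orbit π i, v = (y : ℕ)) →
        s'.mem c v = s.mem c v) →
      t' ≤ t + 47 * (orbit π i).length + 14 → Q s' t') :
    Wp w (buildLayout n w) cycleCmd s t Q := by
  have hpos := minimalPeriod_pos (π := π) i
  have hle := minimalPeriod_le (π := π) i
  have hn : 0 < n := by omega
  have hw0 : 0 < 2 ^ w := by omega
  rw [cycleCmd, wp_seq]
  refine wp_list hw he h10 h6 fun s1 t1 q1 x1 m1 y1 ht1 => ?_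
  have he1 : Env n s1 := he.congr fun r hr => q1 r (by omega)
  have hcw : Function.minimalPeriod π i < 2 ^ w := by omega
  simp only [mov, ↓wp_seq, ↓wp_store, ↓wp_bin, BinOp.eval, he1.r4, he1.r5, he1.r0, x1, buildLayout,
    Nat.reduceLT, if_false, hn, hw, hw0, hcw, true_and, Nat.sub_zero]
  refine wp_grow hw (Function.minimalPeriod π i) (p := 0) (st := 0) (link := n) (side := 0)
    (seg := orbit π i) ?_ (by simp) (by simp [setCell_apply]) (by simp [setCell_apply])
    (by simp [setCell_apply]) (by simp [setCell_apply]) (by simp) ?_ (nodup_orbit i) ?_ (by omega)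
    (by omega) le_rfl (by omega) hpos fun s2 t2 T q2 x2 i2 r2 c2 p2 f2 ht2 => ?_
  · exact he1.congr fun r hr => by simp only [Function.update_apply]; rw [if_neg (by omega)]
  · intro a ha
    rw [← y1 a ha]
    simp [setCell_apply]
  · intro x hx
    have : s1.mem 3 x = 0 := by rw [m1 3 (by omega), h3]
    simpa [setCell_apply] using this
  have f2' : ∀ c v, c < 7 → ¬ (c < 5 ∧ c ≠ 3 ∧ ∃ y ∈ orbit π i, v = (y : ℕ)) →
      s2.mem c v = s.mem c v := by
    intro c v hc h
    rw [f2 c v h (by omega)]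
    simp only [setCell_apply]
    rw [if_neg (by omega), if_neg (by omega), if_neg (by omega), if_neg (by omega), m1 c (by omega)]
  have q2' : ∀ r, r < 12 → s2.reg r = s.reg r := fun r hr => by
    rw [q2 r (by omega)]
    simp only [Function.update_apply]
    rw [if_neg (by omega), q1 r hr]
  have he2 : Env n s2 := he.congr fun r hr => q2' r (by omega)
  have hcnt : s2.mem 5 0 = s.mem 5 0 := f2' 5 0 (by omega) (by omega)
  have hmod : (s.mem 5 0 + 1) % 2 ^ w = s.mem 5 0 + 1 := Nat.mod_eq_of_lt (by omega)
  rw [growCmd, wp_loop, if_neg (by simp [Test.eval, x2, he2.r4])]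
  simp only [↓wp_seq, ↓wp_load, ↓wp_bin, ↓wp_store, BinOp.eval, Function.update_apply, he2.r4, he2.r5,
    hcnt, hmod, buildLayout, fstLayout, Nat.reduceLT, Nat.reduceEqDiff, if_true, if_false, true_and,
    Nat.zero_lt_one, or_true, lt_two_pow_clog (show s.mem 5 0 + 1 ≤ n by omega)]
  refine k _ _ (unfold false T) ?_ ⟨T, rfl, c2.congr_matrix fun c hc x _ => by
    dsimp only; exact setCell_ne (by omega)⟩ i2
    ?_ ?_ ?_ ?_ ?_
  · intro r hr hr'
    simp only [Function.update_apply]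
    rw [if_neg hr, if_neg hr, q2' r hr']
  · have := Real.logb_nonneg (b := 2) (x := (Function.minimalPeriod π i + 1 : ℕ)) (by norm_num)
      (by push_cast; linarith [(Nat.cast_nonneg (Function.minimalPeriod π i) : (0 : ℝ) ≤ _)])
    rw [length_orbit]
    linarith
  · simp [setCell_apply]
  · intro x hx
    have := c2.size_ne_zero x ((perm_inorder_unfold false T).mem_iff.1 (i2 ▸ hx))
    simpa [setCell_apply] using this
  · intro c v hc hc5 h
    rw [← f2' c v hc h]
    exact setCell_ne (by omega)
  · rw [length_orbit]; omega

/-- After the construction for the elements below `i`, the forest consists of the trees `Ts`. -/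
structure Partial (A : Memory) (π : Equiv.Perm (Fin n)) (i : ℕ)
    (Ts : List (BinaryTree (Fin n))) : Prop where
  holds : Holds A Ts
  follows : ∀ T ∈ Ts, Follows (inorder T) π
  counter : A 5 0 = numTrees Ts
  seen : ∀ x : Fin n, x < i → x ∈ Ts.flatMap inorder
  size : ∀ x : Fin n, A 2 x = 0 ↔ x ∉ Ts.flatMap inorder
  sign : ∀ x : Fin n, A 3 x = 0
  input : ∀ x : Fin n, A 6 x = π x
  pot_le : forestPot Ts ≤ 2 * (Ts.flatMap inorder).length

/-- Build the forest of the permutation in array 6. Elements that are in a tree already are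
recognized by their size, which is initially zero. -/
def buildCmd : Cmd :=
  .seq (.const 5 1) <| .loop (.lt 10 0) <|
    .seq (.load 11 2 10) <| .seq (.branch (.eq 11 4) cycleCmd .skip) (.bin .add 10 10 5)

/-- Each element costs a constant number of steps in the main loop, and a constant number when it is
put into its tree. -/
theorem wp_build_loop (hw : n < 2 ^ w) : ∀ (d i : ℕ) {s : State} {t : ℕ}
    {Ts : List (BinaryTree (Fin n))}, i + d = n → Env n s → s.reg 10 = i → Partial s.mem π i Ts →
    (∀ s' t' Ts', Partial s'.mem π n Ts' →
      t' + 47 * (Ts.flatMap inorder).length ≤ t + 19 * d + 1 + 47 * (Ts'.flatMap inorder).length →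
      Q s' t') →
    Wp w (buildLayout n w) (.loop (.lt 10 0) <|
      .seq (.load 11 2 10) <| .seq (.branch (.eq 11 4) cycleCmd .skip) (.bin .add 10 10 5)) s t Q := by
  intro d
  induction d with
  | zero =>
    intro i s t Ts hd he h10 hP k
    rw [wp_loop, if_neg (by simp [Test.eval, he.r0, h10, ← hd])]
    obtain rfl : i = n := by omega
    exact k _ _ Ts hP (by omega)
  | succ d ih =>
    intro i s t Ts hd he h10 hP k
    have hi : i < n := by omega
    have hmod : (i + 1) % 2 ^ w = i + 1 := Nat.mod_eq_of_lt (by omega)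
    rw [wp_loop, if_pos (by simp [Test.eval, he.r0, h10, hi])]
    simp only [↓wp_seq, ↓wp_load, ↓wp_branch, ↓wp_skip, ↓wp_bin, Test.eval, BinOp.eval, h10, buildLayout,
      fstLayout, Nat.reduceLT, if_true, hi, true_and, Function.update_apply, Nat.reduceEqDiff, if_false,
      he.r4, he.r5, hmod, decide_eq_true_eq, OfNat.ofNat_ne_zero, OfNat.zero_ne_ofNat]
    by_cases h0 : s.mem 2 i = 0
    · rw [if_pos h0]
      have hnot := (hP.size ⟨i, hi⟩).1 h0
      have hnd : (⟨i, hi⟩ :: Ts.flatMap inorder).Nodup := List.nodup_cons.2 ⟨hnot, hP.holds.nodup⟩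
      have hlt : numTrees Ts < n := by
        have h1 := hnd.length_le_card
        rw [List.length_cons, Fintype.card_fin] at h1
        have := numTrees_le_length Ts
        omega
      refine wp_cycle hw (i := ⟨i, hi⟩) (he.congr fun r hr => ?_) (by simp [h10]) hP.input hP.sign
        (by dsimp only; rw [hP.counter]; exact hlt) fun s1 t1 T q1 r1 e1 p1 c1 z1 f1 ht1 => ?_
      · dsimp only; rw [Function.update_apply, if_neg (by omega)]
      dsimp only at c1 f1
      have q1' : ∀ r, r ≠ 6 → r < 11 → s1.reg r = s.reg r := fun r hr hr' => by
        rw [q1 r hr (by omega)]; dsimp only; rw [Function.update_apply, if_neg (by omega)]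
      have hdisj : ∀ x ∈ orbit π ⟨i, hi⟩, x ∉ Ts.flatMap inorder := by
        intro x hx hx'
        obtain ⟨U, hU, hxU⟩ := List.mem_flatMap.1 hx'
        have h1 := ((follows_orbit (π := π) ⟨i, hi⟩).sameCycle (nodup_orbit _) (mem_orbit_self _)).2 hx
        exact hnot (List.mem_flatMap.2 ⟨U, hU,
          ((hP.follows U hU).sameCycle (hP.holds.nodup_of_mem hU) hxU).1 h1.symm⟩)
      simp only [↓wp_bin, BinOp.eval, q1' 10 (by omega) (by omega), q1' 5 (by omega) (by omega), h10,
        he.r5, hmod]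
      refine ih (i + 1) (Ts := T :: Ts) (by omega) ?_ (by simp) ?_ fun s' t' Ts' hP' ht' => ?_
      · refine ⟨?_, ?_, ?_⟩
        · simp only [Function.update_apply]
          rw [if_neg (by omega), q1' 0 (by omega) (by omega), he.r0]
        · simp only [Function.update_apply]
          rw [if_neg (by omega), q1' 4 (by omega) (by omega), he.r4]
        · simp only [Function.update_apply]
          rw [if_neg (by omega), q1' 5 (by omega) (by omega), he.r5]
      · have hiT : (⟨i, hi⟩ : Fin n) ∈ inorder T := e1 ▸ mem_orbit_self _
        refine ⟨⟨?_, ?_⟩, ?_, ?_, ?_, ?_, ?_, ?_, ?_⟩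
        · rw [List.flatMap_cons, e1, List.nodup_append]
          exact ⟨nodup_orbit _, hP.holds.nodup, fun x hx y hy h => hdisj x hx (h ▸ hy)⟩
        · intro U hU
          rcases List.mem_cons.1 hU with rfl | hU
          · exact r1
          · obtain ⟨S, rfl, hS⟩ := hP.holds.rep U hU
            refine ⟨S, rfl, hS.congr_matrix fun c hc x hx => f1 c x (by omega) (by omega) ?_⟩
            rintro ⟨-, -, y, hy, h⟩
            obtain rfl : x = y := Fin.ext h
            exact hdisj x hy (List.mem_flatMap.2 ⟨_, hU, (perm_inorder_unfold _ _).mem_iff.2 hx⟩)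
        · intro U hU
          rcases List.mem_cons.1 hU with rfl | hU
          · rw [e1]; exact follows_orbit _
          · exact hP.follows U hU
        · rw [numTrees_cons_of_mem hiT, c1, hP.counter]
        · intro x hx
          rw [List.flatMap_cons, List.mem_append]
          rcases Nat.lt_or_ge x i with h | h
          · exact .inr (hP.seen x h)
          · obtain rfl : x = ⟨i, hi⟩ := Fin.ext (by simp; omega)
            exact .inl hiT
        · intro x
          rw [List.flatMap_cons, List.mem_append, e1]
          by_cases hx : x ∈ orbit π ⟨i, hi⟩
          · simp [hx, z1 x hx]
          · rw [f1 2 x (by omega) (by omega), hP.size x]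
            · simp [hx]
            · rintro ⟨-, -, y, hy, h⟩
              exact hx (Fin.ext h ▸ hy)
        · intro x
          rw [f1 3 x (by omega) (by omega) (by simp), hP.sign]
        · intro x
          rw [f1 6 x (by omega) (by omega) (by simp), hP.input]
        · rw [forestPot_cons, List.flatMap_cons, List.length_append, e1]
          have := hP.pot_le
          push_cast
          linarith
      · refine k s' t' Ts' hP' ?_
        rw [List.flatMap_cons, List.length_append, e1] at ht'
        omega
    · rw [if_neg h0]
      refine ih (i + 1) (Ts := Ts) (by omega) (he.congr fun r hr => ?_) (by simp) ?_
        fun s' t' Ts' hP' ht' => k s' t' Ts' hP' (by omega)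
      · simp only [Function.update_apply]
        rw [if_neg (by omega), if_neg (by omega)]
      · refine ⟨hP.holds, hP.follows, hP.counter, fun x hx => ?_, hP.size, hP.sign, hP.input, hP.pot_le⟩
        rcases Nat.lt_or_ge x i with h | h
        · exact hP.seen x h
        · obtain rfl : x = ⟨i, hi⟩ := Fin.ext (by simp; omega)
          by_contra hc
          exact h0 ((hP.size _).2 hc)

theorem exists_part {Ts : List (BinaryTree (Fin n))} (hnd : (Ts.flatMap inorder).Nodup)
    (hmem : ∀ x, x ∈ Ts.flatMap inorder) : ∃ F : Forest n, Part F Ts := by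
  choose F hF using fun x => List.mem_flatMap.1 (hmem x)
  refine ⟨F, hnd, hmem, fun T hT x hx => ?_⟩
  rw [List.nodup_flatMap] at hnd
  by_contra hne
  have : Std.Symm (Function.onFun List.Disjoint (inorder (α := Fin n))) := ⟨fun _ _ h => h.symm⟩
  have := hnd.2.forall (hF x).1 hT hne
  exact this (hF x).2 hx

theorem wp_build (hn : 1 ≤ n) (hw : n < 2 ^ w) (π : Equiv.Perm (Fin n)) :
    Wp w (buildLayout n w) buildCmd (buildState π) 0 fun s t => t ≤ 70 * n ∧
      ∃ Ts, IsForest s.mem π Ts ∧ forestPot Ts ≤ 2 * n := by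
  have h1 : 1 % 2 ^ w = 1 := Nat.mod_eq_of_lt (by omega)
  rw [buildCmd, wp_seq, wp_const, h1]
  refine wp_build_loop (π := π) hw n 0 (Ts := []) (by omega) ⟨?_, ?_, ?_⟩ ?_ ?_ fun s t Ts hP ht => ?_
  · simp [buildState]
  · simp [buildState]
  · simp
  · simp [buildState]
  · refine ⟨⟨by simp, by simp⟩, by simp, ?_, by simp, ?_, ?_, ?_, by simp [forestPot]⟩
    · simp [buildState, numTrees]
    · simp [buildState]
    · simp [buildState]
    · intro x; simp [buildState]
  · have hlen := hP.holds.nodup.length_le_card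
    rw [Fintype.card_fin] at hlen
    simp only [List.flatMap_nil, List.length_nil] at ht
    refine ⟨by omega, Ts, ⟨hP.holds, fun x => hP.seen x x.isLt, hP.follows, hP.counter⟩, ?_⟩
    have := hP.pot_le
    have h2 : ((Ts.flatMap inorder).length : ℝ) ≤ n := by exact_mod_cast hlen
    linarith

end

/-! ### Space -/

theorem fstBits_le {n : ℕ} (hn : 1 ≤ n) : (fstBits n : ℝ) ≤ 3 * n * Real.logb 2 n + 8 * n := by
  have hn' : (1 : ℝ) ≤ n := by exact_mod_cast hn
  have hbits : fstBits n = 3 * n * Nat.clog 2 (n + 1) + 2 * n + Nat.clog 2 (n + 1) := by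
    simp [fstBits, fstLayout, Finset.sum_range_succ]
    ring
  have hlog : (Nat.clog 2 (n + 1) : ℝ) ≤ Nat.log 2 n + 1 := by
    exact_mod_cast Nat.clog_le_of_le_pow (Nat.lt_pow_succ_log_self (by norm_num) n)
  have h1 : (Nat.log 2 n : ℝ) ≤ Real.logb 2 n := by
    have := Real.natLog_le_logb n 2
    exact_mod_cast this
  have h2 : (Nat.log 2 n : ℝ) ≤ n := by exact_mod_cast (Nat.log_le_self 2 n)
  rw [hbits]
  push_cast
  nlinarith

end FST

theorem theorem1 :
    ∃ (build : FST.Cmd) (prog : FST.OpName → FST.Cmd) (C K : ℕ),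
      ∀ (n : ℕ), 1 ≤ n →
        (FST.fstBits n : ℝ) ≤ 3 * n * Real.logb 2 n + C * n ∧
        ∀ (w : ℕ), n < 2 ^ w → ∀ (π : Equiv.Perm (Fin n)),
          ∃ (s : FST.State) (t : ℕ) (F : FST.Forest n),
            FST.Exec w (FST.buildLayout n w) build (FST.buildState π) s t ∧
            t ≤ C * n ∧
            FST.IsFST s.mem F π ∧
            ∀ (os : List (FST.Op n)), FST.AdmissibleSeq w os π →
              ∃ T : ℕ, FST.Serves w K prog s.mem F π os T ∧
                (T : ℝ) ≤ C * (n + os.length * (1 + Real.logb 2 n)) := by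
  refine ⟨FST.buildCmd, FST.opCmd, 12000, 40, fun n hn => ⟨?_, fun w hw π => ?_⟩⟩
  · have := FST.fstBits_le hn
    have h0 : (0 : ℝ) ≤ n := Nat.cast_nonneg n
    push_cast
    linarith
  · obtain ⟨s, t, hex, ht, Ts, hs, hpot⟩ := FST.wp_build hn hw π
    obtain ⟨F, hF⟩ := FST.exists_part hs.holds.nodup hs.mem
    refine ⟨s, t, F, hex, by omega, hs.isFST hF, fun os hos => ?_⟩
    obtain ⟨T, hT, hle⟩ := FST.serves hw os hs hF hos
    refine ⟨T, hT, hle.trans ?_⟩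
    have h0 : (0 : ℝ) ≤ n := Nat.cast_nonneg n
    rw [FST.cost]
    push_cast
    nlinarith
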